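/- **Theorem 1.** Let $c\in\mathbb C\setminus\{0\}$ with $|\arg c|<5\pi/6$, where $\arg c\in(-\pi,\pi]$ and $c^{1/3},c^{2/3}$ denote principal branches. Let $\mathcal L_c$ be the operator in $L_2(\mathbb R_+)$ given by $\mathcal L_c y=-y''+cxy$ on the domain $$\mathfrak D(\mathcal L_c)=\{y\in L_2(\mathbb R_+):\ y\in W^2_{2,\mathrm{loc}}[0,\infty),\ -y''+cxy\in L_2(\mathbb R_+),\ y(0)=0\}.$$ Let $\mathrm{Ai}$ be the Airy function, i.e. the entire solution of $y''=zy$ with $\mathrm{Ai}(0)=3^{-2/3}/\Gamma(2/3)$ and $\mathrm{Ai}'(0)=-3^{-1/3}/\Gamma(1/3)$. Then the zeros of $\mathrm{Ai}$ in $\mathbb C$ form an infinite sequence $-t_1>-t_2>\dots$ of negative real numbers; the eigenvalues of $\mathcal L_c$ are exactly the numbers $\lambda_n=t_nc^{2/3}$, $n=1,2,\dots$; each of them is simple (of algebraic multiplicity one), with eigenfunction $$y_n(x)=\mathrm{Ai}(-t_n+c^{1/3}x)\in L_2(\mathbb R_+);$$ and the system $\{y_n\}_{n\ge1}$ of eigenfunctions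 is complete in $L_2(\mathbb R_+)$ (its linear span is dense) and minimal in $L_2(\mathbb R_+)$ (no $y_n$ belongs to the closed linear span of the others). -/

import Mathlib

open MeasureTheory Set

/-- Maclaurin coefficients of the Airy function `Ai`: the recurrence expresses `y'' = z y`, and the
first two coefficients are the classical initial values `Ai(0)` and `Ai'(0)`. -/
noncomputable def airyCoeff : ℕ → ℝ
  | 0 => 1 / ((3 : ℝ) ^ (2 / 3 : ℝ) * Real.Gamma (2 / 3))
  | 1 => -(1 / ((3 : ℝ) ^ (1 / 3 : ℝ) * Real.Gamma (1 / 3)))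
  | 2 => 0
  | n + 3 => airyCoeff n / (((n : ℝ) + 2) * ((n : ℝ) + 3))

/-- The Airy function `Ai`, an entire function of a complex variable. -/
noncomputable def airyAi (z : ℂ) : ℂ := ∑' n : ℕ, (airyCoeff n : ℂ) * z ^ n

/-- The Hilbert space `L₂(ℝ₊)` of complex-valued functions. -/
abbrev L2HalfLine : Type := Lp ℂ 2 (volume.restrict (Ioi (0 : ℝ)))

/-- `u` belongs to `W²_{2,loc}[0,∞)`, with first derivative `v` and second derivative `w`: both `u`
and `v` are indefinite integrals (locally absolutely continuous), and `w` is square integrable on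
every `[0,b]`. -/
structure IsW22Loc (u v w : ℝ → ℂ) : Prop where
  integral_fst : ∀ x, 0 ≤ x → u x = u 0 + ∫ s in (0 : ℝ)..x, v s
  integral_snd : ∀ x, 0 ≤ x → v x = v 0 + ∫ s in (0 : ℝ)..x, w s
  memLp_snd : ∀ b, 0 ≤ b → MemLp w 2 (volume.restrict (Ioc 0 b))

namespace IsW22Loc

variable {u v w u' v' w' : ℝ → ℂ}

theorem intervalIntegrable_snd (h : IsW22Loc u v w) {x : ℝ} (hx : 0 ≤ x) :
    IntervalIntegrable w volume 0 x := by
  rw [intervalIntegrable_iff_integrableOn_Ioc_of_le hx]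
  exact (h.memLp_snd x hx).integrable (by norm_num)

theorem continuousOn_deriv (h : IsW22Loc u v w) (b : ℝ) (hb : 0 ≤ b) :
    ContinuousOn v (Icc 0 b) := by
  have h1 : ContinuousOn (fun x => v 0 + ∫ s in (0 : ℝ)..x, w s) (Icc 0 b) := by
    refine continuousOn_const.add ?_
    have := intervalIntegral.continuousOn_primitive_interval (f := w) (a := 0) (b := b)
      (μ := volume) (by
        have := h.intervalIntegrable_snd hb
        rw [uIcc_of_le hb, integrableOn_Icc_iff_integrableOn_Ioc]
        exact (intervalIntegrable_iff_integrableOn_Ioc_of_le hb).1 this)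
    rwa [uIcc_of_le hb] at this
  exact h1.congr fun x hx => h.integral_snd x hx.1

theorem intervalIntegrable_fst (h : IsW22Loc u v w) {x : ℝ} (hx : 0 ≤ x) :
    IntervalIntegrable v volume 0 x := by
  refine ContinuousOn.intervalIntegrable ?_
  rw [uIcc_of_le hx]
  exact h.continuousOn_deriv x hx

theorem zero : IsW22Loc (fun _ => 0) (fun _ => 0) (fun _ => 0) :=
  ⟨by simp, by simp, fun _ _ => MemLp.zero'⟩

theorem add (h : IsW22Loc u v w) (h' : IsW22Loc u' v' w') :
    IsW22Loc (fun x => u x + u' x) (fun x => v x + v' x) (fun x => w x + w' x) := by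
  refine ⟨fun x hx => ?_, fun x hx => ?_, fun b hb => (h.memLp_snd b hb).add (h'.memLp_snd b hb)⟩
  · rw [intervalIntegral.integral_add (h.intervalIntegrable_fst hx) (h'.intervalIntegrable_fst hx),
      h.integral_fst x hx, h'.integral_fst x hx]
    ring
  · rw [intervalIntegral.integral_add (h.intervalIntegrable_snd hx) (h'.intervalIntegrable_snd hx),
      h.integral_snd x hx, h'.integral_snd x hx]
    ring

theorem smul (a : ℂ) (h : IsW22Loc u v w) :
    IsW22Loc (fun x => a * u x) (fun x => a * v x) (fun x => a * w x) := by
  refine ⟨fun x hx => ?_, fun x hx => ?_, fun b hb => (h.memLp_snd b hb).const_mul a⟩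
  · rw [intervalIntegral.integral_const_mul, h.integral_fst x hx]
    ring
  · rw [intervalIntegral.integral_const_mul, h.integral_snd x hx]
    ring

theorem ae_zero_of_integral {g : ℝ → ℂ} (hg : ∀ x, 0 ≤ x → IntervalIntegrable g volume 0 x)
    (h0 : ∀ x, 0 ≤ x → ∫ s in (0 : ℝ)..x, g s = 0) :
    g =ᵐ[volume.restrict (Ioi (0 : ℝ))] fun _ => 0 := by
  rw [Filter.EventuallyEq, ae_restrict_iff' measurableSet_Ioi]
  have key : ∀ n : ℕ, ∀ᵐ x : ℝ, x ∈ uIcc (0 : ℝ) n → ∀ c ∈ uIcc (0 : ℝ) n,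
      HasDerivAt (fun y => ∫ s in c..y, g s) (g x) x :=
    fun n => (hg n n.cast_nonneg).ae_hasDerivAt_integral
  filter_upwards [ae_all_iff.2 key] with x hx hx0
  obtain ⟨n, hn⟩ := exists_nat_ge x
  have hd := hx n (by rw [uIcc_of_le n.cast_nonneg]; exact ⟨le_of_lt hx0, hn⟩) 0 left_mem_uIcc
  have hz : (fun y => ∫ s in (0 : ℝ)..y, g s) =ᶠ[nhds x] fun _ => 0 := by
    filter_upwards [Ioi_mem_nhds hx0] with y hy
    exact h0 y (le_of_lt hy)
  exact hd.unique ((hasDerivAt_const x (0 : ℂ)).congr_of_eventuallyEq hz)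

theorem continuousOn_self (h : IsW22Loc u v w) (b : ℝ) (hb : 0 ≤ b) :
    ContinuousOn u (Icc 0 b) := by
  have h1 : ContinuousOn (fun x => u 0 + ∫ s in (0 : ℝ)..x, v s) (Icc 0 b) := by
    refine continuousOn_const.add ?_
    have := intervalIntegral.continuousOn_primitive_interval (f := v) (a := 0) (b := b)
      (μ := volume) (by
        rw [uIcc_of_le hb]
        exact (h.continuousOn_deriv b hb).integrableOn_Icc)
    rwa [uIcc_of_le hb] at this
  exact h1.congr fun x hx => h.integral_fst x hx.1

/-- On `[0,∞)` a continuous function that vanishes almost everywhere vanishes identically. -/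
theorem eq_zero_of_ae {g : ℝ → ℂ} (hc : ∀ b, 0 ≤ b → ContinuousOn g (Icc 0 b))
    (h0 : g =ᵐ[volume.restrict (Ioi (0 : ℝ))] fun _ => 0) (x : ℝ) (hx : 0 ≤ x) : g x = 0 := by
  have hlt : (0 : ℝ) < x + 1 := by linarith
  have h1 : g =ᵐ[volume.restrict (Icc 0 (x + 1))] fun _ => 0 := by
    rw [← restrict_Ioc_eq_restrict_Icc]
    exact ae_mono (Measure.restrict_mono Ioc_subset_Ioi_self le_rfl) h0
  exact Measure.eqOn_Icc_of_ae_eq volume hlt.ne h1 (hc _ hlt.le) continuousOn_const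
    ⟨hx, by linarith⟩

/-- The second derivative is determined, almost everywhere, by the class of the function. -/
theorem snd_ae_zero (h : IsW22Loc u v w) (h0 : u =ᵐ[volume.restrict (Ioi (0 : ℝ))] fun _ => 0) :
    w =ᵐ[volume.restrict (Ioi (0 : ℝ))] fun _ => 0 := by
  have hu : ∀ x, 0 ≤ x → u x = 0 := eq_zero_of_ae h.continuousOn_self h0
  have hv : ∀ x, 0 ≤ x → v x = 0 := by
    refine eq_zero_of_ae h.continuousOn_deriv
      (ae_zero_of_integral (fun x hx => h.intervalIntegrable_fst hx) fun x hx => ?_)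
    have := h.integral_fst x hx
    rw [hu x hx, hu 0 le_rfl, zero_add] at this
    exact this.symm
  refine ae_zero_of_integral (fun x hx => h.intervalIntegrable_snd hx) fun x hx => ?_
  have := h.integral_snd x hx
  rw [hv x hx, hv 0 le_rfl, zero_add] at this
  exact this.symm

end IsW22Loc

/-- The graph of the Airy operator with Dirichlet condition: pairs `(y, f)` in `L₂(ℝ₊)` such that
`y` has a representative `u ∈ W²_{2,loc}` with `u(0) = 0` and `f = -u'' + c x u`. -/
noncomputable def airyGraph (c : ℂ) : Submodule ℂ (L2HalfLine × L2HalfLine) where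
  carrier := {p | ∃ u v w : ℝ → ℂ, IsW22Loc u v w ∧ u 0 = 0 ∧
    p.1 =ᵐ[volume.restrict (Ioi (0 : ℝ))] u ∧
    p.2 =ᵐ[volume.restrict (Ioi (0 : ℝ))] fun x => -w x + c * (x : ℂ) * u x}
  zero_mem' := by
    refine ⟨_, _, _, IsW22Loc.zero, rfl, Lp.coeFn_zero _ _ _, ?_⟩
    filter_upwards [Lp.coeFn_zero ℂ 2 (volume.restrict (Ioi (0 : ℝ)))] with x hx
    simpa using hx
  add_mem' := by
    rintro ⟨y, f⟩ ⟨y', f'⟩ ⟨u, v, w, h, h0, hy, hf⟩ ⟨u', v', w', h', h0', hy', hf'⟩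
    refine ⟨_, _, _, h.add h', by simp [h0, h0'], ?_, ?_⟩
    · filter_upwards [Lp.coeFn_add y y', hy, hy'] with x h1 h2 h3
      simp_all
    · filter_upwards [Lp.coeFn_add f f', hf, hf'] with x h1 h2 h3
      simp only [Prod.mk_add_mk] at *
      rw [h1, Pi.add_apply, h2, h3]
      ring
  smul_mem' := by
    rintro a ⟨y, f⟩ ⟨u, v, w, h, h0, hy, hf⟩
    refine ⟨_, _, _, h.smul a, by simp [h0], ?_, ?_⟩
    · filter_upwards [Lp.coeFn_smul a y, hy] with x h1 h2
      simp_all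
    · filter_upwards [Lp.coeFn_smul a f, hf] with x h1 h2
      simp only [Prod.smul_mk] at *
      rw [h1, Pi.smul_apply, h2, smul_eq_mul]
      ring

theorem airyGraph_singleValued (c : ℂ) (p : L2HalfLine × L2HalfLine) (hp : p ∈ airyGraph c)
    (h1 : p.1 = 0) : p.2 = 0 := by
  obtain ⟨u, v, w, h, -, hy, hf⟩ := hp
  rw [h1] at hy
  have hu : u =ᵐ[volume.restrict (Ioi (0 : ℝ))] fun _ => 0 :=
    hy.symm.trans (Lp.coeFn_zero _ _ _)
  refine Lp.ext ?_
  filter_upwards [hf, hu, h.snd_ae_zero hu, Lp.coeFn_zero ℂ 2 (volume.restrict (Ioi (0 : ℝ)))]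
    with x ha hb hc hd
  rw [ha, hb, hc, hd]
  simp

/-- The complex Airy operator `-d²/dx² + c x` in `L₂(ℝ₊)` with Dirichlet condition at `0`, on its
maximal domain. -/
noncomputable def airyOperator (c : ℂ) : L2HalfLine →ₗ.[ℂ] L2HalfLine :=
  (airyGraph c).toLinearPMap

theorem airyOperator_graph (c : ℂ) : (airyOperator c).graph = airyGraph c :=
  Submodule.toLinearPMap_graph_eq _ (airyGraph_singleValued c)

section Abstract

variable {H : Type*} [NormedAddCommGroup H] [NormedSpace ℂ H]

/-- `y` is an eigenvector of the unbounded operator `L` with eigenvalue `μ`. -/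
def IsEigenvectorOf (L : H →ₗ.[ℂ] H) (μ : ℂ) (y : H) : Prop :=
  y ≠ 0 ∧ ∃ hy : y ∈ L.domain, L ⟨y, hy⟩ = μ • y

/-- `rootSubspaceLevel L μ k` is the kernel of `(L - μ)^k`: a vector `y` lies in level `k + 1` if it
is in the domain of `L` and `L y - μ y` lies in level `k`. -/
def rootSubspaceLevel (L : H →ₗ.[ℂ] H) (μ : ℂ) : ℕ → Submodule ℂ H
  | 0 => ⊥
  | k + 1 => ((rootSubspaceLevel L μ k).comap
      (L.toFun - μ • L.domain.subtype)).map L.domain.subtype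

/-- The root subspace of `L` at `μ`: all eigenvectors and associated vectors. -/
def rootSubspace (L : H →ₗ.[ℂ] H) (μ : ℂ) : Submodule ℂ H := ⨆ k, rootSubspaceLevel L μ k

/-- `μ` is a simple eigenvalue of `L`: its algebraic multiplicity is one. -/
def IsSimpleEigenvalue (L : H →ₗ.[ℂ] H) (μ : ℂ) : Prop :=
  (∃ y, IsEigenvectorOf L μ y) ∧ Module.finrank ℂ (rootSubspace L μ) = 1

/-- A system is complete if its linear span is dense. -/
def IsCompleteSystem (e : ℕ → H) : Prop :=
  (Submodule.span ℂ (range e)).topologicalClosure = ⊤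

/-- A system is minimal if no element lies in the closed linear span of the others. -/
def IsMinimalSystem (e : ℕ → H) : Prop :=
  ∀ n, e n ∉ (Submodule.span ℂ (e '' {n}ᶜ)).topologicalClosure

end Abstract

/-! ### Power series with infinite radius of convergence -/

/-! Put ω = c^{1/3}. Then c = ω³, the eigenfunctions are Ai read along the rays z + ωx, and |arg ω|
< 5π/18 < π/3, a sector in which Ai decays faster than any exponential (`norm_airyAi_line_le`). The
zeros of Ai are real and negative by a monotonicity argument for Ai' times the conjugate of Ai,
infinite in number by Sturm comparison, and simple by uniqueness for the Airy equation.

The spectral statements come from one Green formula (`integral_graph_mul_airyAi_line`): if Ly = f,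
then f + ω²zy, paired bilinearly with Ai(z + ωx), gives y'(0)Ai(z). For an eigenpair and z = -μ/ω²
the pairing is zero and y'(0) ≠ 0, so Ai(z) = 0. When Ai(z) = 0, the formula says that the
eigenfunction annihilates the range of L - μ, whereas the integral of its own square is Ai'(z)²/ω ≠
0 (`integral_airyAi_line_sq`). This rules out associated vectors, and it makes the conjugate
eigenfunctions biorthogonal to the system up to scaling, whence minimality.

For completeness, let f be the conjugate of a function orthogonal to all eigenfunctions. The
transform F(z) = ∫ f(x) Ai(z + ωx) dx is entire and vanishes at the zeros of Ai, so G = F/Ai is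
entire. Lower bounds for |Ai| on large squares give G growth at most exp(B|z|^{3/2})
(`norm_le_of_norm_mul_airyAi_le`). Upper bounds for Ai(z + ωx) against saddle point lower bounds for
Ai(z) show that G tends to 0 along four rays whose gaps are all below 2π/3
(`airyPhase_neg_of_lower`, `airyPhase_neg_of_upper`). Phragmén–Lindelöf and Liouville then force G =
0 (`eq_zero_of_tendsto_rays`). The four rays exist because arg ω < 5π/18, after conjugation to make
it nonnegative; this is where 5π/6 enters. Finally F = 0 implies f = 0: by the Airy equation, F'' -
zF is ω times the transform of x f, so all moments of f(x)Ai(ωx) vanish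
(`ae_eq_zero_of_airyTransform_eq_zero`). -/

/-- Since n ≤ 2^n, the factor n produced by differentiation is absorbed by doubling the radius. -/
theorem norm_mul_natCast_mul_pow_pred_le (a z : ℂ) (n : ℕ) {R : ℝ} (hR : 0 < R) (hz : ‖z‖ ≤ R) :
    ‖a * (n * z ^ (n - 1))‖ ≤ ‖a‖ * (2 * R) ^ n * (1 / R) := by
  rw [norm_mul, norm_mul, norm_pow, Complex.norm_natCast, mul_assoc]
  refine mul_le_mul_of_nonneg_left ?_ (norm_nonneg _)
  rcases n with _ | n
  · simp [hR.le]
  · have h1 : ((n + 1 : ℕ) : ℝ) ≤ 2 ^ (n + 1) := by exact_mod_cast (Nat.lt_two_pow_self).le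
    have h2 : ‖z‖ ^ n ≤ R ^ n := pow_le_pow_left₀ (norm_nonneg _) hz n
    have h3 : (2 * R) ^ (n + 1) * (1 / R) = 2 ^ (n + 1) * R ^ n := by
      field_simp
      ring
    rw [h3, Nat.add_sub_cancel]
    exact mul_le_mul h1 h2 (by positivity) (by positivity)

theorem hasDerivAt_tsum_pow {a : ℕ → ℂ} (ha : ∀ r : ℝ, 0 ≤ r → Summable fun n => ‖a n‖ * r ^ n)
    (z : ℂ) :
    HasDerivAt (fun z => ∑' n, a n * z ^ n) (∑' n : ℕ, ((n : ℂ) + 1) * a (n + 1) * z ^ n) z := by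
  set R : ℝ := ‖z‖ + 1 with hR
  have hR0 : 0 < R := by positivity
  have hs := ha (2 * R) (by positivity)
  have h := hasDerivAt_tsum_of_isPreconnected (𝕜 := ℂ) (F := ℂ)
    (u := fun n => (‖a n‖ * (2 * R) ^ n) * (1 / R))
    (g := fun n z => a n * z ^ n) (g' := fun n z => a n * (n * z ^ (n - 1)))
    (t := Metric.ball 0 R) (y₀ := 0) (y := z) (hs.mul_right _) Metric.isOpen_ball
    (Metric.isPreconnected_ball) (fun n y _ => (hasDerivAt_pow n y).const_mul _)
    (fun n y hy => norm_mul_natCast_mul_pow_pred_le _ _ _ hR0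
      (mem_ball_zero_iff.1 hy).le)
    (Metric.mem_ball_self hR0)
    (summable_of_ne_finset_zero (s := {0}) fun n hn => by
      rw [Finset.mem_singleton] at hn
      simp [hn]) (by simp [hR])
  have hsum : Summable fun n : ℕ => a n * (n * z ^ (n - 1)) :=
    Summable.of_norm_bounded (hs.mul_right (1 / R)) fun n =>
      norm_mul_natCast_mul_pow_pred_le _ _ _ hR0 (by simp [hR])
  rw [hsum.tsum_eq_zero_add] at h
  refine h.congr_deriv ?_
  rw [Nat.cast_zero, zero_mul, mul_zero, zero_add]
  refine tsum_congr fun n => ?_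
  rw [Nat.add_sub_cancel]
  push_cast
  ring

theorem summable_norm_deriv_coeff {a : ℕ → ℂ}
    (ha : ∀ r : ℝ, 0 ≤ r → Summable fun n => ‖a n‖ * r ^ n) (r : ℝ) (hr : 0 ≤ r) :
    Summable fun n : ℕ => ‖((n : ℂ) + 1) * a (n + 1)‖ * r ^ n := by
  have hs := (ha (2 * (r + 1)) (by positivity))
  refine Summable.of_nonneg_of_le (fun n => by positivity) (fun n => ?_)
    (((summable_nat_add_iff 1).2 hs).mul_right (1 / (r + 1)))
  have := norm_mul_natCast_mul_pow_pred_le (a (n + 1)) r (n + 1) (R := r + 1) (by positivity)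
    (by rw [Complex.norm_real, Real.norm_of_nonneg hr]; linarith)
  refine le_trans (le_of_eq ?_) this
  rw [Nat.add_sub_cancel]
  simp only [norm_mul, norm_pow, Complex.norm_real, Real.norm_of_nonneg hr]
  push_cast
  ring

/-! ### Linear systems with vanishing initial data -/

/-- Grönwall for the pair (u, v) in the sup norm, with zero initial value and zero forcing. The
factor `α` is the speed of a complex line: it lets the lemma run along segments in ℂ as well as on
the half-line. -/
theorem eq_zero_of_linear_system {u v : ℝ → ℂ} {α : ℂ} {k : ℝ → ℂ} {K b : ℝ}
    (hu : ContinuousOn u (Icc 0 b)) (hv : ContinuousOn v (Icc 0 b))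
    (hu' : ∀ x ∈ Ico 0 b, HasDerivWithinAt u (α * v x) (Ici x) x)
    (hv' : ∀ x ∈ Ico 0 b, HasDerivWithinAt v (k x * u x) (Ici x) x)
    (hk : ∀ x ∈ Ico 0 b, ‖k x‖ ≤ K) (hu0 : u 0 = 0) (hv0 : v 0 = 0) :
    ∀ x ∈ Icc 0 b, u x = 0 ∧ v x = 0 := by
  intro x hx
  have h := norm_le_gronwallBound_of_norm_deriv_right_le (f := fun x => (u x, v x))
    (f' := fun x => (α * v x, k x * u x)) (δ := 0) (K := max ‖α‖ K) (ε := 0) (a := 0) (b := b)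
    (hu.prodMk hv) (fun x hx => (hu' x hx).prodMk (hv' x hx)) (by simp [hu0, hv0]) ?_ x hx
  · rw [gronwallBound_ε0] at h
    have h2 : ((u x, v x) : ℂ × ℂ) = 0 := by
      rw [← norm_le_zero_iff]
      simpa using h
    simpa using h2
  · intro x hx
    rw [add_zero, Prod.norm_def, Prod.norm_def]
    simp only [norm_mul]
    have h1 : 0 ≤ max ‖u x‖ ‖v x‖ := le_max_of_le_left (norm_nonneg _)
    refine max_le ?_ ?_
    · exact mul_le_mul (le_max_left _ _) (le_max_right _ _) (norm_nonneg _)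
        (le_max_of_le_left (norm_nonneg _))
    · exact mul_le_mul ((hk x hx).trans (le_max_right _ _)) (le_max_left _ _) (norm_nonneg _)
        (le_max_of_le_left (norm_nonneg _))

/-! ### The Airy function as a solution of the Airy equation -/

theorem airyCoeff_summable (r : ℝ) (hr : 0 ≤ r) :
    Summable fun n => ‖(airyCoeff n : ℂ)‖ * r ^ n := by
  simp only [Complex.norm_real, Real.norm_eq_abs]
  set R := r + 1 with hR
  have hR0 : 0 < R := by positivity
  -- Past this index (n + 2)(n + 3) ≥ R³, so the three-step recurrence makes |a_n| Rⁿ nonincreasing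
  -- along each residue class mod 3. Taking R = r + 1 leaves a convergent geometric series in r / R.
  obtain ⟨N, hN⟩ := exists_nat_ge (R ^ 3)
  have step : ∀ n, N ≤ n → |airyCoeff (n + 3)| * R ^ (n + 3) ≤ |airyCoeff n| * R ^ n := by
    intro n hn
    have hn' : (N : ℝ) ≤ n := by exact_mod_cast hn
    have hd : (0 : ℝ) < ((n : ℝ) + 2) * ((n : ℝ) + 3) := by positivity
    rw [airyCoeff, abs_div, abs_of_pos hd, pow_add]
    rw [div_mul_eq_mul_div, div_le_iff₀ hd]
    have : R ^ 3 ≤ ((n : ℝ) + 2) * ((n : ℝ) + 3) := by nlinarith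
    calc |airyCoeff n| * (R ^ n * R ^ 3) = |airyCoeff n| * R ^ n * R ^ 3 := by ring
      _ ≤ _ := by gcongr
  obtain ⟨M, hM⟩ : ∃ M, ∀ n ≤ N + 3, |airyCoeff n| * R ^ n ≤ M := by
    refine ⟨∑ n ∈ Finset.range (N + 4), |airyCoeff n| * R ^ n, fun n hn => ?_⟩
    exact Finset.single_le_sum (f := fun n => |airyCoeff n| * R ^ n)
      (fun i _ => by positivity) (Finset.mem_range.2 (by omega))
  have bound : ∀ n, |airyCoeff n| * R ^ n ≤ M := by
    intro n
    induction n using Nat.strong_induction_on with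
    | _ n ih =>
      by_cases hn : n ≤ N + 3
      · exact hM n hn
      · obtain ⟨m, rfl⟩ : ∃ m, n = m + 3 := ⟨n - 3, by omega⟩
        exact (step m (by omega)).trans (ih m (by omega))
  refine Summable.of_nonneg_of_le (fun n => by positivity) (fun n => ?_)
    ((summable_geometric_of_lt_one (r := r / R) (by positivity)
      ((div_lt_one hR0).2 (by simp [hR]))).mul_left M)
  have := bound n
  rw [div_pow, mul_div_assoc', le_div_iff₀ (by positivity)]
  calc |airyCoeff n| * r ^ n * R ^ n = |airyCoeff n| * R ^ n * r ^ n := by ring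
    _ ≤ _ := by gcongr

theorem airyAi_hasDerivAt (z : ℂ) : HasDerivAt airyAi (deriv airyAi z) z :=
  (hasDerivAt_tsum_pow airyCoeff_summable z).differentiableAt.hasDerivAt

theorem airyAi_differentiable : Differentiable ℂ airyAi := fun z =>
  (airyAi_hasDerivAt z).differentiableAt

theorem deriv_airyAi (z : ℂ) :
    deriv airyAi z = ∑' n : ℕ, ((n : ℂ) + 1) * airyCoeff (n + 1) * z ^ n :=
  (hasDerivAt_tsum_pow airyCoeff_summable z).deriv

/-- The Airy equation `Ai'' = z Ai`. -/
theorem deriv_airyAi_hasDerivAt (z : ℂ) : HasDerivAt (deriv airyAi) (z * airyAi z) z := by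
  have h := hasDerivAt_tsum_pow (summable_norm_deriv_coeff airyCoeff_summable) z
  rw [← funext deriv_airyAi] at h
  have hs := (summable_norm_deriv_coeff (summable_norm_deriv_coeff airyCoeff_summable)) ‖z‖
    (norm_nonneg _)
  have hs' : Summable fun n : ℕ =>
      ((n : ℂ) + 1) * (((n + 1 : ℕ) + 1 : ℂ) * airyCoeff (n + 1 + 1)) * z ^ n := by
    refine Summable.of_norm ?_
    simpa only [norm_mul, norm_pow] using hs
  rw [hs'.tsum_eq_zero_add] at h
  refine h.congr_deriv (Eq.symm ?_)
  rw [airyAi, ← tsum_mul_left]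
  have h2 : airyCoeff (0 + 1 + 1) = 0 := rfl
  rw [h2]
  simp only [Complex.ofReal_zero, mul_zero, zero_mul, zero_add]
  refine tsum_congr fun n => ?_
  have h3 : airyCoeff (n + 1 + 1 + 1) = airyCoeff n / (((n : ℝ) + 2) * ((n : ℝ) + 3)) := rfl
  rw [h3]
  push_cast
  have h4 : (n : ℂ) + 2 ≠ 0 := by exact_mod_cast (by positivity : (n : ℝ) + 2 ≠ 0)
  have h5 : (n : ℂ) + 3 ≠ 0 := by exact_mod_cast (by positivity : (n : ℝ) + 3 ≠ 0)
  rw [show (n : ℂ) + 1 + 1 + 1 = n + 3 by ring, show (n : ℂ) + 1 + 1 = n + 2 by ring]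
  field_simp
  ring

theorem airyAi_conj (z : ℂ) : airyAi (starRingEnd ℂ z) = starRingEnd ℂ (airyAi z) := by
  rw [airyAi, airyAi, Complex.conj_tsum]
  refine tsum_congr fun n => ?_
  simp

theorem deriv_airyAi_conj (z : ℂ) :
    deriv airyAi (starRingEnd ℂ z) = starRingEnd ℂ (deriv airyAi z) := by
  rw [deriv_airyAi, deriv_airyAi, Complex.conj_tsum]
  refine tsum_congr fun n => ?_
  simp

theorem airyAi_ofReal_im (x : ℝ) : (airyAi x).im = 0 := by
  have := airyAi_conj x
  rw [Complex.conj_ofReal] at this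
  exact Complex.conj_eq_iff_im.1 this.symm

theorem deriv_airyAi_ofReal_im (x : ℝ) : (deriv airyAi x).im = 0 := by
  have := deriv_airyAi_conj x
  rw [Complex.conj_ofReal] at this
  exact Complex.conj_eq_iff_im.1 this.symm

theorem airyAi_zero_ne : airyAi 0 ≠ 0 := by
  have h : airyAi 0 = airyCoeff 0 := by
    rw [airyAi, tsum_eq_single 0 (fun n hn => by simp [hn])]
    simp
  rw [h, airyCoeff]
  have : 0 < Real.Gamma (2 / 3) := Real.Gamma_pos_of_pos (by norm_num)
  exact_mod_cast (by positivity : (1 / ((3 : ℝ) ^ (2 / 3 : ℝ) * Real.Gamma (2 / 3))) ≠ 0)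

section Line

variable (z ω : ℂ) (x : ℝ)

theorem hasDerivAt_airyAi_line :
    HasDerivAt (fun x : ℝ => airyAi (z + ω * x)) (ω * deriv airyAi (z + ω * x)) x := by
  have h1 : HasDerivAt (fun x : ℝ => z + ω * (x : ℂ)) ω x := by
    simpa using ((Complex.ofRealCLM.hasDerivAt (x := x)).const_mul ω).const_add z
  have := (airyAi_hasDerivAt (z + ω * x)).comp x h1
  rwa [mul_comm] at this

theorem hasDerivAt_deriv_airyAi_line :
    HasDerivAt (fun x : ℝ => deriv airyAi (z + ω * x))
      (ω * ((z + ω * x) * airyAi (z + ω * x))) x := by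
  have h1 : HasDerivAt (fun x : ℝ => z + ω * (x : ℂ)) ω x := by
    simpa using ((Complex.ofRealCLM.hasDerivAt (x := x)).const_mul ω).const_add z
  have := (deriv_airyAi_hasDerivAt (z + ω * x)).comp x h1
  rwa [mul_comm] at this

end Line

theorem airyAi_continuous : Continuous airyAi := airyAi_differentiable.continuous

theorem deriv_airyAi_differentiable : Differentiable ℂ (deriv airyAi) :=
  fun z => (deriv_airyAi_hasDerivAt z).differentiableAt

theorem deriv_airyAi_continuous : Continuous (deriv airyAi) :=
  deriv_airyAi_differentiable.continuous

theorem continuous_airyAi_line (z ω : ℂ) : Continuous fun x : ℝ => airyAi (z + ω * x) :=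
  airyAi_continuous.comp (by fun_prop)

theorem continuous_deriv_airyAi_line (z ω : ℂ) :
    Continuous fun x : ℝ => deriv airyAi (z + ω * x) :=
  deriv_airyAi_continuous.comp (by fun_prop)

/-- The zeros of the Airy function are simple. -/
theorem deriv_airyAi_ne_zero {z : ℂ} (hz : airyAi z = 0) : deriv airyAi z ≠ 0 := by
  intro hz'
  -- The segment from z at time 0 to the origin at time 1: vanishing Cauchy data at z would
  -- propagate to Ai(0) = 0.
  have h := eq_zero_of_linear_system (u := fun x : ℝ => airyAi (z + -z * x))
    (v := fun x : ℝ => deriv airyAi (z + -z * x)) (α := -z)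
    (k := fun x => -z * (z + -z * x)) (K := ‖z‖ * (‖z‖ + ‖z‖ * 1)) (b := 1)
    (continuous_airyAi_line _ _).continuousOn (continuous_deriv_airyAi_line _ _).continuousOn
    (fun x _ => (hasDerivAt_airyAi_line z (-z) x).hasDerivWithinAt)
    (fun x _ => by
      simpa only [mul_assoc] using (hasDerivAt_deriv_airyAi_line z (-z) x).hasDerivWithinAt)
    (fun x hx => by
      rw [norm_mul, norm_neg]
      gcongr
      refine (norm_add_le _ _).trans ?_
      rw [norm_mul, norm_neg, Complex.norm_real, Real.norm_of_nonneg hx.1]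
      gcongr
      exact hx.2.le) (by simpa using hz) (by simpa using hz') 1 (by simp)
  have h1 := h.1
  simp only [Complex.ofReal_one, mul_one, add_neg_cancel] at h1
  exact airyAi_zero_ne h1

/-! ### Contour integrals for the Airy function -/

/-- The moments of `exp (-r³/3)` on the half-line. -/
noncomputable def cubicMoment (n : ℕ) : ℝ := ∫ r in Ioi (0 : ℝ), r ^ n * Real.exp (-(r ^ 3 / 3))

theorem cubicMoment_eq (n : ℕ) :
    cubicMoment n = 3 ^ (((n : ℝ) + 1) / 3) * (1 / 3) * Real.Gamma (((n : ℝ) + 1) / 3) := by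
  have h := integral_rpow_mul_exp_neg_mul_rpow (p := 3) (q := n) (b := 1 / 3) (by norm_num)
    (by have : (0 : ℝ) ≤ n := n.cast_nonneg
        linarith) (by norm_num)
  have h2 : (1 / 3 : ℝ) ^ (-((n : ℝ) + 1) / 3) = 3 ^ (((n : ℝ) + 1) / 3) := by
    rw [one_div, Real.inv_rpow (by norm_num), ← Real.rpow_neg (by norm_num)]
    congr 1
    ring
  rw [h2] at h
  rw [← h, cubicMoment]
  refine setIntegral_congr_fun measurableSet_Ioi fun r _ => ?_
  simp only [Real.rpow_natCast]
  rw [show (3 : ℝ) = ((3 : ℕ) : ℝ) by norm_num, Real.rpow_natCast]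
  congr 2
  push_cast
  ring

theorem cubicMoment_add_three (n : ℕ) : cubicMoment (n + 3) = (n + 1) * cubicMoment n := by
  rw [cubicMoment_eq, cubicMoment_eq]
  have h : (((n + 3 : ℕ) : ℝ) + 1) / 3 = ((n : ℝ) + 1) / 3 + 1 := by
    push_cast
    ring
  rw [h, Real.Gamma_add_one (by positivity), Real.rpow_add (by norm_num), Real.rpow_one]
  ring

/-- Both sides obey the same three-step recurrence: the moment gains a factor n + 1, while the signs
from (-1)ⁿ and the sine cancel. The starting values agree by the reflection formula Γ(1/3)Γ(2/3) =
2π/√3, and sin π = 0 gives the missing coefficient. This form turns the Taylor series of Ai into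
exponential integrals. -/
theorem airyCoeff_eq (n : ℕ) : airyCoeff n =
    (-1) ^ n * Real.sin (Real.pi * (n + 1) / 3) * cubicMoment n / (Real.pi * n.factorial) := by
  have hpi := Real.pi_pos
  have hG : Real.Gamma (1 / 3) * Real.Gamma (2 / 3) = Real.pi / (√3 / 2) := by
    have := Real.Gamma_mul_Gamma_one_sub (1 / 3)
    rw [show (1 : ℝ) - 1 / 3 = 2 / 3 by norm_num, show Real.pi * (1 / 3) = Real.pi / 3 by ring,
      Real.sin_pi_div_three] at this
    exact this
  have hG1 : 0 < Real.Gamma (1 / 3) := Real.Gamma_pos_of_pos (by norm_num)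
  have hG2 : 0 < Real.Gamma (2 / 3) := Real.Gamma_pos_of_pos (by norm_num)
  have h3 : (3 : ℝ) ^ (1 / 3 : ℝ) * 3 ^ (2 / 3 : ℝ) = 3 := by
    rw [← Real.rpow_add (by norm_num)]
    norm_num
  have hr1 : 0 < (3 : ℝ) ^ (1 / 3 : ℝ) := by positivity
  have hr2 : 0 < (3 : ℝ) ^ (2 / 3 : ℝ) := by positivity
  have hs : 0 < √(3 : ℝ) := by positivity
  have hG' : Real.Gamma (1 / 3) * Real.Gamma (2 / 3) * √3 = 2 * Real.pi := by
    rw [hG]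
    field_simp
  induction n using Nat.strong_induction_on with
  | _ n ih =>
    match n, ih with
    | 0, _ =>
      rw [cubicMoment_eq, airyCoeff]
      have : Real.sin (Real.pi * ((0 : ℕ) + 1) / 3) = √3 / 2 := by
        rw [← Real.sin_pi_div_three]
        congr 1
        push_cast
        ring
      rw [this]
      simp only [Nat.cast_zero, zero_add, pow_zero, one_mul, Nat.factorial_zero, Nat.cast_one,
        mul_one]
      rw [div_eq_div_iff (by positivity) (by positivity)]
      linear_combination (-(1 / 6) * √3 * Real.Gamma (1 / 3) * Real.Gamma (2 / 3)) * h3 -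
        (1 / 2) * hG'
    | 1, _ =>
      rw [cubicMoment_eq, airyCoeff]
      have : Real.sin (Real.pi * ((1 : ℕ) + 1) / 3) = √3 / 2 := by
        rw [← Real.sin_pi_div_three, ← Real.sin_pi_sub]
        congr 1
        push_cast
        ring
      rw [this]
      simp only [Nat.cast_one, pow_one, Nat.factorial_one, mul_one,
        show ((1 : ℝ) + 1) / 3 = 2 / 3 by norm_num]
      rw [← neg_div, div_eq_div_iff (by positivity) (by positivity)]
      linear_combination ((1 / 6) * √3 * Real.Gamma (1 / 3) * Real.Gamma (2 / 3)) * h3 +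
        (1 / 2) * hG'
    | 2, _ =>
      have : Real.sin (Real.pi * ((2 : ℕ) + 1) / 3) = 0 := by
        rw [← Real.sin_pi]
        congr 1
        push_cast
        ring
      rw [this]
      simp [airyCoeff]
    | m + 3, ih =>
      rw [airyCoeff, ih m (by omega), cubicMoment_add_three]
      have : Real.sin (Real.pi * ((m + 3 : ℕ) + 1) / 3) = -Real.sin (Real.pi * (m + 1) / 3) := by
        rw [← Real.sin_add_pi]
        congr 1
        push_cast
        ring
      rw [this]
      simp only [Nat.factorial_succ]
      push_cast
      have hf : (m.factorial : ℝ) ≠ 0 := by positivity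
      field_simp
      ring

theorem integrableOn_exp_linear_sub_cube (K : ℝ) :
    IntegrableOn (fun r : ℝ => Real.exp (K * r - r ^ 3 / 3)) (Ioi 0) := by
  refine integrable_of_isBigO_exp_neg (b := 1) one_pos (by fun_prop) ?_
  refine Asymptotics.IsBigO.of_bound 1 ?_
  -- Beyond this point r²/3 exceeds K + 1, so the exponent is at most -r.
  filter_upwards [Filter.eventually_ge_atTop (3 * (|K| + 1))] with r hr
  rw [one_mul, Real.norm_of_nonneg (Real.exp_pos _).le, Real.norm_of_nonneg (Real.exp_pos _).le]
  refine Real.exp_le_exp.2 ?_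
  have hK := le_abs_self K
  have hK0 := abs_nonneg K
  have hr0 : 0 ≤ r := by linarith
  have h1 : (K + 1) * r ≤ (r / 3) * r := by gcongr; linarith
  have h2 : r * r ≤ r * r * r := le_mul_of_one_le_right (by positivity) (by linarith)
  nlinarith

/-- Expand exp(wr) and integrate term by term; the series of absolute values sums to exp(‖w‖r -
r³/3), which is integrable. -/
theorem hasSum_integral_exp_neg_cube (w : ℂ) :
    HasSum (fun n : ℕ => w ^ n / n.factorial * (cubicMoment n : ℂ))
      (∫ r in Ioi (0 : ℝ), Complex.exp (w * r - r ^ 3 / 3)) := by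
  have h := hasSum_integral_of_dominated_convergence (μ := volume.restrict (Ioi (0 : ℝ)))
    (F := fun (n : ℕ) (r : ℝ) => w ^ n / n.factorial * ((r ^ n * Real.exp (-(r ^ 3 / 3)) : ℝ) : ℂ))
    (f := fun r : ℝ => Complex.exp (w * r - r ^ 3 / 3))
    (fun n r => (‖w‖ * r) ^ n / n.factorial * Real.exp (-(r ^ 3 / 3)))
    (fun n => (by fun_prop : Continuous _).aestronglyMeasurable) ?_ ?_ ?_ ?_
  · simpa only [integral_const_mul, integral_complex_ofReal, cubicMoment] using h
  · intro n
    filter_upwards [ae_restrict_mem measurableSet_Ioi] with r hr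
    have hr : 0 < r := hr
    rw [norm_mul, norm_div, norm_pow, Complex.norm_natCast, Complex.norm_real, Real.norm_of_nonneg
      (by positivity), mul_pow]
    apply le_of_eq
    ring
  · refine Filter.Eventually.of_forall fun r => ?_
    exact (Real.summable_pow_div_factorial _).mul_right _
  · have : (fun r : ℝ => ∑' n : ℕ, (‖w‖ * r) ^ n / n.factorial * Real.exp (-(r ^ 3 / 3))) =
        fun r => Real.exp (‖w‖ * r - r ^ 3 / 3) := by
      funext r
      rw [tsum_mul_right, sub_eq_add_neg, Real.exp_add, Real.exp_eq_exp_ℝ,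
        NormedSpace.exp_eq_tsum_div]
    rw [this]
    exact integrableOn_exp_linear_sub_cube _
  · refine Filter.Eventually.of_forall fun r => ?_
    have := (NormedSpace.expSeries_div_hasSum_exp (w * r)).mul_right
      ((Real.exp (-(r ^ 3 / 3)) : ℝ) : ℂ)
    rw [← Complex.exp_eq_exp_ℂ, Complex.ofReal_exp, ← Complex.exp_add] at this
    convert! this using 1
    · funext n
      push_cast
      rw [mul_pow]
      ring
    · congr 1
      push_cast
      ring

/-- The point `exp (iπ/3)`. -/
noncomputable def rayDir : ℂ := 1 / 2 + (√3 / 2 : ℝ) * Complex.I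

theorem rayDir_eq_exp : rayDir = Complex.exp ((Real.pi / 3 : ℝ) * Complex.I) := by
  rw [Complex.exp_mul_I, ← Complex.ofReal_cos, ← Complex.ofReal_sin, Real.cos_pi_div_three,
    Real.sin_pi_div_three, rayDir]
  push_cast
  rfl

theorem rayDir_pow_three : rayDir ^ 3 = -1 := by
  rw [rayDir_eq_exp, ← Complex.exp_nat_mul, ← Complex.exp_pi_mul_I]
  congr 1
  push_cast
  ring

theorem rayDir_pow_sub (n : ℕ) : rayDir ^ n - starRingEnd ℂ rayDir ^ n =
    2 * Complex.I * (Real.sin (Real.pi * n / 3) : ℝ) := by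
  have h : rayDir ^ n = Complex.exp ((Real.pi * n / 3 : ℝ) * Complex.I) := by
    rw [rayDir_eq_exp, ← Complex.exp_nat_mul]
    congr 1
    push_cast
    ring
  rw [← map_pow, h, Complex.sub_conj, Complex.exp_ofReal_mul_I_im]
  push_cast
  ring

/-- `Ai` as a contour integral along the two rays `arg t = ±π/3`. -/
theorem airyAi_eq_ray_integrals (z : ℂ) : 2 * Real.pi * Complex.I * airyAi z =
    rayDir * (∫ r in Ioi (0 : ℝ), Complex.exp (-(z * rayDir) * r - r ^ 3 / 3)) -
    starRingEnd ℂ rayDir *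
      ∫ r in Ioi (0 : ℝ), Complex.exp (-(z * starRingEnd ℂ rayDir) * r - r ^ 3 / 3) := by
  have h1 := (hasSum_integral_exp_neg_cube (-(z * rayDir))).mul_left rayDir
  have h2 := (hasSum_integral_exp_neg_cube (-(z * starRingEnd ℂ rayDir))).mul_left
    (starRingEnd ℂ rayDir)
  rw [← (h1.sub h2).tsum_eq, airyAi, ← tsum_mul_left]
  refine tsum_congr fun n => ?_
  have h3 := rayDir_pow_sub (n + 1)
  have h4 : Real.sin (Real.pi * ((n + 1 : ℕ) : ℝ) / 3) = Real.sin (Real.pi * (n + 1) / 3) := by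
    push_cast
    rfl
  rw [h4] at h3
  rw [airyCoeff_eq]
  have hpi : (Real.pi : ℂ) ≠ 0 := by exact_mod_cast Real.pi_ne_zero
  have hf : (n.factorial : ℂ) ≠ 0 := by exact_mod_cast n.factorial_ne_zero
  rw [neg_pow (z * rayDir), neg_pow (z * starRingEnd ℂ rayDir), mul_pow z, mul_pow z]
  have h5 : 2 * (Real.pi : ℂ) * Complex.I * (((-1) ^ n * Real.sin (Real.pi * (n + 1) / 3) *
      cubicMoment n / (Real.pi * n.factorial) : ℝ) : ℂ) * z ^ n =
      (-1) ^ n * z ^ n / n.factorial * cubicMoment n *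
        (2 * Complex.I * (Real.sin (Real.pi * (n + 1) / 3) : ℝ)) := by
    push_cast
    field_simp
  rw [← mul_assoc, h5, ← h3, pow_succ, pow_succ]
  ring

theorem norm_exp_cube_sub (z t : ℂ) : ‖Complex.exp (t ^ 3 / 3 - z * t)‖ =
    Real.exp (t.re ^ 3 / 3 - t.re * t.im ^ 2 - (z.re * t.re - z.im * t.im)) := by
  rw [Complex.norm_exp]
  congr 1
  have h3 : (t ^ 3 / 3).re = (t ^ 3).re / 3 := by
    rw [show (3 : ℂ) = ((3 : ℝ) : ℂ) by norm_num, Complex.div_ofReal_re]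
  rw [Complex.sub_re, h3, Complex.mul_re]
  simp only [pow_succ, pow_zero, one_mul, Complex.mul_re, Complex.mul_im]
  ring

theorem integrable_exp_cube_vertical (z : ℂ) {a : ℝ} (ha : 0 < a) :
    Integrable fun s : ℝ =>
      Complex.exp ((a + s * Complex.I) ^ 3 / 3 - z * (a + s * Complex.I)) := by
  have h := (integrable_cexp_quadratic (b := (a : ℂ)) (by simpa using ha) (z.im : ℂ)
    ((a ^ 3 / 3 - z.re * a : ℝ) : ℂ)).norm
  refine (integrable_norm_iff (by fun_prop)).1 (h.congr (Filter.Eventually.of_forall fun s => ?_))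
  simp only [norm_exp_cube_sub]
  rw [Complex.norm_exp]
  congr 1
  have h1 : -(a : ℂ) * (s : ℂ) ^ 2 + (z.im : ℂ) * s + ((a ^ 3 / 3 - z.re * a : ℝ) : ℂ) =
      ((-a * s ^ 2 + z.im * s + (a ^ 3 / 3 - z.re * a) : ℝ) : ℂ) := by
    push_cast
    ring
  rw [h1, Complex.ofReal_re]
  simp
  ring

/-- Bound for the Airy integrand on the horizontal segments that join the rays to a vertical
line. -/
theorem norm_exp_cube_sub_le (z t : ℂ) {a R : ℝ} (ha : 0 < a) (h1 : a ≤ t.re) (h2 : t.re ≤ R / 2)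
    (h3 : t.im ^ 2 = 3 / 4 * R ^ 2) :
    ‖Complex.exp (t ^ 3 / 3 - z * t)‖ ≤ Real.exp (2 * ‖z‖ * R - 2 / 3 * a * R ^ 2) := by
  rw [norm_exp_cube_sub]
  refine Real.exp_le_exp.2 ?_
  have hR : 0 < R := by linarith
  have h4 : |t.im| ≤ R := abs_le_of_sq_le_sq (by nlinarith) hR.le
  have h5 : -(z.re * t.re) ≤ ‖z‖ * R := by
    have := Complex.abs_re_le_norm z
    have : |z.re * t.re| ≤ ‖z‖ * R := by
      rw [abs_mul, abs_of_nonneg (by linarith : 0 ≤ t.re)]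
      exact mul_le_mul this (by linarith) (by linarith) (norm_nonneg _)
    linarith [neg_abs_le (z.re * t.re)]
  have h6 : z.im * t.im ≤ ‖z‖ * R := by
    have := Complex.abs_im_le_norm z
    have : |z.im * t.im| ≤ ‖z‖ * R := by
      rw [abs_mul]
      gcongr
    linarith [le_abs_self (z.im * t.im)]
  have h7 : t.re ^ 3 / 3 - t.re * t.im ^ 2 ≤ -(2 / 3 * a * R ^ 2) := by
    rw [h3]
    have : t.re ^ 2 ≤ (R / 2) ^ 2 := pow_le_pow_left₀ (by linarith) h2 2
    have h8 : t.re * (t.re ^ 2 / 3 - 3 / 4 * R ^ 2) ≤ a * (t.re ^ 2 / 3 - 3 / 4 * R ^ 2) :=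
      mul_le_mul_of_nonpos_right h1 (by nlinarith)
    nlinarith
  linarith

theorem tendsto_mul_exp_linear_sub_sq (K : ℝ) {b : ℝ} (hb : 0 < b) :
    Filter.Tendsto (fun R : ℝ => Real.exp (K * R - b * R ^ 2) * R) Filter.atTop (nhds 0) := by
  refine squeeze_zero' ?_ ?_ (Real.tendsto_pow_mul_exp_neg_atTop_nhds_zero 1)
  · filter_upwards [Filter.eventually_ge_atTop 0] with R hR
    positivity
  · filter_upwards [Filter.eventually_ge_atTop 0, Filter.eventually_ge_atTop ((K + 1) / b)]
      with R hR hR'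
    rw [pow_one, mul_comm]
    refine mul_le_mul_of_nonneg_left (Real.exp_le_exp.2 ?_) hR
    rw [div_le_iff₀ hb] at hR'
    nlinarith

/-- `Ai` as a contour integral along a vertical line. -/
theorem airyAi_eq_vertical_integral (z : ℂ) {a : ℝ} (ha : 0 < a) :
    2 * Real.pi * airyAi z =
      ∫ s : ℝ, Complex.exp ((a + s * Complex.I) ^ 3 / 3 - z * (a + s * Complex.I)) := by
  set g : ℂ → ℂ := fun t => Complex.exp (t ^ 3 / 3 - z * t) with hg
  have hgd : Differentiable ℂ g := by fun_prop
  have hgc : Continuous g := hgd.continuous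
  -- An entire primitive of the integrand replaces contour deformation: every path integral becomes
  -- a difference of values of P.
  obtain ⟨P, hP⟩ := hgd.isExactOn_univ
  replace hP : ∀ t, HasDerivAt P (g t) t := fun t => hP t (mem_univ t)
  have line : ∀ (p q : ℂ) (A B : ℝ), ∫ s in A..B, q * g (p + s * q) =
      P (p + B * q) - P (p + A * q) := by
    intro p q A B
    refine intervalIntegral.integral_eq_sub_of_hasDerivAt (f := fun s : ℝ => P (p + s * q))
      (fun s _ => ?_) (Continuous.intervalIntegrable (by fun_prop) _ _)
    have h1 : HasDerivAt (fun s : ℝ => p + (s : ℂ) * q) q s := by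
      simpa using ((Complex.ofRealCLM.hasDerivAt (x := s)).mul_const q).const_add p
    have := (hP (p + s * q)).comp s h1
    rwa [mul_comm] at this
  -- With q³ = -1 the cubic term on the ray is exactly -r³/3.
  have ray : ∀ q : ℂ, q ^ 3 = -1 → Filter.Tendsto (fun R : ℝ => P (R * q) - P 0) Filter.atTop
      (nhds (q * ∫ r in Ioi (0 : ℝ), Complex.exp (-(z * q) * r - r ^ 3 / 3))) := by
    intro q hq
    have hint : IntegrableOn (fun r : ℝ => q * Complex.exp (-(z * q) * r - r ^ 3 / 3))
        (Ioi 0) := by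
      refine Integrable.const_mul ?_ q
      refine (integrable_norm_iff (by fun_prop)).1
        ((integrableOn_exp_linear_sub_cube (-(z * q)).re).congr
          (Filter.Eventually.of_forall fun r => ?_))
      have h1 : -(z * q) * r - (r : ℂ) ^ 3 / 3 = -(z * q) * r - ((r ^ 3 / 3 : ℝ) : ℂ) := by
        push_cast
        rfl
      simp only [Complex.norm_exp]
      rw [h1, Complex.sub_re, Complex.re_mul_ofReal, Complex.ofReal_re]
    have h := intervalIntegral_tendsto_integral_Ioi 0 hint Filter.tendsto_id
    rw [integral_const_mul] at h
    refine h.congr fun R => ?_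
    have := line 0 q 0 R
    simp only [zero_add, Complex.ofReal_zero, zero_mul] at this
    rw [id, ← this]
    refine intervalIntegral.integral_congr fun r _ => ?_
    simp only [hg]
    congr 2
    rw [mul_pow, hq]
    ring
  -- The horizontal segments joining the ray points R·exp(±iπ/3) to the vertical line at the same
  -- heights; their contribution is at most R·exp(2‖z‖R - 2aR²/3).
  have seg : ∀ σ : ℝ, σ ^ 2 = 3 / 4 → Filter.Tendsto
      (fun R : ℝ => P (R * (1 / 2 + σ * Complex.I)) - P (a + (R * σ : ℝ) * Complex.I)) Filter.atTop
      (nhds 0) := by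
    intro σ hσ
    rw [tendsto_zero_iff_norm_tendsto_zero]
    refine squeeze_zero' (Filter.Eventually.of_forall fun R => norm_nonneg _) ?_
      (tendsto_mul_exp_linear_sub_sq (2 * ‖z‖) (b := 2 / 3 * a) (by positivity))
    filter_upwards [Filter.eventually_ge_atTop (2 * a)] with R hR
    have hre : ((R : ℂ) * (1 / 2 + σ * Complex.I)).re = R / 2 := by
      simp [Complex.mul_re]
      ring
    have him : ((R : ℂ) * (1 / 2 + σ * Complex.I)).im = R * σ := by
      simp [Complex.mul_im]
    have h := Convex.norm_image_sub_le_of_norm_hasDerivWithin_le (𝕜 := ℂ) (f := P) (f' := g)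
      (s := {t : ℂ | t.re ∈ Icc a (R / 2) ∧ t.im ∈ Icc (R * σ) (R * σ)})
      (x := a + (R * σ : ℝ) * Complex.I) (y := R * (1 / 2 + σ * Complex.I))
      (C := Real.exp (2 * ‖z‖ * R - 2 / 3 * a * R ^ 2))
      (fun t _ => (hP t).hasDerivWithinAt)
      (fun t ht => by
        refine norm_exp_cube_sub_le z t ha ht.1.1 ht.1.2 ?_
        have h1 : t.im = R * σ := le_antisymm ht.2.2 ht.2.1
        rw [h1, mul_pow, hσ]
        ring)
      (((convex_Icc a (R / 2)).linear_preimage Complex.reLm).inter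
        ((convex_Icc (R * σ) (R * σ)).linear_preimage Complex.imLm))
      (by simp; linarith)
      (by
        rw [mem_ofPred_eq, hre, him]
        simp; linarith)
    refine h.trans (mul_le_mul_of_nonneg_left ?_ (Real.exp_pos _).le)
    have h2 : (R : ℂ) * (1 / 2 + σ * Complex.I) - (a + (R * σ : ℝ) * Complex.I) =
        ((R / 2 - a : ℝ) : ℂ) := by
      push_cast
      ring
    rw [h2, Complex.norm_real, Real.norm_of_nonneg (by linarith)]
    linarith
  have h3 : (√3 / 2) ^ 2 = (3 / 4 : ℝ) := by
    rw [div_pow, Real.sq_sqrt (by norm_num)]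
    norm_num
  have hconj : starRingEnd ℂ rayDir = 1 / 2 + ((-(√3 / 2) : ℝ) : ℂ) * Complex.I := by
    have : (1 / 2 : ℂ) = ((1 / 2 : ℝ) : ℂ) := by push_cast; rfl
    rw [rayDir, this, map_add, map_mul, Complex.conj_ofReal, Complex.conj_ofReal, Complex.conj_I]
    push_cast
    ring
  have hlim1 := ((ray rayDir rayDir_pow_three).sub (ray (starRingEnd ℂ rayDir)
    (by rw [← map_pow, rayDir_pow_three]; simp)))
  rw [← airyAi_eq_ray_integrals, hconj, rayDir] at hlim1
  have hlim2 := (hlim1.sub (seg (√3 / 2) h3)).add (seg (-(√3 / 2)) (by rw [neg_sq, h3]))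
  have hvi := integrable_exp_cube_vertical z ha
  have hsq : 0 < √3 / 2 := by positivity
  have hlim3 := intervalIntegral_tendsto_integral (hvi.const_mul Complex.I)
    (a := fun R : ℝ => R * -(√3 / 2)) (b := fun R : ℝ => R * (√3 / 2)) (l := Filter.atTop)
    (by
      simp only [mul_neg]
      exact Filter.tendsto_neg_atTop_atBot.comp (Filter.tendsto_id.atTop_mul_const hsq))
    (Filter.tendsto_id.atTop_mul_const hsq)
  rw [integral_const_mul] at hlim3
  have heq := tendsto_nhds_unique hlim2 (hlim3.congr fun R => ?_)
  · rw [sub_zero, add_zero] at heq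
    refine mul_left_cancel₀ Complex.I_ne_zero ?_
    rw [← heq]
    ring
  · rw [line a Complex.I]
    ring

/-! ### Bounds for the Airy function -/

theorem integral_exp_neg_sq_add_linear {a : ℝ} (ha : 0 < a) (y d : ℝ) :
    ∫ s : ℝ, Real.exp (d - a * s ^ 2 + y * s) =
      √(Real.pi / a) * Real.exp (d + y ^ 2 / (4 * a)) := by
  have h : ∀ s : ℝ, Real.exp (d - a * s ^ 2 + y * s) =
      Real.exp (-a * (s - y / (2 * a)) ^ 2) * Real.exp (d + y ^ 2 / (4 * a)) := by
    intro s
    rw [← Real.exp_add]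
    congr 1
    field_simp
    ring
  simp_rw [h]
  rw [integral_mul_const, integral_sub_right_eq_self (fun s : ℝ => Real.exp (-a * s ^ 2)),
    integral_gaussian]

/-- Upper bound for `Ai`, with a free parameter `a > 0`. -/
theorem norm_airyAi_le (z : ℂ) {a : ℝ} (ha : 0 < a) :
    ‖airyAi z‖ ≤ 1 / √a * Real.exp (a ^ 3 / 3 - a * z.re + z.im ^ 2 / (4 * a)) := by
  have h := norm_integral_le_integral_norm (μ := volume)
    (fun s : ℝ => Complex.exp ((a + s * Complex.I) ^ 3 / 3 - z * (a + s * Complex.I)))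
  rw [← airyAi_eq_vertical_integral z ha] at h
  have h2 : ∀ s : ℝ, ‖Complex.exp ((a + s * Complex.I) ^ 3 / 3 - z * (a + s * Complex.I))‖ =
      Real.exp ((a ^ 3 / 3 - a * z.re) - a * s ^ 2 + z.im * s) := by
    intro s
    rw [norm_exp_cube_sub]
    congr 1
    simp
    ring
  simp_rw [h2] at h
  rw [integral_exp_neg_sq_add_linear ha, norm_mul, norm_mul, Complex.norm_real, Complex.norm_ofNat,
    Real.norm_of_nonneg Real.pi_pos.le, Real.sqrt_div Real.pi_pos.le] at h
  have hpi := Real.pi_gt_three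
  have h3 : √Real.pi ≤ 2 * Real.pi := by
    rw [Real.sqrt_le_left (by positivity)]
    nlinarith
  have h4 : 0 < √a := Real.sqrt_pos.2 ha
  have h5 : 2 * Real.pi * ‖airyAi z‖ ≤ 2 * Real.pi *
      (1 / √a * Real.exp (a ^ 3 / 3 - a * z.re + z.im ^ 2 / (4 * a))) := by
    refine h.trans ?_
    rw [← mul_assoc]
    refine mul_le_mul_of_nonneg_right ?_ (Real.exp_pos _).le
    rw [mul_one_div]
    gcongr
  exact le_of_mul_le_mul_left h5 (by positivity)

/-- The saddle point representation of `Ai`. -/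
theorem airyAi_sq_eq {q : ℂ} (hq : 0 < q.re) : 2 * Real.pi * airyAi (q ^ 2) =
    Complex.exp (-(2 / 3 * q ^ 3)) *
      ∫ s : ℝ, Complex.exp (-q * s ^ 2 - s ^ 3 / 3 * Complex.I) := by
  -- The line Re t = Re q passes through the saddle t = q of t³/3 - q²t; translating by Im q puts
  -- the saddle at s = 0.
  rw [airyAi_eq_vertical_integral _ hq, ← integral_add_right_eq_self _ q.im, ← integral_const_mul]
  congr 1
  funext s
  rw [← Complex.exp_add]
  congr 1
  have h : (q.re : ℂ) + ((s + q.im : ℝ) : ℂ) * Complex.I = q + s * Complex.I := by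
    conv_rhs => rw [← Complex.re_add_im q]
    push_cast
    ring
  rw [h]
  linear_combination (q * s ^ 2 + s ^ 3 / 3 * Complex.I) * Complex.I_sq

theorem integral_abs_cube_mul_gaussian {b : ℝ} (hb : 0 < b) :
    Integrable (fun s : ℝ => |s| ^ 3 * Real.exp (-b * s ^ 2)) ∧
      ∫ s : ℝ, |s| ^ 3 * Real.exp (-b * s ^ 2) = 1 / b ^ 2 := by
  have h0 := integral_rpow_mul_exp_neg_mul_rpow (p := 2) (q := 3) (b := b) (by norm_num)
    (by norm_num) hb
  have h1 : ∫ s in Ioi (0 : ℝ), s ^ 3 * Real.exp (-b * s ^ 2) = 1 / 2 * (1 / b ^ 2) := by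
    have e1 : b ^ (-(3 + 1) / 2 : ℝ) = 1 / b ^ 2 := by
      rw [show (-(3 + 1) / 2 : ℝ) = -((2 : ℕ) : ℝ) by norm_num, Real.rpow_neg hb.le,
        Real.rpow_natCast, one_div]
    have e2 : Real.Gamma ((3 + 1) / 2) = 1 := by
      rw [show ((3 : ℝ) + 1) / 2 = 2 by norm_num, Real.Gamma_two]
    rw [e1, e2] at h0
    rw [show (1 : ℝ) / 2 * (1 / b ^ 2) = 1 / b ^ 2 * (1 / 2) * 1 by ring, ← h0]
    refine setIntegral_congr_fun measurableSet_Ioi fun r _ => ?_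
    rw [show (3 : ℝ) = ((3 : ℕ) : ℝ) by norm_num, show (2 : ℝ) = ((2 : ℕ) : ℝ) by norm_num,
      Real.rpow_natCast, Real.rpow_natCast]
  have h2 : ∫ s : ℝ, |s| ^ 3 * Real.exp (-b * s ^ 2) = 1 / b ^ 2 := by
    have := integral_comp_abs (f := fun s : ℝ => s ^ 3 * Real.exp (-b * s ^ 2))
    simp only [sq_abs] at this
    rw [this, h1]
    ring
  refine ⟨?_, h2⟩
  -- Integrability is read off from the value: a nonintegrable function has integral 0 by
  -- convention, but this one equals 1/b² > 0.
  by_contra hn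
  rw [integral_undef hn] at h2
  have : 0 < 1 / b ^ 2 := by positivity
  linarith

theorem norm_exp_mul_I_sub_one_le (x : ℝ) : ‖Complex.exp (x * Complex.I) - 1‖ ≤ |x| := by
  have := Real.norm_exp_I_mul_ofReal_sub_one_le (x := x)
  rwa [mul_comm, Real.norm_eq_abs] at this

/-- Compare with the pure Gaussian: the factor exp(-is³/3) differs from 1 by at most |s|³/3, whose
integral against exp(-Re q · s²) is the subtracted error. -/
theorem norm_saddle_integral_ge {q : ℂ} (hq : 0 < q.re) :
    √(Real.pi / ‖q‖) - 1 / (3 * q.re ^ 2) ≤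
      ‖∫ s : ℝ, Complex.exp (-q * s ^ 2 - s ^ 3 / 3 * Complex.I)‖ := by
  have hn : ∀ s : ℝ, ‖Complex.exp (-q * s ^ 2)‖ = Real.exp (-q.re * s ^ 2) := by
    intro s
    rw [Complex.norm_exp]
    congr 1
    rw [← Complex.ofReal_pow, Complex.re_mul_ofReal, Complex.neg_re]
  have hgi : Integrable fun s : ℝ => Complex.exp (-q * s ^ 2) := by
    simpa using integrable_cexp_quadratic hq 0 0
  have hsplit : ∀ s : ℝ, Complex.exp (-q * s ^ 2 - s ^ 3 / 3 * Complex.I) =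
      Complex.exp (-q * s ^ 2) * Complex.exp ((-(s ^ 3 / 3) : ℝ) * Complex.I) := by
    intro s
    rw [← Complex.exp_add]
    congr 1
    push_cast
    ring
  have hfi : Integrable fun s : ℝ => Complex.exp (-q * s ^ 2 - s ^ 3 / 3 * Complex.I) := by
    refine hgi.mono (by fun_prop) (Filter.Eventually.of_forall fun s => ?_)
    rw [hsplit, norm_mul, Complex.norm_exp_ofReal_mul_I, mul_one]
  have hdiff : ‖(∫ s : ℝ, Complex.exp (-q * s ^ 2 - s ^ 3 / 3 * Complex.I)) -
      ∫ s : ℝ, Complex.exp (-q * s ^ 2)‖ ≤ 1 / (3 * q.re ^ 2) := by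
    rw [← integral_sub hfi hgi]
    have hc := integral_abs_cube_mul_gaussian hq
    have e : 1 / (3 * q.re ^ 2) = ∫ s : ℝ, 1 / 3 * (|s| ^ 3 * Real.exp (-q.re * s ^ 2)) := by
      rw [integral_const_mul, hc.2]
      field_simp
    rw [e]
    refine norm_integral_le_of_norm_le (hc.1.const_mul _) (Filter.Eventually.of_forall fun s => ?_)
    rw [hsplit, ← mul_sub_one, norm_mul, hn]
    have := norm_exp_mul_I_sub_one_le (-(s ^ 3 / 3))
    rw [abs_neg, abs_div, abs_pow, abs_of_pos (by norm_num : (0 : ℝ) < 3)] at this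
    calc _ ≤ Real.exp (-q.re * s ^ 2) * (|s| ^ 3 / 3) := by gcongr
      _ = _ := by ring
  have hmain : ‖∫ s : ℝ, Complex.exp (-q * s ^ 2)‖ = √(Real.pi / ‖q‖) := by
    rw [integral_gaussian_complex hq]
    have : (1 / 2 : ℂ) = ((1 / 2 : ℝ) : ℂ) := by push_cast; rfl
    rw [this, Complex.norm_cpow_real, norm_div, Complex.norm_real,
      Real.norm_of_nonneg Real.pi_pos.le, Real.sqrt_eq_rpow]
  rw [← hmain]
  have := norm_sub_norm_le (∫ s : ℝ, Complex.exp (-q * s ^ 2))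
    (∫ s : ℝ, Complex.exp (-q * s ^ 2 - s ^ 3 / 3 * Complex.I))
  rw [norm_sub_rev] at this
  linarith

/-- Lower bound for `Ai` in sectors that avoid the negative half-axis, written in the variable
`q = √z`. -/
theorem norm_airyAi_sq_ge {k : ℝ} (hk : 0 < k) :
    ∃ R : ℝ, 1 ≤ R ∧ ∀ q : ℂ, R ≤ ‖q‖ → k * ‖q‖ ≤ q.re →
      1 / (4 * Real.pi) / √‖q‖ * Real.exp (-(2 / 3 * (q ^ 3).re)) ≤ ‖airyAi (q ^ 2)‖ := by
  -- The threshold makes the error at most 1/√‖q‖, while the Gaussian part is at least (3/2)/√‖q‖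
  -- because √π ≥ 3/2; half of 1/√‖q‖ survives.
  refine ⟨max 1 (1 / (3 * k ^ 2)), le_max_left _ _, fun q hR hq => ?_⟩
  have hq1 : 1 ≤ ‖q‖ := (le_max_left _ _).trans hR
  have hq2 : 1 / (3 * k ^ 2) ≤ ‖q‖ := (le_max_right _ _).trans hR
  have hq0 : 0 < ‖q‖ := by linarith
  have hre : 0 < q.re := lt_of_lt_of_le (by positivity) hq
  have hpi := Real.pi_gt_three
  have h := congrArg norm (airyAi_sq_eq hre)
  rw [norm_mul, norm_mul, norm_mul, Complex.norm_real, Complex.norm_ofNat,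
    Real.norm_of_nonneg Real.pi_pos.le, Complex.norm_exp] at h
  have hexp : (-(2 / 3 * q ^ 3)).re = -(2 / 3 * (q ^ 3).re) := by
    rw [Complex.neg_re, show (2 / 3 : ℂ) = ((2 / 3 : ℝ) : ℂ) by push_cast; rfl,
      Complex.re_ofReal_mul]
  rw [hexp] at h
  have hs1 : 1 ≤ √‖q‖ := Real.one_le_sqrt.2 hq1
  have hss : √‖q‖ * √‖q‖ = ‖q‖ := Real.mul_self_sqrt hq0.le
  have hpi2 : 3 / 2 ≤ √Real.pi := Real.le_sqrt_of_sq_le (by nlinarith)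
  have h1 : 1 / (3 * q.re ^ 2) ≤ 1 / √‖q‖ := by
    have e1 : k ^ 2 * ‖q‖ ^ 2 ≤ q.re ^ 2 := by
      rw [← mul_pow]
      exact pow_le_pow_left₀ (by positivity) hq 2
    have e2 : 1 ≤ ‖q‖ * (3 * k ^ 2) := by rwa [div_le_iff₀ (by positivity)] at hq2
    refine one_div_le_one_div_of_le (by positivity) ?_
    have e3 : √‖q‖ ≤ ‖q‖ := by nlinarith
    nlinarith
  have h2 : 1 / 2 / √‖q‖ ≤ ‖∫ s : ℝ, Complex.exp (-q * s ^ 2 - s ^ 3 / 3 * Complex.I)‖ := by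
    refine le_trans ?_ (norm_saddle_integral_ge hre)
    rw [Real.sqrt_div Real.pi_pos.le]
    have : 3 / 2 / √‖q‖ ≤ √Real.pi / √‖q‖ := by gcongr
    have e : 3 / 2 / √‖q‖ - 1 / √‖q‖ = 1 / 2 / √‖q‖ := by ring
    linarith
  refine le_of_mul_le_mul_left (a := 2 * Real.pi) ?_ (by positivity)
  rw [h]
  calc 2 * Real.pi * (1 / (4 * Real.pi) / √‖q‖ * Real.exp (-(2 / 3 * (q ^ 3).re)))
      = Real.exp (-(2 / 3 * (q ^ 3).re)) * (1 / 2 / √‖q‖) := by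
        field_simp
        ring
    _ ≤ _ := by gcongr

/-- With κ = cos(φ/2) one has 2κ² - 1 = cos φ and s = sin²φ, and the right side is -(2/3)cos(3φ/2).
So the free parameter a = κT in `norm_airyAi_le` recovers the sharp Airy exponent at T² exp(iφ). -/
theorem cube_exponent_identity {κ s : ℝ} (hκ : 0 < κ) (hs : s = 4 * κ ^ 2 * (1 - κ ^ 2)) :
    κ ^ 3 / 3 - κ * (2 * κ ^ 2 - 1) + s / (4 * κ) = -(2 / 3 * κ * (4 * κ ^ 2 - 3)) := by
  subst hs
  field_simp
  ring

/-- A weighted Young inequality: the cross term is charged to T³ when S is small relative to T, and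
to S³ otherwise. -/
theorem four_mul_le_cubes {δ T S : ℝ} (hδ : 0 < δ) (hT : 0 ≤ T) (hS : 0 ≤ S) :
    4 * T * S ^ 2 ≤ δ * T ^ 3 + 4 * √(4 / δ) * S ^ 3 := by
  by_cases h : 4 * S ^ 2 ≤ δ * T ^ 2
  · have : T * (4 * S ^ 2) ≤ T * (δ * T ^ 2) := mul_le_mul_of_nonneg_left h hT
    have h2 : 0 ≤ 4 * √(4 / δ) * S ^ 3 := by positivity
    nlinarith
  · push Not at h
    have h1 : T ≤ √(4 / δ) * S := by
      refine abs_le_of_sq_le_sq' ?_ (by positivity) |>.2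
      rw [mul_pow, Real.sq_sqrt (by positivity), div_mul_eq_mul_div, le_div_iff₀ hδ]
      linarith
    have h2 : 4 * T * S ^ 2 ≤ 4 * (√(4 / δ) * S) * S ^ 2 := by gcongr
    have h3 : 0 ≤ δ * T ^ 3 := by positivity
    nlinarith

/-- A version of `cube_exponent_identity` that tolerates errors of order R in the real part and T²R
in the squared imaginary part. They cost 2κTR and 3TR/(4κ), together below 4TR. -/
theorem airy_exponent_le {κ σ T R u v : ℝ} (hκ : 3 / 4 ≤ κ) (hκ1 : κ ≤ 1)
    (hσ : σ = 4 * κ ^ 2 * (1 - κ ^ 2)) (hT : 1 ≤ T) (hR : 0 ≤ R)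
    (hu : (2 * κ ^ 2 - 1) * T ^ 2 - 2 * R ≤ u)
    (hv : v ^ 2 ≤ σ * (T ^ 2) ^ 2 + 3 * T ^ 2 * R) :
    (κ * T) ^ 3 / 3 - κ * T * u + v ^ 2 / (4 * (κ * T)) ≤
      -(2 / 3 * κ * (4 * κ ^ 2 - 3)) * T ^ 3 + 4 * T * R := by
  have hκ0 : 0 < κ := by linarith
  have hT0 : 0 < T := by linarith
  have h1 : κ * T * ((2 * κ ^ 2 - 1) * T ^ 2 - 2 * R) ≤ κ * T * u := by gcongr
  have h2 : v ^ 2 / (4 * (κ * T)) ≤ (σ * (T ^ 2) ^ 2 + 3 * T ^ 2 * R) / (4 * (κ * T)) := by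
    gcongr
  have h4 : (σ * (T ^ 2) ^ 2 + 3 * T ^ 2 * R) / (4 * (κ * T)) =
      σ / (4 * κ) * T ^ 3 + 3 / (4 * κ) * (T * R) := by
    field_simp
  have h5 : 3 / (4 * κ) ≤ 1 := by
    rw [div_le_one (by positivity)]
    linarith
  have h8 : 0 ≤ T * R := by positivity
  have h6 : 3 / (4 * κ) * (T * R) ≤ 1 * (T * R) := by gcongr
  have h7 : κ * (T * R) ≤ 1 * (T * R) := by gcongr
  rw [h4] at h2
  have h9 : (κ ^ 3 / 3 - κ * (2 * κ ^ 2 - 1) + σ / (4 * κ)) * T ^ 3 =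
      -(2 / 3 * κ * (4 * κ ^ 2 - 3)) * T ^ 3 := by
    rw [cube_exponent_identity hκ0 hσ]
  have h10 : κ * T * ((2 * κ ^ 2 - 1) * T ^ 2 - 2 * R) =
      κ * (2 * κ ^ 2 - 1) * T ^ 3 - 2 * (κ * (T * R)) := by ring
  rw [h10] at h1
  rw [← h9, mul_pow]
  linarith

/-- T³ grows at least like x^{3/2}, so it beats Nx once T ≥ 2N/(δm). The subtracted constant bounds
Nx below that threshold. -/
theorem linear_le_cube {δ m N T x : ℝ} (hδ : 0 < δ) (hm : 0 < m) (hN : 0 ≤ N) (hT : 0 ≤ T)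
    (hx : 0 ≤ x) (hxT : m * x ≤ T ^ 2) :
    N * x - N * (2 * N / (δ * m)) ^ 2 / m ≤ δ / 2 * T ^ 3 := by
  by_cases h : 2 * N ≤ δ * m * T
  · have h1 : 0 ≤ N * (2 * N / (δ * m)) ^ 2 / m := by positivity
    have h3 : δ / 2 * T * (m * x) ≤ δ / 2 * T * T ^ 2 := by gcongr
    have h4 : 2 * N * x ≤ δ * m * T * x := by gcongr
    nlinarith
  · push Not at h
    have h1 : 0 ≤ δ / 2 * T ^ 3 := by positivity
    have h2 : T ≤ 2 * N / (δ * m) := by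
      rw [le_div_iff₀ (by positivity)]
      linarith
    have h3 : N * x ≤ N * (2 * N / (δ * m)) ^ 2 / m := by
      rw [mul_div_assoc]
      refine mul_le_mul_of_nonneg_left ?_ hN
      rw [le_div_iff₀ hm]
      have : T ^ 2 ≤ (2 * N / (δ * m)) ^ 2 := pow_le_pow_left₀ hT h2 2
      linarith
    linarith

/-- The point z + ωx differs from X exp(i arg ω), with X = ‖ω‖x + 1 + ‖z‖, by a quantity of order 1
+ ‖z‖; these are the error terms that `airy_exponent_le` accepts. -/
theorem re_im_line_bounds (z ω : ℂ) {x : ℝ} (hx : 0 ≤ x) :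
    Real.cos ω.arg * (‖ω‖ * x + (1 + ‖z‖)) - 2 * (1 + ‖z‖) ≤ (z + ω * x).re ∧
    (z + ω * x).im ^ 2 ≤ Real.sin ω.arg ^ 2 * (‖ω‖ * x + (1 + ‖z‖)) ^ 2 +
      3 * (‖ω‖ * x + (1 + ‖z‖)) * (1 + ‖z‖) := by
  obtain ⟨R, hR⟩ : ∃ R, R = 1 + ‖z‖ := ⟨_, rfl⟩
  obtain ⟨X, hX⟩ : ∃ X, X = ‖ω‖ * x + R := ⟨_, rfl⟩
  have hR0 : 0 ≤ R := by rw [hR]; positivity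
  have hmx : 0 ≤ ‖ω‖ * x := by positivity
  rw [← hR, ← hX]
  constructor
  · rw [Complex.add_re, Complex.re_mul_ofReal, ← Complex.norm_mul_cos_arg ω]
    have h1 : -‖z‖ ≤ z.re := by linarith [neg_abs_le z.re, Complex.abs_re_le_norm z]
    have h2 : Real.cos ω.arg * R ≤ 1 * R := by gcongr; exact Real.cos_le_one _
    rw [hX]
    linarith
  · have h1 : |(z + ω * x).im| ≤ |Real.sin ω.arg| * X + R := by
      rw [Complex.add_im, Complex.im_mul_ofReal, ← Complex.norm_mul_sin_arg ω]
      refine (abs_add_le _ _).trans ?_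
      rw [abs_mul, abs_mul, abs_of_nonneg (norm_nonneg ω), abs_of_nonneg hx]
      have h2 := Complex.abs_im_le_norm z
      have h4 : |Real.sin ω.arg| * (‖ω‖ * x) ≤ |Real.sin ω.arg| * X := by gcongr; linarith
      linarith
    have h2 : (z + ω * x).im ^ 2 ≤ (|Real.sin ω.arg| * X + R) ^ 2 := by
      rw [← sq_abs]
      exact pow_le_pow_left₀ (abs_nonneg _) h1 2
    refine h2.trans ?_
    have hXR : 0 ≤ X * R := mul_nonneg (by linarith) hR0
    have h3 : |Real.sin ω.arg| * (X * R) ≤ 1 * (X * R) := by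
      gcongr
      exact Real.abs_sin_le_one _
    have h4 : R * R ≤ X * R := by gcongr; linarith
    have h5 := sq_abs (Real.sin ω.arg)
    calc (|Real.sin ω.arg| * X + R) ^ 2
        = |Real.sin ω.arg| ^ 2 * X ^ 2 + 2 * (|Real.sin ω.arg| * (X * R)) + R * R := by ring
      _ ≤ |Real.sin ω.arg| ^ 2 * X ^ 2 + 2 * (1 * (X * R)) + X * R := by linarith
      _ = _ := by rw [h5]; ring

/-- `Ai` decays faster than any exponential along rays in the sector `|arg ω| < π/3`, with explicit
control of the dependence on the initial point. -/
theorem norm_airyAi_line_le {ω : ℂ} (hω : ω ≠ 0) (harg : |ω.arg| < Real.pi / 3) (N : ℝ)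
    (hN : 0 ≤ N) :
    ∃ C B : ℝ, 0 < C ∧ 0 < B ∧ ∀ (z : ℂ) (x : ℝ), 0 ≤ x →
      ‖airyAi (z + ω * x)‖ ≤
        C * Real.exp (B * ((1 + ‖z‖) * √(1 + ‖z‖))) * Real.exp (-(N * x)) := by
  set m := ‖ω‖ with hm
  have hm0 : 0 < m := norm_pos_iff.2 hω
  set φ := ω.arg with hφ
  set κ := Real.cos (φ / 2) with hκ
  have hpi := Real.pi_pos
  have hκ2 : √3 / 2 < κ := by
    rw [← Real.cos_pi_div_six, hκ, ← Real.cos_abs (φ / 2), abs_div, abs_of_pos (zero_lt_two' ℝ)]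
    exact Real.cos_lt_cos_of_nonneg_of_le_pi_div_two (by positivity) (by linarith) (by linarith)
  have h32 : 0 < √(3 : ℝ) := by positivity
  have h33 : √(3 : ℝ) ^ 2 = 3 := Real.sq_sqrt (by norm_num)
  have hκ0 : 0 < κ := by linarith
  have hκ1 : κ ≤ 1 := Real.cos_le_one _
  have hκ3 : 3 < 4 * κ ^ 2 := by nlinarith
  have hκh : 3 / 4 ≤ κ := by nlinarith
  have hcos : Real.cos φ = 2 * κ ^ 2 - 1 := by
    rw [hκ, ← Real.cos_two_mul]
    congr 1
    ring
  have hsin : Real.sin φ ^ 2 = 4 * κ ^ 2 * (1 - κ ^ 2) := by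
    rw [Real.sin_sq, hcos]
    ring
  have hre : ω.re = m * Real.cos φ := (Complex.norm_mul_cos_arg ω).symm
  have him : ω.im = m * Real.sin φ := (Complex.norm_mul_sin_arg ω).symm
  set δ := 2 / 3 * κ * (4 * κ ^ 2 - 3) with hδ
  have hδ0 : 0 < δ := by
    have : 0 < 4 * κ ^ 2 - 3 := by linarith
    positivity
  set C₀ := N * (2 * N / (δ * m)) ^ 2 / m with hC₀
  -- The decay δT³ is split in two halves: one absorbs the cross term 4TR, which yields the exponent
  -- in R√R, and the other supplies exp(-Nx) up to the constant exp C₀.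
  refine ⟨2 * Real.exp C₀, 4 * √(4 / (δ / 2)), by positivity, by positivity, fun z x hx => ?_⟩
  set R := 1 + ‖z‖ with hR
  have hR1 : 1 ≤ R := by linarith [norm_nonneg z]
  set X := m * x + R with hX
  have hmx : 0 ≤ m * x := by positivity
  have hXR : R ≤ X := by linarith
  set T := √X with hT
  have hT2 : T ^ 2 = X := Real.sq_sqrt (by linarith)
  have hT1 : 1 ≤ T := Real.one_le_sqrt.2 (by linarith)
  set S := √R with hS
  have hS2 : S ^ 2 = R := Real.sq_sqrt (by linarith)
  have hS0 : 0 ≤ S := Real.sqrt_nonneg _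
  have ha : 0 < κ * T := by positivity
  refine (norm_airyAi_le (z + ω * x) ha).trans ?_
  have hpre : 1 / √(κ * T) ≤ 2 := by
    have : 1 / 2 ≤ √(κ * T) := Real.le_sqrt_of_sq_le (by nlinarith)
    rw [div_le_iff₀ (by linarith)]
    linarith
  have hrhs : 2 * Real.exp C₀ * Real.exp (4 * √(4 / (δ / 2)) * (R * S)) * Real.exp (-(N * x)) =
      2 * Real.exp (C₀ + 4 * √(4 / (δ / 2)) * (R * S) + -(N * x)) := by
    rw [Real.exp_add, Real.exp_add]
    ring
  rw [hrhs]
  refine mul_le_mul hpre (Real.exp_le_exp.2 ?_) (Real.exp_pos _).le (by norm_num)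
  have hb := re_im_line_bounds z ω hx
  rw [← hφ, ← hm, ← hR, ← hX, ← hT2, hcos] at hb
  have hE1 := airy_exponent_le hκh hκ1 hsin hT1 (by linarith) hb.1 hb.2
  rw [← hδ, ← hS2] at hE1
  have hE2 := four_mul_le_cubes (half_pos hδ0) (by linarith : 0 ≤ T) hS0
  have hE3 := linear_le_cube hδ0 hm0 hN (by linarith : 0 ≤ T) hx (by rw [hT2]; linarith)
  rw [← hC₀] at hE3
  have hE4 : R * S = S ^ 3 := by
    rw [← hS2]
    ring
  rw [hE4]
  linarith

/-- Cauchy's estimate on a unit circle. Moving the base point by at most 1 at most doubles 1 + ‖z‖,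
and (2R)√(2R) ≤ 4R√R explains 4B. -/
theorem norm_deriv_airyAi_line_le {ω : ℂ} (hω : ω ≠ 0) (harg : |ω.arg| < Real.pi / 3) (N : ℝ)
    (hN : 0 ≤ N) :
    ∃ C B : ℝ, 0 < C ∧ 0 < B ∧ ∀ (z : ℂ) (x : ℝ), 0 ≤ x →
      ‖deriv airyAi (z + ω * x)‖ ≤
        C * Real.exp (B * ((1 + ‖z‖) * √(1 + ‖z‖))) * Real.exp (-(N * x)) := by
  obtain ⟨C, B, hC, hB, h⟩ := norm_airyAi_line_le hω harg N hN
  refine ⟨C, 4 * B, hC, by positivity, fun z x hx => ?_⟩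
  have h1 : ∀ w ∈ Metric.sphere (z + ω * x) 1, ‖airyAi w‖ ≤
      C * Real.exp (4 * B * ((1 + ‖z‖) * √(1 + ‖z‖))) * Real.exp (-(N * x)) := by
    intro w hw
    have h2 := h (w - ω * x) x hx
    rw [sub_add_cancel] at h2
    refine h2.trans ?_
    have h3 : 1 + ‖w - ω * x‖ ≤ 2 * (1 + ‖z‖) := by
      have : w - ω * x = z + (w - (z + ω * x)) := by ring
      rw [this]
      have h4 := norm_add_le z (w - (z + ω * x))
      rw [mem_sphere_iff_norm] at hw
      linarith [norm_nonneg z]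
    have h5 : √(1 + ‖w - ω * x‖) ≤ 2 * √(1 + ‖z‖) := by
      rw [show (2 : ℝ) = √4 by rw [show (4 : ℝ) = 2 ^ 2 by norm_num]; simp,
        ← Real.sqrt_mul (by norm_num)]
      exact Real.sqrt_le_sqrt (by linarith [norm_nonneg z])
    have h6 : (1 + ‖w - ω * x‖) * √(1 + ‖w - ω * x‖) ≤ 2 * (1 + ‖z‖) * (2 * √(1 + ‖z‖)) := by
      gcongr
    gcongr ?_ * Real.exp ?_ * _
    nlinarith
  have h2 := Complex.norm_deriv_le_of_forall_mem_sphere_norm_le one_pos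
    (airyAi_differentiable.diffContOnCl) h1
  rwa [div_one] at h2

/-! ### The zeros of the Airy function -/

/-- The real and imaginary parts of this derivative have readable signs: ω = 1 yields the location
of the zeros, ω = i the behaviour of |Ai| on vertical lines. -/
theorem hasDerivAt_airyAi_line_mul_conj (z ω : ℂ) (x : ℝ) :
    HasDerivAt (fun x : ℝ => ω * deriv airyAi (z + ω * x) * star (airyAi (z + ω * x)))
      ((‖ω * deriv airyAi (z + ω * x)‖ ^ 2 : ℝ) +
        ω ^ 2 * (z + ω * x) * (‖airyAi (z + ω * x)‖ ^ 2 : ℝ)) x := by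
  refine (((hasDerivAt_deriv_airyAi_line z ω x).const_mul ω).mul
    (hasDerivAt_airyAi_line z ω x).star).congr_deriv ?_
  have h1 : ∀ w : ℂ, ((‖w‖ ^ 2 : ℝ) : ℂ) = w * star w := fun w => by
    rw [Complex.star_def, Complex.mul_conj, Complex.normSq_eq_norm_sq]
  rw [h1, h1]
  ring

theorem hasDerivAt_norm_sq_airyAi_line (z ω : ℂ) (x : ℝ) :
    HasDerivAt (fun x : ℝ => ‖airyAi (z + ω * x)‖ ^ 2)
      (2 * (ω * deriv airyAi (z + ω * x) * star (airyAi (z + ω * x))).re) x := by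
  have h := (hasDerivAt_airyAi_line z ω x).norm_sq
  refine h.congr_deriv ?_
  rw [Complex.inner, Complex.star_def]

/-- A nondecreasing function that starts at 0 and tends to 0 is identically 0. -/
theorem eq_zero_of_monotone_of_tendsto {g g' : ℝ → ℝ} (hg : ∀ x, HasDerivAt g (g' x) x)
    (hg' : ∀ x, 0 < x → 0 ≤ g' x) (h0 : g 0 = 0)
    (hlim : Filter.Tendsto g Filter.atTop (nhds 0)) : ∀ x, 0 < x → g' x = 0 := by
  have hc : Continuous g := continuous_iff_continuousAt.2 fun x => (hg x).continuousAt
  have hmono : MonotoneOn g (Ici 0) :=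
    monotoneOn_of_hasDerivWithinAt_nonneg (convex_Ici 0) hc.continuousOn
      (fun x _ => (hg x).hasDerivWithinAt) (fun x hx => hg' x (by simpa using hx))
  have hz : ∀ x, 0 < x → g x = 0 := by
    intro x hx
    refine le_antisymm ?_ ?_
    · refine ge_of_tendsto hlim ?_
      filter_upwards [Filter.eventually_ge_atTop x] with y hy
      exact hmono hx.le (hx.le.trans hy) hy
    · rw [← h0]
      exact hmono self_mem_Ici hx.le hx.le
  intro x hx
  have hev : g =ᶠ[nhds x] fun _ => 0 := by
    filter_upwards [Ioi_mem_nhds hx] with y hy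
    exact hz y hy
  exact (hg x).unique ((hasDerivAt_const x (0 : ℝ)).congr_of_eventuallyEq hev)

theorem tendsto_exp_neg_mul_atTop {N : ℝ} (hN : 0 < N) (K : ℝ) :
    Filter.Tendsto (fun x : ℝ => K * Real.exp (-(N * x))) Filter.atTop (nhds 0) := by
  have : Filter.Tendsto (fun x : ℝ => Real.exp (-(N * x))) Filter.atTop (nhds 0) :=
    Real.tendsto_exp_neg_atTop_nhds_zero.comp (Filter.tendsto_id.const_mul_atTop hN)
  simpa using this.const_mul K

theorem tendsto_airyAi_line {ω : ℂ} (hω : ω ≠ 0) (harg : |ω.arg| < Real.pi / 3) (z : ℂ) :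
    Filter.Tendsto (fun x : ℝ => airyAi (z + ω * x)) Filter.atTop (nhds 0) := by
  obtain ⟨C, B, -, -, h⟩ := norm_airyAi_line_le hω harg 1 zero_le_one
  refine squeeze_zero_norm' ?_ (tendsto_exp_neg_mul_atTop one_pos
    (C * Real.exp (B * ((1 + ‖z‖) * √(1 + ‖z‖)))))
  filter_upwards [Filter.eventually_ge_atTop 0] with x hx using h z x hx

theorem tendsto_deriv_airyAi_line {ω : ℂ} (hω : ω ≠ 0) (harg : |ω.arg| < Real.pi / 3) (z : ℂ) :
    Filter.Tendsto (fun x : ℝ => deriv airyAi (z + ω * x)) Filter.atTop (nhds 0) := by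
  obtain ⟨C, B, -, -, h⟩ := norm_deriv_airyAi_line_le hω harg 1 zero_le_one
  refine squeeze_zero_norm' ?_ (tendsto_exp_neg_mul_atTop one_pos
    (C * Real.exp (B * ((1 + ‖z‖) * √(1 + ‖z‖)))))
  filter_upwards [Filter.eventually_ge_atTop 0] with x hx using h z x hx

/-- All zeros of `Ai` are real and negative. -/
theorem im_eq_zero_and_re_neg_of_airyAi_eq_zero {z : ℂ} (hz : airyAi z = 0) :
    z.im = 0 ∧ z.re < 0 := by
  have harg : |(1 : ℂ).arg| < Real.pi / 3 := by
    rw [Complex.arg_one, abs_zero]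
    have := Real.pi_pos
    positivity
  set h : ℝ → ℂ := fun x => 1 * deriv airyAi (z + 1 * x) * star (airyAi (z + 1 * x)) with hh
  have hd : ∀ x : ℝ, HasDerivAt h _ x := hasDerivAt_airyAi_line_mul_conj z 1
  have h0 : h 0 = 0 := by simp [hh, hz]
  have hlim : Filter.Tendsto h Filter.atTop (nhds 0) := by
    have := ((tendsto_deriv_airyAi_line one_ne_zero harg z).const_mul 1).mul
      ((continuous_star.tendsto _).comp (tendsto_airyAi_line one_ne_zero harg z))
    simpa [hh] using this
  have hdre : ∀ x : ℝ, HasDerivAt (fun x => (h x).re)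
      (‖deriv airyAi (z + 1 * x)‖ ^ 2 + (z.re + x) * ‖airyAi (z + 1 * x)‖ ^ 2) x := by
    intro x
    refine (Complex.reCLM.hasFDerivAt.comp_hasDerivAt x (hd x)).congr_deriv ?_
    simp only [Complex.reCLM_apply, Complex.add_re, Complex.ofReal_re, Complex.re_mul_ofReal,
      one_mul, one_pow]
  have hdim : ∀ x : ℝ, HasDerivAt (fun x => (h x).im)
      (z.im * ‖airyAi (z + 1 * x)‖ ^ 2) x := by
    intro x
    refine (Complex.imCLM.hasFDerivAt.comp_hasDerivAt x (hd x)).congr_deriv ?_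
    simp only [Complex.imCLM_apply, Complex.add_im, Complex.ofReal_im, Complex.im_mul_ofReal,
      one_mul, one_pow, zero_add, add_zero]
  have hlre : Filter.Tendsto (fun x => (h x).re) Filter.atTop (nhds 0) :=
    (Complex.continuous_re.tendsto _).comp hlim
  have hlim' : Filter.Tendsto (fun x => (h x).im) Filter.atTop (nhds 0) :=
    (Complex.continuous_im.tendsto _).comp hlim
  -- The imaginary part of h is zero at both ends of the ray and has derivative Im z · |Ai|². If Im
  -- z ≠ 0, Ai would vanish on the ray; the multiplier σ, later Im z itself, covers both signs at
  -- once.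
  have key : ∀ σ : ℝ, ¬0 < σ * z.im := by
    intro σ hσ
    have h1 : ∀ x : ℝ, 0 < x → airyAi (z + 1 * x) = 0 := by
      intro x hx
      have := eq_zero_of_monotone_of_tendsto (fun x => (hdim x).const_mul σ)
        (fun x _ => by rw [← mul_assoc]; positivity) (by simp [h0])
        (by simpa using hlim'.const_mul σ) x hx
      rw [← mul_assoc] at this
      simpa [hσ.ne'] using this
    have h2 : (fun x : ℝ => airyAi (z + 1 * x)) =ᶠ[nhds 1] fun _ => 0 := by
      filter_upwards [Ioi_mem_nhds zero_lt_one] with y hy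
      exact h1 y hy
    have h3 := (hasDerivAt_airyAi_line z 1 1).unique
      ((hasDerivAt_const (1 : ℝ) (0 : ℂ)).congr_of_eventuallyEq h2)
    rw [one_mul] at h3
    exact deriv_airyAi_ne_zero (h1 1 one_pos) h3
  have him : z.im = 0 := by
    by_contra hne
    exact key z.im (mul_self_pos.2 hne)
  refine ⟨him, ?_⟩
  by_contra! hre
  -- If Re z ≥ 0, the real part of h also has nonnegative derivative |Ai'|² + (Re z + x)|Ai|², which
  -- then vanishes, contradicting simplicity of zeros.
  have h1 := eq_zero_of_monotone_of_tendsto hdre (fun x hx => by positivity) (by simp [h0]) hlre 1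
    one_pos
  have h2 : 0 ≤ (z.re + 1) * ‖airyAi (z + 1 * (1 : ℝ))‖ ^ 2 := by positivity
  have h3 : 0 ≤ ‖deriv airyAi (z + 1 * (1 : ℝ))‖ ^ 2 := by positivity
  have h4 : airyAi (z + 1 * (1 : ℝ)) = 0 := by
    have h5 : (z.re + 1) * ‖airyAi (z + 1 * (1 : ℝ))‖ ^ 2 = 0 := by linarith
    have h6 : z.re + 1 ≠ 0 := by positivity
    simpa [h6] using h5
  refine deriv_airyAi_ne_zero h4 ?_
  have h5 : ‖deriv airyAi (z + 1 * (1 : ℝ))‖ ^ 2 = 0 := by linarith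
  simpa using h5

/-! ### `Ai` on the negative half-axis -/

/-- The real function `x ↦ Ai (-x)`. -/
noncomputable def airyNeg (x : ℝ) : ℝ := (airyAi (-(x : ℂ))).re

/-- The derivative of `x ↦ Ai (-x)`. -/
noncomputable def airyNegDeriv (x : ℝ) : ℝ := -(deriv airyAi (-(x : ℂ))).re

theorem airyAi_neg_eq (x : ℝ) : airyAi (-(x : ℂ)) = airyNeg x := by
  refine Complex.ext rfl ?_
  rw [← Complex.ofReal_neg, airyAi_ofReal_im, Complex.ofReal_im]

theorem deriv_airyAi_neg_eq (x : ℝ) : deriv airyAi (-(x : ℂ)) = -(airyNegDeriv x : ℝ) := by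
  refine Complex.ext ?_ ?_
  · simp [airyNegDeriv]
  · rw [← Complex.ofReal_neg, deriv_airyAi_ofReal_im, ← Complex.ofReal_neg, Complex.ofReal_im]

theorem hasDerivAt_airyNeg (x : ℝ) : HasDerivAt airyNeg (airyNegDeriv x) x := by
  have h := Complex.reCLM.hasFDerivAt.comp_hasDerivAt x (hasDerivAt_airyAi_line 0 (-1) x)
  have e : airyNeg = Complex.reCLM ∘ fun x : ℝ => airyAi (0 + -1 * x) := by
    funext x
    simp [airyNeg]
  rw [e]
  exact h.congr_deriv (by simp [airyNegDeriv])

theorem hasDerivAt_airyNegDeriv (x : ℝ) : HasDerivAt airyNegDeriv (-x * airyNeg x) x := by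
  have h := (Complex.reCLM.hasFDerivAt.comp_hasDerivAt x
    (hasDerivAt_deriv_airyAi_line 0 (-1) x)).neg
  have e : airyNegDeriv = -(Complex.reCLM ∘ fun x : ℝ => deriv airyAi (0 + -1 * x)) := by
    funext x
    simp [airyNegDeriv]
  rw [e]
  exact h.congr_deriv (by simp [airyNeg])

theorem airyNeg_ne_zero_or (x : ℝ) : airyNeg x ≠ 0 ∨ airyNegDeriv x ≠ 0 := by
  by_cases h : airyNeg x = 0
  · right
    intro h'
    refine deriv_airyAi_ne_zero (z := -(x : ℂ)) ?_ ?_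
    · rw [airyAi_neg_eq, h, Complex.ofReal_zero]
    · rw [deriv_airyAi_neg_eq, h', Complex.ofReal_zero, neg_zero]
  · exact Or.inl h

theorem airyNeg_continuous : Continuous airyNeg :=
  continuous_iff_continuousAt.2 fun x => (hasDerivAt_airyNeg x).continuousAt

/-- Sturm comparison with `sin`: `Ai (-x)` has a zero in every interval of length `π` in
`[1, ∞)`. -/
theorem exists_airyNeg_eq_zero {a : ℝ} (ha : 1 ≤ a) :
    ∃ x ∈ Icc a (a + Real.pi), airyNeg x = 0 := by
  by_contra! hne
  have hpi := Real.pi_pos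
  have hsign : ∀ x ∈ Icc a (a + Real.pi), 0 < airyNeg a * airyNeg x := by
    intro x hx
    by_contra! hle
    have hmem : (0 : ℝ) ∈ (fun t => airyNeg a * airyNeg t) '' Icc a x := by
      refine intermediate_value_Icc' hx.1
        ((continuous_const.mul airyNeg_continuous).continuousOn) ⟨hle, mul_self_nonneg _⟩
    obtain ⟨y, hy, hy0⟩ := hmem
    have h1 := hne a (left_mem_Icc.2 (by linarith))
    have h2 := hne y ⟨hy.1, hy.2.trans hx.2⟩
    exact mul_ne_zero h1 h2 hy0
  -- The Wronskian with sin(x - a), normalised by the sign of the function at a. Without a zero it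
  -- is nonincreasing because 1 - x ≤ 0, yet it is negative at a and positive at a + π.
  set W : ℝ → ℝ := fun x => airyNeg a * (airyNegDeriv x * Real.sin (x - a) -
    airyNeg x * Real.cos (x - a)) with hW
  have hWd : ∀ x, HasDerivAt W (airyNeg a * airyNeg x * ((1 - x) * Real.sin (x - a))) x := by
    intro x
    have h1 : HasDerivAt (fun x => x - a) 1 x := (hasDerivAt_id x).sub_const a
    refine ((((hasDerivAt_airyNegDeriv x).mul h1.sin).sub
      ((hasDerivAt_airyNeg x).mul h1.cos)).const_mul _).congr_deriv ?_
    ring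
  have hanti : AntitoneOn W (Icc a (a + Real.pi)) := by
    refine antitoneOn_of_hasDerivWithinAt_nonpos (convex_Icc _ _)
      (fun x _ => (hWd x).continuousAt.continuousWithinAt)
      (fun x _ => (hWd x).hasDerivWithinAt) fun x hx => ?_
    rw [interior_Icc] at hx
    refine mul_nonpos_of_nonneg_of_nonpos (hsign x ⟨hx.1.le, hx.2.le⟩).le ?_
    refine mul_nonpos_of_nonpos_of_nonneg (by linarith [hx.1]) ?_
    exact Real.sin_nonneg_of_nonneg_of_le_pi (by linarith [hx.1]) (by linarith [hx.2])
  have h1 := hanti (left_mem_Icc.2 (by linarith)) (right_mem_Icc.2 (by linarith))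
    (by linarith : a ≤ a + Real.pi)
  have h2 := hsign a (left_mem_Icc.2 (by linarith))
  have h3 := hsign (a + Real.pi) (right_mem_Icc.2 (by linarith))
  simp only [hW, add_sub_cancel_left, Real.sin_pi, Real.cos_pi, sub_self, Real.sin_zero,
    Real.cos_zero, mul_zero, mul_one, zero_sub, mul_neg, neg_neg] at h1
  linarith

/-- Rolle between a zero in [a, a + π] and one in [a + 4, a + 4 + π]. Since π < 4, these are
distinct and both lie in [a, a + 8]. -/
theorem exists_airyNegDeriv_eq_zero {a : ℝ} (ha : 1 ≤ a) :
    ∃ x ∈ Icc a (a + 8), airyNegDeriv x = 0 := by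
  obtain ⟨x, hx, hx0⟩ := exists_airyNeg_eq_zero ha
  obtain ⟨y, hy, hy0⟩ := exists_airyNeg_eq_zero (a := a + 4) (by linarith)
  have hpi := Real.pi_lt_four
  have hxy : x < y := by linarith [hx.2, hy.1]
  obtain ⟨c, hc, hc0⟩ := exists_hasDerivAt_eq_zero hxy airyNeg_continuous.continuousOn
    (by rw [hx0, hy0]) fun t _ => hasDerivAt_airyNeg t
  exact ⟨c, ⟨by linarith [hx.1, hc.1], by linarith [hy.2, hc.2]⟩, hc0⟩

/-- Lower bound for `Ai` at its critical points on the negative half-axis. -/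
theorem exists_le_norm_airyAi_of_critical : ∃ k : ℝ, 0 < k ∧ ∀ x : ℝ, 1 ≤ x →
    airyNegDeriv x = 0 → k ≤ x * ‖airyAi (-(x : ℂ))‖ ^ 2 := by
  -- An energy whose derivative reduces to the square of the function, by the Airy equation; at a
  -- critical point only the term x·Ai(-x)² remains.
  set E : ℝ → ℝ := fun x => airyNegDeriv x ^ 2 + x * airyNeg x ^ 2 with hE
  have hEd : ∀ x, HasDerivAt E (airyNeg x ^ 2) x := by
    intro x
    refine (((hasDerivAt_airyNegDeriv x).pow 2).add
      ((hasDerivAt_id x).mul ((hasDerivAt_airyNeg x).pow 2))).congr_deriv ?_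
    simp
    ring
  have hmono : Monotone E := monotone_of_hasDerivAt_nonneg hEd fun x => sq_nonneg _
  refine ⟨E 1, ?_, fun x hx h0 => ?_⟩
  · simp only [hE, one_mul]
    rcases airyNeg_ne_zero_or 1 with h | h
    · positivity
    · positivity
  · have := hmono hx
    rw [airyAi_neg_eq, Complex.norm_real, Real.norm_eq_abs, sq_abs]
    simpa [hE, h0] using this

/-- On vertical lines in the left half-plane `|Ai|` is minimal on the real axis. -/
theorem norm_airyAi_le_vertical {x : ℝ} (hx : 0 ≤ x) (y : ℝ) :
    ‖airyAi (-(x : ℂ))‖ ≤ ‖airyAi (-(x : ℂ) + Complex.I * y)‖ := by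
  wlog hy : 0 ≤ y generalizing y
  · have h := this (-y) (by linarith)
    have h2 : -(x : ℂ) + Complex.I * ((-y : ℝ) : ℂ) =
        starRingEnd ℂ (-(x : ℂ) + Complex.I * y) := by
      simp
    rwa [h2, airyAi_conj, RCLike.norm_conj] at h
  set z : ℂ := -(x : ℂ) with hz
  -- Half the derivative of |Ai|² along the vertical line. It vanishes at y = 0 because Ai and Ai'
  -- are real there, and it is nondecreasing because x ≥ 0.
  set h : ℝ → ℝ := fun y =>
    (Complex.I * deriv airyAi (z + Complex.I * y) * star (airyAi (z + Complex.I * y))).re with hh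
  have hd : ∀ y : ℝ, HasDerivAt h (‖Complex.I * deriv airyAi (z + Complex.I * y)‖ ^ 2 +
      x * ‖airyAi (z + Complex.I * y)‖ ^ 2) y := by
    intro y
    refine (Complex.reCLM.hasFDerivAt.comp_hasDerivAt y
      (hasDerivAt_airyAi_line_mul_conj z Complex.I y)).congr_deriv ?_
    have : Complex.I ^ 2 * (z + Complex.I * y) = x - Complex.I * y := by
      rw [Complex.I_sq, hz]
      ring
    rw [this, Complex.reCLM_apply, Complex.add_re, Complex.ofReal_re, Complex.re_mul_ofReal]
    simp
  have h0 : h 0 = 0 := by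
    simp only [hh, Complex.ofReal_zero, mul_zero, add_zero, hz, airyAi_neg_eq, deriv_airyAi_neg_eq]
    simp
  have hmono : Monotone h := monotone_of_hasDerivAt_nonneg hd fun y => by positivity
  have hmono2 : MonotoneOn (fun y : ℝ => ‖airyAi (z + Complex.I * y)‖ ^ 2) (Ici 0) := by
    refine monotoneOn_of_hasDerivWithinAt_nonneg (convex_Ici 0)
      (fun y _ => (hasDerivAt_norm_sq_airyAi_line z Complex.I y).continuousAt.continuousWithinAt)
      (fun y _ => (hasDerivAt_norm_sq_airyAi_line z Complex.I y).hasDerivWithinAt) fun y hy => ?_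
    rw [interior_Ici] at hy
    have := hmono hy.le
    rw [h0] at this
    exact mul_nonneg zero_le_two this
  have h1 := hmono2 self_mem_Ici hy hy
  simp only [Complex.ofReal_zero, mul_zero, add_zero] at h1
  exact (pow_le_pow_iff_left₀ (norm_nonneg _) (norm_nonneg _) two_ne_zero).1 h1

/-! ### Enumeration of the zeros -/

/-- The hypotheses make S a locally finite linear order with a least and no greatest element, hence
order isomorphic to ℕ. -/
theorem exists_strictMono_range_eq {S : Set ℝ} (hinf : ∀ b, ∃ s ∈ S, b < s)
    (hfin : ∀ a b, (S ∩ Icc a b).Finite) (hbdd : BddBelow S) :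
    ∃ t : ℕ → ℝ, StrictMono t ∧ range t = S := by
  obtain ⟨s₀, hs₀, -⟩ := hinf 0
  obtain ⟨b₀, hb₀⟩ := hbdd
  obtain ⟨m, hm, hmin⟩ : ∃ m ∈ S, ∀ s ∈ S, m ≤ s := by
    obtain ⟨m, hm, hmin⟩ := Set.exists_min_image (S ∩ Icc b₀ s₀) id (hfin _ _)
      ⟨s₀, hs₀, hb₀ hs₀, le_rfl⟩
    refine ⟨m, hm.1, fun s hs => ?_⟩
    rcases le_total s s₀ with h | h
    · exact hmin s ⟨hs, hb₀ hs, h⟩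
    · exact hm.2.2.trans h
  let _ : LocallyFiniteOrder S := LocallyFiniteOrder.ofFiniteIcc fun a b => by
    refine Set.Finite.of_finite_image (f := Subtype.val) ((hfin a b).subset ?_)
      Subtype.val_injective.injOn
    rintro _ ⟨x, hx, rfl⟩
    exact ⟨x.2, hx⟩
  let _ : SuccOrder S := LinearLocallyFiniteOrder.succOrder S
  let _ : PredOrder S := LinearLocallyFiniteOrder.predOrder S
  let _ : OrderBot S := { bot := ⟨m, hm⟩, bot_le := fun s => hmin s s.2 }
  have : NoMaxOrder S := ⟨fun s => by
    obtain ⟨t, ht, hst⟩ := hinf s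
    exact ⟨⟨t, ht⟩, hst⟩⟩
  have e : S ≃o ℕ := orderIsoNatOfLinearSuccPredArch
  refine ⟨fun n => e.symm n, fun a b hab => e.symm.strictMono hab, ?_⟩
  ext s
  constructor
  · rintro ⟨n, rfl⟩
    exact (e.symm n).2
  · intro hs
    exact ⟨e ⟨s, hs⟩, by simp⟩

/-- An accumulation point of zeros would be a zero with nonvanishing derivative, hence isolated. -/
theorem finite_airyNeg_zeros_inter_Icc (a b : ℝ) : ({t | airyNeg t = 0} ∩ Icc a b).Finite := by
  by_contra hinf
  obtain ⟨x, -, hx⟩ := Set.Infinite.exists_accPt_of_subset_isCompact hinf isCompact_Icc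
    inter_subset_right
  rw [accPt_iff_frequently] at hx
  have hx0 : airyNeg x = 0 := by
    have hcl : IsClosed {t | airyNeg t = 0} := isClosed_eq airyNeg_continuous continuous_const
    have h1 : ∃ᶠ y in nhds x, y ∈ {t | airyNeg t = 0} := hx.mono fun y hy => hy.2.1
    exact hcl.mem_of_frequently_of_tendsto h1 Filter.tendsto_id
  have hx1 : airyNegDeriv x ≠ 0 := (airyNeg_ne_zero_or x).resolve_left (by simp [hx0])
  have h2 := (hasDerivAt_airyNeg x).eventually_ne (c := 0) hx1
  rw [eventually_nhdsWithin_iff] at h2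
  obtain ⟨y, ⟨hy1, hy2⟩, hy3⟩ := (hx.and_eventually h2).exists
  exact hy3 hy1 hy2.1

/-- The zeros of `Ai` form an infinite sequence of negative real numbers. -/
theorem exists_airyAi_zeros : ∃ t : ℕ → ℝ, StrictMono t ∧ (∀ n, 0 < t n) ∧
    {z : ℂ | airyAi z = 0} = range fun n => -(t n : ℂ) := by
  have hpos : ∀ t, airyNeg t = 0 → 0 < t := by
    intro t ht
    have := (im_eq_zero_and_re_neg_of_airyAi_eq_zero (z := -(t : ℂ))
      (by rw [airyAi_neg_eq, ht, Complex.ofReal_zero])).2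
    simpa using this
  obtain ⟨t, ht, hrange⟩ := exists_strictMono_range_eq (S := {t | airyNeg t = 0})
    (fun b => by
      obtain ⟨x, hx, hx0⟩ := exists_airyNeg_eq_zero (a := |b| + 1) (by linarith [abs_nonneg b])
      exact ⟨x, hx0, by linarith [hx.1, le_abs_self b]⟩)
    finite_airyNeg_zeros_inter_Icc ⟨0, fun t ht => (hpos t ht).le⟩
  have hz : ∀ n, airyNeg (t n) = 0 := fun n => by
    have : t n ∈ {t | airyNeg t = 0} := hrange ▸ mem_range_self n
    exact this
  refine ⟨t, ht, fun n => hpos _ (hz n), ?_⟩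
  ext z
  constructor
  · intro hzz
    have hzz : airyAi z = 0 := hzz
    have h := im_eq_zero_and_re_neg_of_airyAi_eq_zero hzz
    have hzr : z = -((-z.re : ℝ) : ℂ) := Complex.ext (by simp) (by simp [h.1])
    have : -z.re ∈ range t := by
      rw [hrange]
      have h2 : airyAi (-((-z.re : ℝ) : ℂ)) = 0 := by rw [← hzr, hzz]
      rw [airyAi_neg_eq] at h2
      exact_mod_cast h2
    obtain ⟨n, hn⟩ := this
    exact ⟨n, by simp only [hn]; exact hzr.symm⟩
  · rintro ⟨n, rfl⟩
    change airyAi (-(t n : ℂ)) = 0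
    rw [airyAi_neg_eq, hz, Complex.ofReal_zero]

/-! ### Integration by parts and square integrability -/

/-- Integration by parts where one factor is only an indefinite integral. -/
theorem integral_mul_eq_of_eq_primitive {p q A A' : ℝ → ℂ} {X : ℝ} (hX : 0 ≤ X)
    (hq : IntervalIntegrable q volume 0 X) (hp : ∀ x ∈ Icc 0 X, p x = p 0 + ∫ s in (0 : ℝ)..x, q s)
    (hA : ∀ x, HasDerivAt A (A' x) x) (hA' : Continuous A') :
    ∫ x in (0 : ℝ)..X, q x * A x = p X * A X - p 0 * A 0 - ∫ x in (0 : ℝ)..X, p x * A' x := by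
  have hAc : Continuous A := continuous_iff_continuousAt.2 fun x => (hA x).continuousAt
  have hqi : Integrable q (volume.restrict (Ioc 0 X)) :=
    (intervalIntegrable_iff_integrableOn_Ioc_of_le hX).1 hq
  have hAi : Integrable A' (volume.restrict (Ioc 0 X)) :=
    (intervalIntegrable_iff_integrableOn_Ioc_of_le hX).1 (hA'.intervalIntegrable 0 X)
  have hmeas : MeasurableSet {y : ℝ × ℝ | y.1 ≤ y.2} := measurableSet_le measurable_fst measurable_snd
  -- Fubini for q(s)A'(r) on the triangle s ≤ r: integrating first in r or first in s gives the two
  -- sides, with no differentiability of p required.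
  have hprod : Integrable (fun y : ℝ × ℝ => {y : ℝ × ℝ | y.1 ≤ y.2}.indicator
      (fun y => q y.1 * A' y.2) y)
      ((volume.restrict (Ioc 0 X)).prod (volume.restrict (Ioc 0 X))) :=
    (hqi.mul_prod hAi).indicator hmeas
  have hswap := integral_integral_swap (f := fun s r : ℝ =>
    {y : ℝ × ℝ | y.1 ≤ y.2}.indicator (fun y => q y.1 * A' y.2) (s, r)) hprod
  have hleft : ∀ s ∈ Ioc 0 X, ∫ r in Ioc 0 X,
      {y : ℝ × ℝ | y.1 ≤ y.2}.indicator (fun y => q y.1 * A' y.2) (s, r) =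
      q s * (A X - A s) := by
    intro s hs
    have h1 : ∀ r, {y : ℝ × ℝ | y.1 ≤ y.2}.indicator (fun y => q y.1 * A' y.2) (s, r) =
        (Ici s).indicator (fun r => q s * A' r) r := fun r => by
      simp [indicator_apply]
    simp_rw [h1]
    rw [setIntegral_indicator measurableSet_Ici]
    have h2 : Ioc 0 X ∩ Ici s = Icc s X := by
      ext r
      simp only [mem_inter_iff, mem_Ioc, mem_Ici, mem_Icc]
      constructor
      · rintro ⟨⟨-, h⟩, h'⟩; exact ⟨h', h⟩
      · rintro ⟨h, h'⟩; exact ⟨⟨hs.1.trans_le h, h'⟩, h⟩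
    rw [h2, integral_Icc_eq_integral_Ioc, integral_const_mul,
      ← intervalIntegral.integral_of_le hs.2,
      intervalIntegral.integral_eq_sub_of_hasDerivAt (fun x _ => hA x)
        (hA'.intervalIntegrable _ _)]
  have hright : ∀ r ∈ Ioc 0 X, ∫ s in Ioc 0 X,
      {y : ℝ × ℝ | y.1 ≤ y.2}.indicator (fun y => q y.1 * A' y.2) (s, r) =
      (p r - p 0) * A' r := by
    intro r hr
    have h1 : ∀ s, {y : ℝ × ℝ | y.1 ≤ y.2}.indicator (fun y => q y.1 * A' y.2) (s, r) =
        (Iic r).indicator (fun s => q s * A' r) s := fun s => by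
      simp [indicator_apply]
    simp_rw [h1]
    rw [setIntegral_indicator measurableSet_Iic]
    have h2 : Ioc 0 X ∩ Iic r = Ioc 0 r := by
      ext s
      simp only [mem_inter_iff, mem_Ioc, mem_Iic]
      constructor
      · rintro ⟨⟨h, -⟩, h'⟩; exact ⟨h, h'⟩
      · rintro ⟨h, h'⟩; exact ⟨⟨h, h'.trans hr.2⟩, h'⟩
    rw [h2, integral_mul_const, ← intervalIntegral.integral_of_le hr.1.le,
      hp r ⟨hr.1.le, hr.2⟩, add_sub_cancel_left]
  rw [setIntegral_congr_fun measurableSet_Ioc hleft,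
    setIntegral_congr_fun measurableSet_Ioc hright] at hswap
  rw [← intervalIntegral.integral_of_le hX, ← intervalIntegral.integral_of_le hX] at hswap
  have hpc : ContinuousOn p (Icc 0 X) := by
    have := intervalIntegral.continuousOn_primitive_interval (f := q) (a := 0) (b := X)
      (μ := volume) (by
        rw [uIcc_of_le hX, integrableOn_Icc_iff_integrableOn_Ioc]
        exact hqi)
    rw [uIcc_of_le hX] at this
    exact (continuousOn_const.add this).congr hp
  have hpA : IntervalIntegrable (fun x => p x * A' x) volume 0 X := by
    refine ContinuousOn.intervalIntegrable ?_
    rw [uIcc_of_le hX]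
    exact hpc.mul hA'.continuousOn
  have hqA : IntervalIntegrable (fun x => q x * A x) volume 0 X :=
    hq.mul_continuousOn hAc.continuousOn
  have e1 : ∫ x in (0 : ℝ)..X, q x * (A X - A x) =
      (p X - p 0) * A X - ∫ x in (0 : ℝ)..X, q x * A x := by
    simp_rw [mul_sub]
    rw [intervalIntegral.integral_sub (hq.mul_const _) hqA, intervalIntegral.integral_mul_const,
      hp X ⟨hX, le_rfl⟩, add_sub_cancel_left]
  have e2 : ∫ x in (0 : ℝ)..X, (p x - p 0) * A' x =
      (∫ x in (0 : ℝ)..X, p x * A' x) - p 0 * (A X - A 0) := by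
    simp_rw [sub_mul]
    rw [intervalIntegral.integral_sub hpA ((hA'.intervalIntegrable _ _).const_mul _),
      intervalIntegral.integral_const_mul,
      intervalIntegral.integral_eq_sub_of_hasDerivAt (fun x _ => hA x)
        (hA'.intervalIntegrable _ _)]
  rw [e1, e2] at hswap
  linear_combination -hswap

/-- From |g| ≤ 1 + |g|². Linear growth is all that the exponential bound below needs. -/
theorem integral_norm_le_add_integral_sq {g : ℝ → ℂ}
    (hg : MemLp g 2 (volume.restrict (Ioi (0 : ℝ)))) {x : ℝ} (hx : 0 ≤ x) :
    IntervalIntegrable g volume 0 x ∧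
      ∫ s in (0 : ℝ)..x, ‖g s‖ ≤ x + ∫ s in Ioi (0 : ℝ), ‖g s‖ ^ 2 := by
  have hsq : IntegrableOn (fun s => ‖g s‖ ^ 2) (Ioi (0 : ℝ)) := hg.integrable_norm_pow (by norm_num)
  have hsub : Ioc 0 x ⊆ Ioi (0 : ℝ) := Ioc_subset_Ioi_self
  have hgx : MemLp g 2 (volume.restrict (Ioc 0 x)) :=
    hg.mono_measure (Measure.restrict_mono hsub le_rfl)
  have hgi : Integrable g (volume.restrict (Ioc 0 x)) := hgx.integrable (by norm_num)
  refine ⟨(intervalIntegrable_iff_integrableOn_Ioc_of_le hx).2 hgi, ?_⟩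
  rw [intervalIntegral.integral_of_le hx]
  calc ∫ s in Ioc 0 x, ‖g s‖ ≤ ∫ s in Ioc 0 x, (1 + ‖g s‖ ^ 2) := by
        refine integral_mono hgi.norm ((integrable_const 1).add (hsq.mono_set hsub)) fun s => ?_
        nlinarith [sq_nonneg (‖g s‖ - 1), norm_nonneg (g s)]
    _ = x + ∫ s in Ioc 0 x, ‖g s‖ ^ 2 := by
        rw [integral_add (integrable_const 1) (hsq.mono_set hsub)]
        simp [hx]
    _ ≤ _ := by
        refine add_le_add_right ?_ x
        exact setIntegral_mono_set hsq (Filter.Eventually.of_forall fun s => sq_nonneg _)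
          hsub.eventuallyLE

/-- Elements of the domain of the Airy operator grow at most exponentially. -/
theorem IsW22Loc.exists_exp_bound {c : ℂ} {u v w : ℝ → ℂ} (h : IsW22Loc u v w) (h0 : u 0 = 0)
    (hu : MemLp u 2 (volume.restrict (Ioi (0 : ℝ))))
    (hf : MemLp (fun x => -w x + c * (x : ℂ) * u x) 2 (volume.restrict (Ioi (0 : ℝ)))) :
    ∃ K : ℝ, ∀ x, 0 ≤ x → ‖v x‖ ≤ K * Real.exp (3 * x) ∧ ‖u x‖ ≤ K * Real.exp (3 * x) := by
  set U := ∫ s in Ioi (0 : ℝ), ‖u s‖ ^ 2 with hU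
  set Q := ∫ s in Ioi (0 : ℝ), ‖-w s + c * (s : ℂ) * u s‖ ^ 2 with hQ
  have hU0 : 0 ≤ U := integral_nonneg fun _ => sq_nonneg _
  have hQ0 : 0 ≤ Q := integral_nonneg fun _ => sq_nonneg _
  -- Solving for w = cxu - f and integrating makes v grow at most quadratically; one more
  -- integration bounds u by a cubic, and 1 + x ≤ exp x gives exp(3x).
  set K := ‖v 0‖ + ‖c‖ * (1 + U) + (1 + Q) with hK
  have hK0 : 0 ≤ K := by positivity
  have hv : ∀ x, 0 ≤ x → ‖v x‖ ≤ K * (1 + x) ^ 2 := by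
    intro x hx
    obtain ⟨hui, hub⟩ := integral_norm_le_add_integral_sq hu hx
    obtain ⟨hfi, hfb⟩ := integral_norm_le_add_integral_sq hf hx
    rw [h.integral_snd x hx]
    have h1 : ‖∫ s in (0 : ℝ)..x, w s‖ ≤ ∫ s in (0 : ℝ)..x,
        (‖c‖ * x * ‖u s‖ + ‖-w s + c * (s : ℂ) * u s‖) := by
      refine intervalIntegral.norm_integral_le_of_norm_le hx
        (Filter.Eventually.of_forall fun s hs => ?_) ((hui.norm.const_mul _).add hfi.norm)
      have e : w s = c * s * u s - (-w s + c * (s : ℂ) * u s) := by ring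
      calc ‖w s‖ = ‖c * s * u s - (-w s + c * (s : ℂ) * u s)‖ := by rw [← e]
        _ ≤ ‖c * s * u s‖ + ‖-w s + c * (s : ℂ) * u s‖ := norm_sub_le _ _
        _ ≤ _ := by
          rw [norm_mul, norm_mul, Complex.norm_real, Real.norm_of_nonneg hs.1.le]
          gcongr
          exact hs.2
    rw [intervalIntegral.integral_add (hui.norm.const_mul _) hfi.norm,
      intervalIntegral.integral_const_mul] at h1
    have h2 : ‖c‖ * x * ∫ s in (0 : ℝ)..x, ‖u s‖ ≤ ‖c‖ * x * (x + U) := by gcongr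
    have h3 : ‖c‖ * x * (x + U) ≤ ‖c‖ * (1 + U) * (1 + x) ^ 2 := by
      rw [mul_assoc, mul_assoc]
      refine mul_le_mul_of_nonneg_left ?_ (norm_nonneg c)
      nlinarith [mul_nonneg hx hU0, mul_nonneg (mul_nonneg hx hx) hU0]
    have h4 : x + Q ≤ (1 + Q) * (1 + x) ^ 2 := by
      nlinarith [mul_nonneg hx hQ0, mul_nonneg (mul_nonneg hx hx) hQ0]
    have h5 : ‖v 0‖ ≤ ‖v 0‖ * (1 + x) ^ 2 := le_mul_of_one_le_right (norm_nonneg _) (by nlinarith)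
    refine (norm_add_le _ _).trans ?_
    rw [hK]
    linarith
  have hexp : ∀ x : ℝ, 0 ≤ x → (1 + x) ^ 2 ≤ Real.exp (3 * x) ∧ x * (1 + x) ^ 2 ≤ Real.exp (3 * x) := by
    intro x hx
    have h1 : 1 + x ≤ Real.exp x := by linarith [Real.add_one_le_exp x]
    have h2 : Real.exp (3 * x) = Real.exp x ^ 3 := by rw [← Real.exp_nat_mul]; norm_num
    have h3 : (1 + x) ^ 3 ≤ Real.exp x ^ 3 := pow_le_pow_left₀ (by linarith) h1 3
    have h4 : 0 ≤ x * (1 + x) ^ 2 := by positivity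
    rw [h2]
    constructor <;> nlinarith [sq_nonneg (1 + x)]
  refine ⟨K, fun x hx => ⟨(hv x hx).trans (by gcongr; exact (hexp x hx).1), ?_⟩⟩
  rw [h.integral_fst x hx, h0, zero_add]
  have h1 : ‖∫ s in (0 : ℝ)..x, v s‖ ≤ K * (1 + x) ^ 2 * |x - 0| := by
    refine intervalIntegral.norm_integral_le_of_norm_le_const fun s hs => ?_
    rw [uIoc_of_le hx] at hs
    have h2 : 1 + s ≤ 1 + x := by linarith [hs.2]
    exact (hv s hs.1.le).trans (by gcongr; linarith [hs.1])
  rw [sub_zero, abs_of_nonneg hx] at h1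
  calc _ ≤ K * (1 + x) ^ 2 * x := h1
    _ = K * (x * (1 + x) ^ 2) := by ring
    _ ≤ _ := by gcongr; exact (hexp x hx).2

theorem memLp_two_of_exp_bound {g : ℝ → ℂ} (hg : Continuous g) {K : ℝ}
    (h : ∀ x, 0 ≤ x → ‖g x‖ ≤ K * Real.exp (-x)) :
    MemLp g 2 (volume.restrict (Ioi (0 : ℝ))) := by
  rw [memLp_two_iff_integrable_sq_norm hg.aestronglyMeasurable]
  have hi : IntegrableOn (fun x : ℝ => K ^ 2 * Real.exp (-2 * x)) (Ioi 0) :=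
    (integrableOn_exp_mul_Ioi (by norm_num) 0).const_mul _
  refine hi.mono' (by fun_prop) ?_
  filter_upwards [ae_restrict_mem measurableSet_Ioi] with x hx
  rw [Real.norm_of_nonneg (sq_nonneg _)]
  refine (pow_le_pow_left₀ (norm_nonneg _) (h x (le_of_lt hx)) 2).trans (le_of_eq ?_)
  rw [mul_pow, ← Real.exp_nat_mul]
  congr 2
  push_cast
  ring

section Line

variable {ω : ℂ} (hω : ω ≠ 0) (harg : |ω.arg| < Real.pi / 3)
include hω harg

theorem exists_airyAi_line_bound (z : ℂ) {N : ℝ} (hN : 0 ≤ N) : ∃ C : ℝ, 0 ≤ C ∧ ∀ x : ℝ, 0 ≤ x →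
    ‖airyAi (z + ω * x)‖ ≤ C * Real.exp (-(N * x)) ∧
      ‖deriv airyAi (z + ω * x)‖ ≤ C * Real.exp (-(N * x)) := by
  obtain ⟨C, B, hC, -, h⟩ := norm_airyAi_line_le hω harg N hN
  obtain ⟨C', B', hC', -, h'⟩ := norm_deriv_airyAi_line_le hω harg N hN
  refine ⟨max (C * Real.exp (B * ((1 + ‖z‖) * √(1 + ‖z‖))))
    (C' * Real.exp (B' * ((1 + ‖z‖) * √(1 + ‖z‖)))), le_max_of_le_left (by positivity),
    fun x hx => ⟨(h z x hx).trans ?_, (h' z x hx).trans ?_⟩⟩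
  · gcongr
    exact le_max_left _ _
  · gcongr
    exact le_max_right _ _

theorem memLp_airyAi_line (z : ℂ) :
    MemLp (fun x : ℝ => airyAi (z + ω * x)) 2 (volume.restrict (Ioi (0 : ℝ))) := by
  obtain ⟨C, -, h⟩ := exists_airyAi_line_bound hω harg z zero_le_one
  exact memLp_two_of_exp_bound (continuous_airyAi_line z ω) fun x hx => by
    simpa using (h x hx).1

/-- Green's formula for the Airy operator, tested against a decaying solution. -/
theorem IsW22Loc.integral_mul_airyAi_line {u v w : ℝ → ℂ} (h : IsW22Loc u v w) (h0 : u 0 = 0)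
    (hu : MemLp u 2 (volume.restrict (Ioi (0 : ℝ))))
    (hf : MemLp (fun x => -w x + ω ^ 3 * (x : ℂ) * u x) 2 (volume.restrict (Ioi (0 : ℝ)))) (z : ℂ) :
    ∫ x in Ioi (0 : ℝ), ((-w x + ω ^ 3 * (x : ℂ) * u x) + ω ^ 2 * z * u x) * airyAi (z + ω * x) =
      v 0 * airyAi z := by
  set A : ℝ → ℂ := fun x => airyAi (z + ω * x) with hA
  set D : ℝ → ℂ := fun x => deriv airyAi (z + ω * x) with hD
  have hAc : Continuous A := continuous_airyAi_line z ω
  have hDc : Continuous D := continuous_deriv_airyAi_line z ω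
  have hint : IntegrableOn (fun x : ℝ => ((-w x + ω ^ 3 * (x : ℂ) * u x) + ω ^ 2 * z * u x) * A x)
      (Ioi 0) :=
    MemLp.integrable_mul (hf.add (hu.const_mul (ω ^ 2 * z))) (memLp_airyAi_line hω harg z)
  have hlim := intervalIntegral_tendsto_integral_Ioi 0 hint Filter.tendsto_id
  obtain ⟨K, hK⟩ := h.exists_exp_bound h0 hu hf
  -- Rate 4 beats the growth exp(3x) of u and v, so the boundary terms at infinity disappear.
  obtain ⟨C, hC, hb⟩ := exists_airyAi_line_bound hω harg z (N := 4) (by norm_num)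
  have hprod : ∀ {p q : ℝ → ℂ}, (∀ x, 0 ≤ x → ‖p x‖ ≤ K * Real.exp (3 * x)) →
      (∀ x, 0 ≤ x → ‖q x‖ ≤ C * Real.exp (-(4 * x))) →
      Filter.Tendsto (fun x => p x * q x) Filter.atTop (nhds 0) := by
    intro p q hp hq
    refine squeeze_zero_norm' ?_ (tendsto_exp_neg_mul_atTop one_pos (K * C))
    filter_upwards [Filter.eventually_ge_atTop 0] with x hx
    rw [norm_mul]
    refine (mul_le_mul (hp x hx) (hq x hx) (norm_nonneg _)
      ((norm_nonneg _).trans (hp x hx))).trans (le_of_eq ?_)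
    have : Real.exp (-(1 * x)) = Real.exp (3 * x) * Real.exp (-(4 * x)) := by
      rw [← Real.exp_add]
      congr 1
      ring
    rw [this]
    ring
  have hlim2 : Filter.Tendsto (fun X => v 0 * A 0 - v X * A X + ω * (u X * D X)) Filter.atTop
      (nhds (v 0 * A 0)) := by
    have h1 := hprod (fun x hx => (hK x hx).1) (fun x hx => (hb x hx).1)
    have h2 := hprod (fun x hx => (hK x hx).2) (fun x hx => (hb x hx).2)
    simpa using (h1.const_sub (v 0 * A 0)).add (h2.const_mul ω)
  have hA0 : A 0 = airyAi z := by simp [hA]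
  rw [← hA0]
  refine tendsto_nhds_unique hlim (hlim2.congr' ?_)
  filter_upwards [Filter.eventually_ge_atTop 0] with X hX
  have hp1 := integral_mul_eq_of_eq_primitive hX (h.intervalIntegrable_snd hX)
    (fun x hx => h.integral_snd x hx.1) (fun x => hasDerivAt_airyAi_line z ω x)
    (hDc.const_smul ω)
  have hp2 := integral_mul_eq_of_eq_primitive hX (h.intervalIntegrable_fst hX)
    (fun x hx => h.integral_fst x hx.1) (fun x => hasDerivAt_deriv_airyAi_line z ω x)
    (by fun_prop : Continuous fun x : ℝ => ω * ((z + ω * x) * A x))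
  rw [h0, zero_mul, sub_zero] at hp2
  have huc : ContinuousOn u (uIcc 0 X) := by
    rw [uIcc_of_le hX]
    exact h.continuousOn_self X hX
  have hwA : IntervalIntegrable (fun x => w x * A x) volume 0 X :=
    (h.intervalIntegrable_snd hX).mul_continuousOn hAc.continuousOn
  have huA : IntervalIntegrable (fun x => u x * (ω * ((z + ω * x) * A x))) volume 0 X :=
    (huc.mul (by fun_prop : Continuous fun x : ℝ =>
      ω * ((z + ω * x) * A x)).continuousOn).intervalIntegrable
  have e1 : ∫ x in (0 : ℝ)..X, ((-w x + ω ^ 3 * (x : ℂ) * u x) + ω ^ 2 * z * u x) * A x =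
      ω * (∫ x in (0 : ℝ)..X, u x * (ω * ((z + ω * x) * A x))) -
        ∫ x in (0 : ℝ)..X, w x * A x := by
    rw [← intervalIntegral.integral_const_mul, ← intervalIntegral.integral_sub
      (huA.const_mul ω) hwA]
    refine intervalIntegral.integral_congr fun x _ => ?_
    ring
  have e2 : ∫ x in (0 : ℝ)..X, v x * (ω * D x) = ω * ∫ x in (0 : ℝ)..X, v x * D x := by
    rw [← intervalIntegral.integral_const_mul]
    refine intervalIntegral.integral_congr fun x _ => ?_
    ring
  simp only [id]
  rw [e1]
  simp only [hA, hD] at hp1 hp2 e2 ⊢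
  rw [e2] at hp1
  linear_combination hp1 - ω * hp2

end Line

/-! ### Uniqueness for the eigenvalue equation -/

/-- Constant extension to the left of 0 gives a function continuous on all of ℝ, so that its
primitives are differentiable everywhere, including at 0. -/
theorem continuous_comp_max_zero {g : ℝ → ℂ} (hg : ∀ b, 0 ≤ b → ContinuousOn g (Icc 0 b)) :
    Continuous fun x : ℝ => g (max x 0) := by
  rw [continuous_iff_continuousAt]
  intro x
  have h1 : ContinuousOn (fun x : ℝ => g (max x 0)) (Iic (|x| + 1)) := by
    refine (hg (|x| + 1) (by positivity)).comp (by fun_prop) fun y hy => ?_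
    exact ⟨le_max_right _ _, max_le hy (by positivity)⟩
  exact h1.continuousAt (Iic_mem_nhds (by linarith [le_abs_self x]))

/-- The equation holds only almost everywhere, but after integration its right side is continuous,
so u and v become classical solutions to which the Grönwall lemma applies. -/
theorem IsW22Loc.eq_zero_of_initial {u v w : ℝ → ℂ} (h : IsW22Loc u v w) (h0 : u 0 = 0)
    (h1 : v 0 = 0) {k : ℝ → ℂ} (hk : Continuous k)
    (hw : w =ᵐ[volume.restrict (Ioi (0 : ℝ))] fun x => k x * u x) (x : ℝ) (hx : 0 ≤ x) :
    u x = 0 := by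
  have hUc := continuous_comp_max_zero h.continuousOn_self
  have hVc := continuous_comp_max_zero h.continuousOn_deriv
  have hu : ∀ y, 0 ≤ y → u y = ∫ s in (0 : ℝ)..y, v (max s 0) := by
    intro y hy
    rw [h.integral_fst y hy, h0, zero_add]
    refine intervalIntegral.integral_congr fun s hs => ?_
    rw [uIcc_of_le hy] at hs
    simp only [max_eq_left hs.1]
  have hv : ∀ y, 0 ≤ y → v y = ∫ s in (0 : ℝ)..y, k s * u (max s 0) := by
    intro y hy
    rw [h.integral_snd y hy, h1, zero_add]
    refine intervalIntegral.integral_congr_ae ?_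
    rw [Filter.EventuallyEq, ae_restrict_iff' measurableSet_Ioi] at hw
    filter_upwards [hw] with s hs hs'
    rw [uIoc_of_le hy] at hs'
    rw [hs hs'.1, max_eq_left hs'.1.le]
  obtain ⟨K, hK⟩ := (isCompact_Icc (a := 0) (b := x)).exists_bound_of_continuousOn hk.continuousOn
  have hdu : ∀ y, HasDerivAt (fun y => ∫ s in (0 : ℝ)..y, v (max s 0)) (v (max y 0)) y :=
    fun y => intervalIntegral.integral_hasDerivAt_right (hVc.intervalIntegrable _ _)
      (hVc.stronglyMeasurableAtFilter _ _) hVc.continuousAt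
  have hkUc : Continuous fun s => k s * u (max s 0) := hk.mul hUc
  have hdv : ∀ y, HasDerivAt (fun y => ∫ s in (0 : ℝ)..y, k s * u (max s 0))
      (k y * u (max y 0)) y :=
    fun y => intervalIntegral.integral_hasDerivAt_right (hkUc.intervalIntegrable _ _)
      (hkUc.stronglyMeasurableAtFilter _ _) hkUc.continuousAt
  have hz := eq_zero_of_linear_system (u := fun y => ∫ s in (0 : ℝ)..y, v (max s 0))
    (v := fun y => ∫ s in (0 : ℝ)..y, k s * u (max s 0)) (α := 1) (k := k) (K := K) (b := x)
    (fun y _ => (hdu y).continuousAt.continuousWithinAt)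
    (fun y _ => (hdv y).continuousAt.continuousWithinAt)
    (fun y hy => by
      have := (hdu y).hasDerivWithinAt (s := Ici y)
      rwa [max_eq_left hy.1, hv y hy.1, ← one_mul (∫ s in (0 : ℝ)..y, k s * u (max s 0))] at this)
    (fun y hy => by
      have := (hdv y).hasDerivWithinAt (s := Ici y)
      rwa [max_eq_left hy.1, hu y hy.1] at this)
    (fun y hy => hK y ⟨hy.1, hy.2.le⟩) (by simp) (by simp) x ⟨hx, le_rfl⟩
  rw [hu x hx]
  exact hz.1

/-- The restriction of `Ai (z + ω x)` to the half-line is in `W²_{2,loc}`. -/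
theorem isW22Loc_airyAi_line (z ω : ℂ) : IsW22Loc (fun x : ℝ => airyAi (z + ω * x))
    (fun x : ℝ => ω * deriv airyAi (z + ω * x))
    (fun x : ℝ => ω * (ω * ((z + ω * x) * airyAi (z + ω * x)))) := by
  have hAc := continuous_airyAi_line z ω
  have hDc := continuous_deriv_airyAi_line z ω
  have hWc : Continuous fun x : ℝ => ω * (ω * ((z + ω * x) * airyAi (z + ω * x))) := by fun_prop
  refine ⟨fun x hx => ?_, fun x hx => ?_, fun b hb => ?_⟩
  · rw [intervalIntegral.integral_eq_sub_of_hasDerivAt (fun y _ => hasDerivAt_airyAi_line z ω y)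
      (Continuous.intervalIntegrable (by fun_prop) _ _)]
    ring
  · rw [intervalIntegral.integral_eq_sub_of_hasDerivAt
      (fun y _ => (hasDerivAt_deriv_airyAi_line z ω y).const_mul ω)
      (hWc.intervalIntegrable _ _)]
    ring
  · obtain ⟨K, hK⟩ := (isCompact_Icc (a := 0) (b := b)).exists_bound_of_continuousOn
      hWc.continuousOn
    refine MemLp.of_bound hWc.aestronglyMeasurable K ?_
    filter_upwards [ae_restrict_mem measurableSet_Ioc] with x hx
    exact hK x ⟨hx.1.le, hx.2⟩

/-! ### Eigenvalues of the Airy operator -/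

theorem isEigenvectorOf_airyOperator_iff (c μ : ℂ) (y : L2HalfLine) :
    IsEigenvectorOf (airyOperator c) μ y ↔ y ≠ 0 ∧ (y, μ • y) ∈ airyGraph c := by
  rw [IsEigenvectorOf, ← airyOperator_graph]
  refine and_congr_right fun _ => ?_
  rw [LinearPMap.mem_graph_iff]
  constructor
  · rintro ⟨hy, h⟩
    exact ⟨⟨y, hy⟩, rfl, h⟩
  · rintro ⟨⟨y', hy'⟩, h1, h2⟩
    have h1 : y' = y := h1
    subst h1
    exact ⟨hy', h2⟩

section Eigen

variable {ω : ℂ} (hω : ω ≠ 0) (harg : |ω.arg| < Real.pi / 3)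

theorem mem_airyGraph_of_ae_eq {z : ℂ} (hz : airyAi z = 0) {y : L2HalfLine}
    (hy : y =ᵐ[volume.restrict (Ioi (0 : ℝ))] fun x => airyAi (z + ω * (x : ℂ))) :
    (y, (-(ω ^ 2 * z)) • y) ∈ airyGraph (ω ^ 3) := by
  refine ⟨_, _, _, isW22Loc_airyAi_line z ω, by simp [hz], hy, ?_⟩
  filter_upwards [Lp.coeFn_smul (-(ω ^ 2 * z)) y, hy] with x h1 h2
  rw [h1, Pi.smul_apply, h2, smul_eq_mul]
  ring

include hω harg in
/-- Green's formula on the graph of the Airy operator. -/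
theorem integral_graph_mul_airyAi_line {y f : L2HalfLine} (h : (y, f) ∈ airyGraph (ω ^ 3)) :
    ∃ u v w : ℝ → ℂ, IsW22Loc u v w ∧ u 0 = 0 ∧ y =ᵐ[volume.restrict (Ioi (0 : ℝ))] u ∧
      f =ᵐ[volume.restrict (Ioi (0 : ℝ))] (fun x => -w x + ω ^ 3 * (x : ℂ) * u x) ∧
      ∀ z, ∫ x in Ioi (0 : ℝ), (f x + ω ^ 2 * z * y x) * airyAi (z + ω * x) = v 0 * airyAi z := by
  obtain ⟨u, v, w, hW, h0, hy, hf⟩ := h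
  refine ⟨u, v, w, hW, h0, hy, hf, fun z => ?_⟩
  rw [← hW.integral_mul_airyAi_line hω harg h0 ((memLp_congr_ae hy).1 (Lp.memLp y))
    ((memLp_congr_ae hf).1 (Lp.memLp f)) z]
  refine integral_congr_ae ?_
  filter_upwards [hy, hf] with x h1 h2
  rw [h1, h2]

include hω harg in
-- At z = -μ/ω² the integrand in Green's formula vanishes, leaving v(0)Ai(z) = 0; and v(0) = 0 would
-- give zero Cauchy data, hence y = 0.
theorem airyAi_eq_zero_of_eigenvector {μ : ℂ} {y : L2HalfLine} (hy0 : y ≠ 0)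
    (h : (y, μ • y) ∈ airyGraph (ω ^ 3)) : airyAi (-(μ / ω ^ 2)) = 0 := by
  obtain ⟨u, v, w, hW, h0, hy, hf, hG⟩ := integral_graph_mul_airyAi_line hω harg h
  have hint : ∫ x in Ioi (0 : ℝ), ((μ • y : L2HalfLine) x + ω ^ 2 * (-(μ / ω ^ 2)) * y x) *
      airyAi (-(μ / ω ^ 2) + ω * x) = 0 := by
    refine integral_eq_zero_of_ae ?_
    filter_upwards [Lp.coeFn_smul μ y] with x hx
    rw [hx, Pi.smul_apply, smul_eq_mul]
    field_simp
    simp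
  rw [hG] at hint
  refine (mul_eq_zero.1 hint).resolve_left fun hv0 => hy0 ?_
  have hw : w =ᵐ[volume.restrict (Ioi (0 : ℝ))] fun x => (ω ^ 3 * x - μ) * u x := by
    filter_upwards [hy, hf, Lp.coeFn_smul μ y] with x h1 h2 h3
    rw [h3, Pi.smul_apply, h1, smul_eq_mul] at h2
    linear_combination h2
  have hu := hW.eq_zero_of_initial h0 hv0 (by fun_prop) hw
  refine Lp.ext ?_
  filter_upwards [hy, Lp.coeFn_zero ℂ 2 (volume.restrict (Ioi (0 : ℝ))),
    ae_restrict_mem measurableSet_Ioi] with x h1 h2 hx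
  rw [h1, h2, hu x (le_of_lt hx)]
  rfl

/-- Subtract the multiple of `e` with the same derivative at 0, available because Ai'(z) ≠ 0; the
difference has zero Cauchy data. -/
theorem eigenvector_eq_smul (hω : ω ≠ 0) {z : ℂ} (hz : airyAi z = 0) {e : L2HalfLine}
    (he : e =ᵐ[volume.restrict (Ioi (0 : ℝ))] fun x => airyAi (z + ω * (x : ℂ))) {y : L2HalfLine}
    (h : (y, (-(ω ^ 2 * z)) • y) ∈ airyGraph (ω ^ 3)) : ∃ k : ℂ, y = k • e := by
  obtain ⟨u, v, w, hW, h0, hy, hf⟩ := h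
  have hD : ω * deriv airyAi z ≠ 0 := mul_ne_zero hω (deriv_airyAi_ne_zero hz)
  set k := v 0 / (ω * deriv airyAi z) with hk
  have hW2 := hW.add ((isW22Loc_airyAi_line z ω).smul (-k))
  have hzero := hW2.eq_zero_of_initial (by simp [h0, hz])
    (by
      simp only [Complex.ofReal_zero, mul_zero, add_zero]
      rw [hk, neg_mul, div_mul_cancel₀ _ hD, add_neg_cancel])
    (k := fun x => ω ^ 3 * x + ω ^ 2 * z) (by fun_prop) (by
      filter_upwards [hy, hf, Lp.coeFn_smul (-(ω ^ 2 * z)) y] with x h1 h2 h3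
      rw [h3, Pi.smul_apply, h1, smul_eq_mul] at h2
      linear_combination h2)
  refine ⟨k, Lp.ext ?_⟩
  filter_upwards [hy, he, Lp.coeFn_smul k e, ae_restrict_mem measurableSet_Ioi] with x h1 h2 h3 hx
  have := hzero x (le_of_lt hx)
  rw [h1, h3, Pi.smul_apply, h2, smul_eq_mul]
  linear_combination this

include hω harg in
-- The Airy equation makes ζAi² - Ai'² a primitive of Ai². No conjugate appears, so for nonreal ω
-- the integral is nonzero because of simplicity of the zero, not positivity.
theorem integral_airyAi_line_sq {z : ℂ} (hz : airyAi z = 0) :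
    ∫ x in Ioi (0 : ℝ), airyAi (z + ω * x) * airyAi (z + ω * x) = deriv airyAi z ^ 2 / ω := by
  obtain ⟨C, hC, hb⟩ := exists_airyAi_line_bound hω harg z (N := 2) zero_le_two
  have hint : IntegrableOn (fun x : ℝ => airyAi (z + ω * x) * airyAi (z + ω * x)) (Ioi 0) :=
    MemLp.integrable_mul (memLp_airyAi_line hω harg z) (memLp_airyAi_line hω harg z)
  have hder : ∀ x : ℝ, HasDerivAt (fun x : ℝ => ((z + ω * x) * airyAi (z + ω * x) ^ 2 -
      deriv airyAi (z + ω * x) ^ 2) / ω) (airyAi (z + ω * x) * airyAi (z + ω * x)) x := by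
    intro x
    have h1 : HasDerivAt (fun x : ℝ => z + ω * (x : ℂ)) ω x := by
      simpa using ((Complex.ofRealCLM.hasDerivAt (x := x)).const_mul ω).const_add z
    refine (((h1.mul ((hasDerivAt_airyAi_line z ω x).pow 2)).sub
      ((hasDerivAt_deriv_airyAi_line z ω x).pow 2)).div_const ω).congr_deriv ?_
    field_simp
    simp
    ring
  have hlim : Filter.Tendsto (fun x : ℝ => ((z + ω * x) * airyAi (z + ω * x) ^ 2 -
      deriv airyAi (z + ω * x) ^ 2) / ω) Filter.atTop (nhds 0) := by
    have h2 : Filter.Tendsto (fun x : ℝ => (z + ω * x) * airyAi (z + ω * x)) Filter.atTop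
        (nhds 0) := by
      refine squeeze_zero_norm' ?_ (tendsto_exp_neg_mul_atTop one_pos ((‖z‖ + ‖ω‖) * C))
      filter_upwards [Filter.eventually_ge_atTop 0] with x hx
      have h4 : ‖z + ω * x‖ ≤ (‖z‖ + ‖ω‖) * Real.exp x := by
        refine (norm_add_le _ _).trans ?_
        rw [norm_mul, Complex.norm_real, Real.norm_of_nonneg hx, add_mul]
        refine add_le_add (le_mul_of_one_le_right (norm_nonneg _) (Real.one_le_exp hx)) ?_
        gcongr
        linarith [Real.add_one_le_exp x]
      rw [norm_mul]
      refine (mul_le_mul h4 (hb x hx).1 (norm_nonneg _) (by positivity)).trans (le_of_eq ?_)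
      have h5 : Real.exp (-(1 * x)) = Real.exp x * Real.exp (-(2 * x)) := by
        rw [← Real.exp_add]
        congr 1
        ring
      rw [h5]
      ring
    have h3 := ((h2.mul (tendsto_airyAi_line hω harg z)).sub
      ((tendsto_deriv_airyAi_line hω harg z).pow 2)).div_const ω
    simp only [mul_zero, ne_eq, OfNat.ofNat_ne_zero, not_false_eq_true, zero_pow, sub_zero,
      zero_div] at h3
    refine h3.congr fun x => ?_
    ring
  have := integral_Ioi_of_hasDerivAt_of_tendsto (a := 0)
    (hder 0).continuousAt.continuousWithinAt (fun x _ => hder x) hint hlim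
  rw [this]
  simp [hz]
  ring

end Eigen

/-! ### Algebraic simplicity and minimality -/

section Simple

variable {ω : ℂ} (hω : ω ≠ 0) (harg : |ω.arg| < Real.pi / 3)
include hω harg

/-- Decaying solutions that vanish at `0` are orthogonal, for the bilinear pairing, to the range of
`L - μ`. -/
theorem integral_mul_airyAi_line_eq_zero {z : ℂ} (hz : airyAi z = 0) {y f : L2HalfLine}
    (h : (y, f) ∈ airyGraph (ω ^ 3)) :
    ∫ x in Ioi (0 : ℝ), (f x + ω ^ 2 * z * y x) * airyAi (z + ω * x) = 0 := by
  obtain ⟨-, v, -, -, -, -, -, hG⟩ := integral_graph_mul_airyAi_line hω harg h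
  rw [hG, hz, mul_zero]

/-- If (L - μ)y = ae, pairing with the eigenfunction kills the left side and gives a·Ai'(z)²/ω on
the right; so a = 0 and y is itself a multiple of e. -/
theorem rootSubspaceLevel_le_span {z : ℂ} (hz : airyAi z = 0) {e : L2HalfLine}
    (he : e =ᵐ[volume.restrict (Ioi (0 : ℝ))] fun x => airyAi (z + ω * (x : ℂ))) (k : ℕ) :
    rootSubspaceLevel (airyOperator (ω ^ 3)) (-(ω ^ 2 * z)) k ≤ Submodule.span ℂ {e} := by
  induction k with
  | zero => exact bot_le
  | succ k ih =>
    rintro _ ⟨⟨y, hyd⟩, hy, rfl⟩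
    have hy1 := ih hy
    obtain ⟨a, ha⟩ := Submodule.mem_span_singleton.1 hy1
    set f := airyOperator (ω ^ 3) ⟨y, hyd⟩ with hf
    have hgr : (y, f) ∈ airyGraph (ω ^ 3) := by
      rw [← airyOperator_graph]
      exact LinearPMap.mem_graph _ ⟨y, hyd⟩
    have hfa : f = (-(ω ^ 2 * z)) • y + a • e := by
      rw [ha]
      change f = _ + (f - (-(ω ^ 2 * z)) • y)
      abel
    have hpair := integral_mul_airyAi_line_eq_zero hω harg hz hgr
    have hpair2 : ∫ x in Ioi (0 : ℝ), (f x + ω ^ 2 * z * y x) * airyAi (z + ω * x) =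
        a * (deriv airyAi z ^ 2 / ω) := by
      rw [← integral_airyAi_line_sq hω harg hz, ← integral_const_mul]
      refine integral_congr_ae ?_
      filter_upwards [he, Lp.coeFn_add ((-(ω ^ 2 * z)) • y) (a • e),
        Lp.coeFn_smul (-(ω ^ 2 * z)) y, Lp.coeFn_smul a e] with x h1 h2 h3 h4
      rw [hfa, h2, Pi.add_apply, h3, h4, Pi.smul_apply, Pi.smul_apply, h1]
      simp only [smul_eq_mul]
      ring
    have ha0 : a = 0 := by
      rw [hpair2] at hpair
      refine (mul_eq_zero.1 hpair).resolve_right ?_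
      exact div_ne_zero (pow_ne_zero 2 (deriv_airyAi_ne_zero hz)) hω
    rw [hfa, ha0, zero_smul, add_zero] at hgr
    obtain ⟨k, hk⟩ := eigenvector_eq_smul hω hz he hgr
    exact Submodule.mem_span_singleton.2 ⟨k, hk.symm⟩

theorem ae_airyAi_line_ne_zero {z : ℂ} (hz : airyAi z = 0) {e : L2HalfLine}
    (he : e =ᵐ[volume.restrict (Ioi (0 : ℝ))] fun x => airyAi (z + ω * (x : ℂ))) : e ≠ 0 := by
  rintro rfl
  have h := integral_airyAi_line_sq hω harg hz
  rw [integral_eq_zero_of_ae] at h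
  · exact div_ne_zero (pow_ne_zero 2 (deriv_airyAi_ne_zero hz)) hω h.symm
  · filter_upwards [he, Lp.coeFn_zero ℂ 2 (volume.restrict (Ioi (0 : ℝ)))] with x h1 h2
    rw [h2] at h1
    rw [← h1]
    simp

theorem isEigenvectorOf_airyAi_line {z : ℂ} (hz : airyAi z = 0) {e : L2HalfLine}
    (he : e =ᵐ[volume.restrict (Ioi (0 : ℝ))] fun x => airyAi (z + ω * (x : ℂ))) :
    IsEigenvectorOf (airyOperator (ω ^ 3)) (-(ω ^ 2 * z)) e :=
  (isEigenvectorOf_airyOperator_iff _ _ _).2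
    ⟨ae_airyAi_line_ne_zero hω harg hz he, mem_airyGraph_of_ae_eq hz he⟩

theorem isSimpleEigenvalue_airyOperator {z : ℂ} (hz : airyAi z = 0) :
    IsSimpleEigenvalue (airyOperator (ω ^ 3)) (-(ω ^ 2 * z)) := by
  set e : L2HalfLine := (memLp_airyAi_line hω harg z).toLp _ with hedef
  have he : e =ᵐ[volume.restrict (Ioi (0 : ℝ))] fun x => airyAi (z + ω * (x : ℂ)) :=
    MemLp.coeFn_toLp _
  have hev := isEigenvectorOf_airyAi_line hω harg hz he
  refine ⟨⟨e, hev⟩, ?_⟩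
  have hroot : rootSubspace (airyOperator (ω ^ 3)) (-(ω ^ 2 * z)) = Submodule.span ℂ {e} := by
    refine le_antisymm (iSup_le fun k => rootSubspaceLevel_le_span hω harg hz he k) ?_
    rw [Submodule.span_singleton_le_iff_mem]
    refine Submodule.mem_iSup_of_mem 1 ?_
    obtain ⟨-, hd, hL⟩ := hev
    refine ⟨⟨e, hd⟩, ?_, rfl⟩
    change airyOperator (ω ^ 3) ⟨e, hd⟩ - (-(ω ^ 2 * z)) • e ∈ (⊥ : Submodule ℂ L2HalfLine)
    rw [hL, sub_self]
    exact Submodule.zero_mem _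
  rw [hroot]
  exact finrank_span_singleton hev.1

/-- The eigenfunctions of the Airy operator form a minimal system. -/
theorem isMinimalSystem_airyAi_line {t : ℕ → ℝ} (ht : StrictMono t)
    (hz : ∀ n, airyAi (-(t n : ℂ)) = 0) {y : ℕ → L2HalfLine}
    (hy : ∀ n, y n =ᵐ[volume.restrict (Ioi (0 : ℝ))]
      fun x => airyAi (-(t n : ℂ) + ω * (x : ℂ))) : IsMinimalSystem y := by
  intro n hn
  set A := fun x : ℝ => airyAi (-(t n : ℂ) + ω * x) with hA
  have hAm : MemLp A 2 (volume.restrict (Ioi (0 : ℝ))) := memLp_airyAi_line hω harg _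
  -- Conjugating turns the Hermitian product into the bilinear pairing for which distinct
  -- eigenfunctions are orthogonal.
  set g : L2HalfLine := hAm.star.toLp _ with hg
  have hinner : ∀ f : L2HalfLine, inner ℂ g f = ∫ x in Ioi (0 : ℝ), f x * A x := by
    intro f
    rw [L2.inner_def]
    refine integral_congr_ae ?_
    filter_upwards [hAm.star.coeFn_toLp] with x hx
    rw [hg, hx]
    simp
  have hself : inner ℂ g (y n) ≠ 0 := by
    rw [hinner]
    have h1 : ∫ x in Ioi (0 : ℝ), y n x * A x = ∫ x in Ioi (0 : ℝ), A x * A x := by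
      refine integral_congr_ae ?_
      filter_upwards [hy n] with x hx
      rw [hx]
    rw [h1, integral_airyAi_line_sq hω harg (hz n)]
    exact div_ne_zero (pow_ne_zero 2 (deriv_airyAi_ne_zero (hz n))) hω
  have horth : ∀ m, m ≠ n → inner ℂ g (y m) = 0 := by
    intro m hmn
    rw [hinner]
    have h1 := integral_mul_airyAi_line_eq_zero hω harg (hz n)
      (mem_airyGraph_of_ae_eq (hz m) (hy m))
    have h2 : ∫ x in Ioi (0 : ℝ), (((-(ω ^ 2 * -(t m : ℂ))) • y m : L2HalfLine) x +
        ω ^ 2 * -(t n : ℂ) * y m x) * airyAi (-(t n : ℂ) + ω * x) =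
        ω ^ 2 * (t m - t n) * ∫ x in Ioi (0 : ℝ), y m x * A x := by
      rw [← integral_const_mul]
      refine integral_congr_ae ?_
      filter_upwards [Lp.coeFn_smul (-(ω ^ 2 * -(t m : ℂ))) (y m)] with x hx
      rw [hx, Pi.smul_apply, smul_eq_mul]
      ring
    rw [h2] at h1
    refine (mul_eq_zero.1 h1).resolve_left ?_
    refine mul_ne_zero (pow_ne_zero 2 hω) (sub_ne_zero.2 ?_)
    exact_mod_cast ht.injective.ne hmn
  have hsub : (Submodule.span ℂ (y '' {n}ᶜ)).topologicalClosure ≤ (innerSL ℂ g).ker := by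
    refine Submodule.topologicalClosure_minimal _ ?_ (innerSL ℂ g).isClosed_ker
    rw [Submodule.span_le]
    rintro _ ⟨m, hm, rfl⟩
    exact horth m hm
  exact hself (hsub hn)

end Simple

/-! ### Functions with vanishing moments -/

open scoped FourierTransform ContDiff in
-- A test function is the Fourier transform of a Schwartz function; moving that transform onto g
-- gives zero.
theorem ae_eq_zero_of_fourier_eq_zero {g : ℝ → ℂ} (hg : Integrable g)
    (h : ∀ ξ : ℝ, ∫ x : ℝ, Complex.exp (ξ * Complex.I * x) * g x = 0) : ∀ᵐ x, g x = 0 := by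
  refine ae_eq_zero_of_integral_contDiff_smul_eq_zero hg.locallyIntegrable fun φ hφ hφc => ?_
  have hφ2 : ContDiff ℝ ∞ fun x => (φ x : ℂ) := Complex.ofRealCLM.contDiff.comp hφ
  have hφc2 : HasCompactSupport fun x => (φ x : ℂ) :=
    hφc.comp_left Complex.ofReal_zero
  set Φ : SchwartzMap ℝ ℂ := hφc2.toSchwartzMap hφ2 with hΦ
  have hFg : 𝓕 g = 0 := by
    funext ξ
    rw [Real.fourier_eq']
    have := h (-2 * Real.pi * ξ)
    rw [Pi.zero_apply, ← this]
    refine integral_congr_ae (Filter.Eventually.of_forall fun x => ?_)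
    simp only [smul_eq_mul]
    congr 2
    simp
    ring
  have hinv : 𝓕 (𝓕⁻ Φ : SchwartzMap ℝ ℂ) = Φ := FourierTransform.fourier_fourierInv_eq Φ
  have hflip := VectorFourier.integral_fourierIntegral_smul_eq_flip (𝕜 := ℝ) (V := ℝ) (W := ℝ)
    (e := Real.fourierChar) (μ := volume) (ν := volume) (L := innerₗ ℝ)
    (f := ((𝓕⁻ Φ : SchwartzMap ℝ ℂ) : ℝ → ℂ)) (g := g) Real.continuous_fourierChar
    continuous_inner (SchwartzMap.integrable _) hg
  have e1 : ∀ ξ, VectorFourier.fourierIntegral Real.fourierChar volume (innerₗ ℝ)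
      ((𝓕⁻ Φ : SchwartzMap ℝ ℂ) : ℝ → ℂ) ξ = φ ξ := by
    intro ξ
    have h1 : 𝓕 ((𝓕⁻ Φ : SchwartzMap ℝ ℂ) : ℝ → ℂ) ξ = Φ ξ := by
      rw [← SchwartzMap.fourier_coe, hinv]
    exact h1
  have e2 : ∀ x, VectorFourier.fourierIntegral Real.fourierChar volume (innerₗ ℝ).flip g x = 0 := by
    intro x
    rw [flip_innerₗ]
    exact congrFun hFg x
  simp only [e1, e2, smul_zero, integral_zero] at hflip
  exact_mod_cast hflip

/-- The exponential weights allow exp(iξx) to be expanded under the integral, so vanishing moments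
force the Fourier transform to vanish. -/
theorem ae_eq_zero_of_moments {g : ℝ → ℂ} (hg : ∀ N : ℝ,
    IntegrableOn (fun x => Real.exp (N * x) * ‖g x‖) (Ioi 0))
    (hm : AEStronglyMeasurable g (volume.restrict (Ioi 0)))
    (h : ∀ k : ℕ, ∫ x in Ioi (0 : ℝ), (x : ℂ) ^ k * g x = 0) :
    ∀ᵐ x ∂volume.restrict (Ioi (0 : ℝ)), g x = 0 := by
  have hgi : IntegrableOn g (Ioi 0) := by
    have := hg 0
    simp only [zero_mul, Real.exp_zero, one_mul] at this
    exact (integrable_norm_iff hm).1 this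
  have hexp : ∀ ξ : ℝ, ∫ x in Ioi (0 : ℝ), Complex.exp (ξ * Complex.I * x) * g x = 0 := by
    intro ξ
    have hs := hasSum_integral_of_dominated_convergence (μ := volume.restrict (Ioi (0 : ℝ)))
      (F := fun (n : ℕ) (x : ℝ) => (ξ * Complex.I) ^ n / n.factorial * ((x : ℂ) ^ n * g x))
      (f := fun x : ℝ => Complex.exp (ξ * Complex.I * x) * g x)
      (fun n x => (|ξ| * x) ^ n / n.factorial * ‖g x‖)
      (fun n => ((by fun_prop : Continuous fun x : ℝ => (x : ℂ) ^ n).aestronglyMeasurable.mul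
        hm).const_mul _) ?_ ?_ ?_ ?_
    · simp only [integral_const_mul, h, mul_zero] at hs
      exact hs.unique hasSum_zero
    · intro n
      filter_upwards [ae_restrict_mem measurableSet_Ioi] with x hx
      have hx : 0 < x := hx
      rw [norm_mul, norm_mul, norm_div, norm_pow, norm_pow, norm_mul, Complex.norm_I,
        Complex.norm_natCast, Complex.norm_real, Complex.norm_real, Real.norm_of_nonneg hx.le,
        Real.norm_eq_abs, mul_pow]
      apply le_of_eq
      ring
    · exact Filter.Eventually.of_forall fun x => (Real.summable_pow_div_factorial _).mul_right _
    · refine (hg |ξ|).congr (Filter.Eventually.of_forall fun x => ?_)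
      simp only
      rw [tsum_mul_right, Real.exp_eq_exp_ℝ, NormedSpace.exp_eq_tsum_div]
    · refine Filter.Eventually.of_forall fun x => ?_
      have := (NormedSpace.expSeries_div_hasSum_exp (ξ * Complex.I * x)).mul_right (g x)
      rw [← Complex.exp_eq_exp_ℂ] at this
      convert! this using 1
      funext n
      rw [mul_pow (ξ * Complex.I : ℂ)]
      ring
  have h0 := ae_eq_zero_of_fourier_eq_zero (g := (Ioi (0 : ℝ)).indicator g)
    (hgi.integrable_indicator measurableSet_Ioi) fun ξ => by
      rw [← hexp ξ, ← integral_indicator measurableSet_Ioi]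
      congr 1
      funext x
      by_cases hx : x ∈ Ioi (0 : ℝ) <;> simp [hx]
  rw [ae_restrict_iff' measurableSet_Ioi]
  filter_upwards [h0] with x hx hx'
  rwa [indicator_of_mem hx'] at hx

/-! ### The transform `z ↦ ∫ f(x) Ai(z + ω x) dx` -/

section Transform

variable {ω : ℂ}

/-- Superexponential decay along the rays `z + ω x`, with control of the dependence on `z`. -/
def LineDecay (ω : ℂ) (K : ℂ → ℂ) : Prop := ∀ N : ℝ, 0 ≤ N → ∃ C B : ℝ, 0 < C ∧ 0 < B ∧
  ∀ (z : ℂ) (x : ℝ), 0 ≤ x →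
    ‖K (z + ω * x)‖ ≤ C * Real.exp (B * ((1 + ‖z‖) * √(1 + ‖z‖))) * Real.exp (-(N * x))

/-- Needed because the second derivative of Ai is wAi(w). The factor |z + ωx| is paid for by one
unit of decay rate and one unit of B. -/
theorem LineDecay.mul_self {K : ℂ → ℂ} (hK : LineDecay ω K) : LineDecay ω fun w => w * K w := by
  intro N hN
  obtain ⟨C, B, hC, hB, h⟩ := hK (N + 1) (by linarith)
  refine ⟨(1 + ‖ω‖) * C, B + 1, by positivity, by positivity, fun z x hx => ?_⟩
  set R := 1 + ‖z‖ with hR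
  have hR1 : 1 ≤ R := by linarith [norm_nonneg z]
  have hs : 1 ≤ √R := Real.one_le_sqrt.2 hR1
  have h1 : ‖z + ω * x‖ ≤ (1 + ‖ω‖) * Real.exp (R * √R) * Real.exp x := by
    have h2 : R ≤ Real.exp (R * √R) := by
      have : R * 1 ≤ R * √R := by gcongr
      linarith [Real.add_one_le_exp (R * √R)]
    have h3 : 1 ≤ Real.exp (R * √R) := by linarith
    have h4 : 1 ≤ Real.exp x := Real.one_le_exp hx
    have h5 : x ≤ Real.exp x := by linarith [Real.add_one_le_exp x]
    calc ‖z + ω * x‖ ≤ ‖z‖ + ‖ω‖ * x := by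
          refine (norm_add_le _ _).trans ?_
          rw [norm_mul, Complex.norm_real, Real.norm_of_nonneg hx]
      _ ≤ Real.exp (R * √R) * Real.exp x + ‖ω‖ * (Real.exp (R * √R) * Real.exp x) := by
          gcongr
          · nlinarith [norm_nonneg z]
          · nlinarith
      _ = _ := by ring
  rw [norm_mul]
  refine (mul_le_mul h1 (h z x hx) (norm_nonneg _) (by positivity)).trans (le_of_eq ?_)
  rw [show (B + 1) * (R * √R) = R * √R + B * (R * √R) by ring, Real.exp_add,
    show -(N * x) = x + -((N + 1) * x) by ring, Real.exp_add]
  ring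

theorem lineDecay_airyAi (hω : ω ≠ 0) (harg : |ω.arg| < Real.pi / 3) : LineDecay ω airyAi :=
  fun N hN => norm_airyAi_line_le hω harg N hN

theorem lineDecay_deriv_airyAi (hω : ω ≠ 0) (harg : |ω.arg| < Real.pi / 3) :
    LineDecay ω (deriv airyAi) :=
  fun N hN => norm_deriv_airyAi_line_le hω harg N hN

variable {f : ℝ → ℂ} {M : ℝ}

theorem LineDecay.integrable_mul {K : ℂ → ℂ} (hK : LineDecay ω K) (hKc : Continuous K)
    (hM : 0 ≤ M) (hm : AEStronglyMeasurable f (volume.restrict (Ioi 0)))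
    (hf : IntegrableOn (fun x => ‖f x‖ * Real.exp (-(M * x))) (Ioi 0)) (z : ℂ) :
    IntegrableOn (fun x : ℝ => f x * K (z + ω * x)) (Ioi 0) := by
  obtain ⟨C, B, hC, hB, h⟩ := hK M hM
  refine (hf.mul_const (C * Real.exp (B * ((1 + ‖z‖) * √(1 + ‖z‖))))).mono'
    (hm.mul (by fun_prop : Continuous fun x : ℝ => K (z + ω * x)).aestronglyMeasurable) ?_
  filter_upwards [ae_restrict_mem measurableSet_Ioi] with x hx
  rw [norm_mul]
  calc _ ≤ ‖f x‖ * (C * Real.exp (B * ((1 + ‖z‖) * √(1 + ‖z‖))) * Real.exp (-(M * x))) := by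
        gcongr
        exact h z x (le_of_lt hx)
    _ = _ := by ring

theorem LineDecay.hasDerivAt_integral {K K' : ℂ → ℂ} (hK : LineDecay ω K) (hK' : LineDecay ω K')
    (hKd : ∀ w, HasDerivAt K (K' w) w) (hKc' : Continuous K') (hM : 0 ≤ M)
    (hm : AEStronglyMeasurable f (volume.restrict (Ioi 0)))
    (hf : IntegrableOn (fun x => ‖f x‖ * Real.exp (-(M * x))) (Ioi 0)) (z : ℂ) :
    HasDerivAt (fun z => ∫ x in Ioi (0 : ℝ), f x * K (z + ω * x))
      (∫ x in Ioi (0 : ℝ), f x * K' (z + ω * x)) z := by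
  obtain ⟨C, B, hC, hB, h⟩ := hK' M hM
  have hKc : Continuous K := continuous_iff_continuousAt.2 fun x => (hKd x).continuousAt
  set R := 2 + ‖z‖ with hR
  refine (hasDerivAt_integral_of_dominated_loc_of_deriv_le (μ := volume.restrict (Ioi (0 : ℝ)))
    (F := fun z x => f x * K (z + ω * x)) (F' := fun z x => f x * K' (z + ω * x))
    (bound := fun x => ‖f x‖ * Real.exp (-(M * x)) * (C * Real.exp (B * (R * √R))))
    (Metric.ball_mem_nhds z one_pos)
    (Filter.Eventually.of_forall fun w => hm.mul
      (by fun_prop : Continuous fun x : ℝ => K (w + ω * x)).aestronglyMeasurable)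
    (hK.integrable_mul hKc hM hm hf z)
    (hm.mul (by fun_prop : Continuous fun x : ℝ => K' (z + ω * x)).aestronglyMeasurable)
    ?_ (hf.mul_const _) ?_).2
  · filter_upwards [ae_restrict_mem measurableSet_Ioi] with x hx w hw
    rw [norm_mul]
    have hwR : 1 + ‖w‖ ≤ R := by
      have : ‖w‖ ≤ ‖z‖ + ‖w - z‖ := by
        have := norm_add_le z (w - z)
        rwa [add_sub_cancel] at this
      rw [mem_ball_iff_norm] at hw
      linarith
    calc _ ≤ ‖f x‖ * (C * Real.exp (B * ((1 + ‖w‖) * √(1 + ‖w‖))) * Real.exp (-(M * x))) := by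
          gcongr
          exact h w x (le_of_lt hx)
      _ ≤ ‖f x‖ * (C * Real.exp (B * (R * √R)) * Real.exp (-(M * x))) := by gcongr
      _ = _ := by ring
  · refine Filter.Eventually.of_forall fun x w _ => ?_
    have h1 : HasDerivAt (fun w : ℂ => w + ω * x) 1 w := (hasDerivAt_id w).add_const _
    simpa using ((hKd (w + ω * x)).comp w h1).const_mul (f x)

/-- x·exp(-x) ≤ 1, so each power of x costs one unit of the weight's rate. -/
theorem integrableOn_mul_id (hf : IntegrableOn (fun x => ‖f x‖ * Real.exp (-(M * x))) (Ioi 0))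
    (hm : AEStronglyMeasurable f (volume.restrict (Ioi 0))) :
    IntegrableOn (fun x : ℝ => ‖(x : ℂ) * f x‖ * Real.exp (-((M + 1) * x))) (Ioi 0) := by
  refine hf.mono' (by fun_prop) ?_
  filter_upwards [ae_restrict_mem measurableSet_Ioi] with x hx
  have hx : 0 < x := hx
  rw [Real.norm_of_nonneg (by positivity), norm_mul, Complex.norm_real, Real.norm_of_nonneg hx.le,
    show -((M + 1) * x) = -(M * x) + -x by ring, Real.exp_add]
  have h1 : x * Real.exp (-x) ≤ 1 := by
    rw [Real.exp_neg, ← div_eq_mul_inv, div_le_one (Real.exp_pos x)]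
    linarith [Real.add_one_le_exp x]
  calc x * ‖f x‖ * (Real.exp (-(M * x)) * Real.exp (-x))
      = ‖f x‖ * Real.exp (-(M * x)) * (x * Real.exp (-x)) := by ring
    _ ≤ ‖f x‖ * Real.exp (-(M * x)) * 1 := by gcongr
    _ = _ := mul_one _

section Airy

variable (hω : ω ≠ 0) (harg : |ω.arg| < Real.pi / 3)
include hω harg

theorem hasDerivAt_airyTransform (hM : 0 ≤ M)
    (hm : AEStronglyMeasurable f (volume.restrict (Ioi 0)))
    (hf : IntegrableOn (fun x => ‖f x‖ * Real.exp (-(M * x))) (Ioi 0)) (z : ℂ) :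
    HasDerivAt (fun z => ∫ x in Ioi (0 : ℝ), f x * airyAi (z + ω * x))
      (∫ x in Ioi (0 : ℝ), f x * deriv airyAi (z + ω * x)) z :=
  (lineDecay_airyAi hω harg).hasDerivAt_integral (lineDecay_deriv_airyAi hω harg)
    airyAi_hasDerivAt deriv_airyAi_continuous hM hm hf z

/-- Differentiate the vanishing transform twice and use Ai''(z + ωx) = (z + ωx)Ai(z + ωx);
subtracting z times the transform leaves ω times the claim. -/
theorem airyTransform_mul_id_eq_zero (hM : 0 ≤ M)
    (hm : AEStronglyMeasurable f (volume.restrict (Ioi 0)))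
    (hf : IntegrableOn (fun x => ‖f x‖ * Real.exp (-(M * x))) (Ioi 0))
    (h : ∀ z, ∫ x in Ioi (0 : ℝ), f x * airyAi (z + ω * x) = 0) (z : ℂ) :
    ∫ x in Ioi (0 : ℝ), (x : ℂ) * f x * airyAi (z + ω * x) = 0 := by
  have h1 : ∀ z, ∫ x in Ioi (0 : ℝ), f x * deriv airyAi (z + ω * x) = 0 := fun z => by
    have := hasDerivAt_airyTransform hω harg hM hm hf z
    simp only [h] at this
    exact this.unique (hasDerivAt_const z 0)
  have hdec := (lineDecay_airyAi hω harg).mul_self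
  have h2 : ∫ x in Ioi (0 : ℝ), f x * ((z + ω * x) * airyAi (z + ω * x)) = 0 := by
    have := (lineDecay_deriv_airyAi hω harg).hasDerivAt_integral hdec
      deriv_airyAi_hasDerivAt (continuous_id.mul airyAi_continuous) hM hm hf z
    simp only [h1] at this
    exact this.unique (hasDerivAt_const z 0)
  have hi1 := (lineDecay_airyAi hω harg).integrable_mul airyAi_continuous hM hm hf z
  have hi2 := hdec.integrable_mul (continuous_id.mul airyAi_continuous) hM hm hf z
  have h3 : ω * ∫ x in Ioi (0 : ℝ), (x : ℂ) * f x * airyAi (z + ω * x) = 0 := by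
    calc _ = ∫ x in Ioi (0 : ℝ), (f x * ((z + ω * x) * airyAi (z + ω * x)) -
          z * (f x * airyAi (z + ω * x))) := by
          rw [← integral_const_mul]
          refine integral_congr_ae (Filter.Eventually.of_forall fun x => ?_)
          simp only
          ring
      _ = 0 := by
          rw [integral_sub hi2 (hi1.const_mul z), integral_const_mul, h2, h, mul_zero, sub_zero]
  exact (mul_eq_zero.1 h3).resolve_left hω

theorem airyAi_ray_ne_zero {x : ℝ} (hx : 0 < x) : airyAi (0 + ω * x) ≠ 0 := by
  intro h
  have h1 := (im_eq_zero_and_re_neg_of_airyAi_eq_zero h).2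
  rw [zero_add, Complex.re_mul_ofReal, ← Complex.norm_mul_cos_arg] at h1
  have h2 : 0 < Real.cos ω.arg := by
    rw [← Real.cos_abs]
    exact Real.cos_pos_of_mem_Ioo ⟨by linarith [abs_nonneg ω.arg, Real.pi_pos],
      by linarith [Real.pi_pos]⟩
  have h3 : 0 < ‖ω‖ := norm_pos_iff.2 hω
  have : 0 < ‖ω‖ * Real.cos ω.arg * x := by positivity
  linarith

/-- The transform `f ↦ ∫ f(x) Ai(z + ω x) dx` is injective. -/
theorem ae_eq_zero_of_airyTransform_eq_zero (hM : 0 ≤ M)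
    (hm : AEStronglyMeasurable f (volume.restrict (Ioi 0)))
    (hf : IntegrableOn (fun x => ‖f x‖ * Real.exp (-(M * x))) (Ioi 0))
    (h : ∀ z, ∫ x in Ioi (0 : ℝ), f x * airyAi (z + ω * x) = 0) :
    ∀ᵐ x ∂volume.restrict (Ioi (0 : ℝ)), f x = 0 := by
  have hpow : ∀ k : ℕ, AEStronglyMeasurable (fun x : ℝ => (x : ℂ) ^ k * f x)
      (volume.restrict (Ioi 0)) ∧
      IntegrableOn (fun x : ℝ => ‖(x : ℂ) ^ k * f x‖ * Real.exp (-((M + k) * x))) (Ioi 0) ∧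
      ∀ z, ∫ x in Ioi (0 : ℝ), (x : ℂ) ^ k * f x * airyAi (z + ω * x) = 0 := by
    intro k
    induction k with
    | zero => simpa using ⟨hm, hf, h⟩
    | succ k ih =>
      obtain ⟨i1, i2, i3⟩ := ih
      have e : ∀ x : ℝ, (x : ℂ) ^ (k + 1) * f x = (x : ℂ) * ((x : ℂ) ^ k * f x) := fun x => by ring
      simp_rw [e]
      refine ⟨(by fun_prop : Continuous fun x : ℝ => (x : ℂ)).aestronglyMeasurable.mul i1, ?_,
        airyTransform_mul_id_eq_zero hω harg (by positivity) i1 i2 i3⟩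
      have := integrableOn_mul_id i2 i1
      push_cast
      simpa only [add_assoc] using this
  have hz := ae_eq_zero_of_moments (g := fun x : ℝ => f x * airyAi (0 + ω * x)) ?_
    (hm.mul (continuous_airyAi_line 0 ω).aestronglyMeasurable) fun k => by
      have := (hpow k).2.2 0
      simpa only [mul_assoc] using this
  · filter_upwards [hz, ae_restrict_mem measurableSet_Ioi] with x hx hx0
    exact (mul_eq_zero.1 hx).resolve_right (airyAi_ray_ne_zero hω harg hx0)
  · intro N
    obtain ⟨C, hC, hb⟩ := exists_airyAi_line_bound hω harg 0 (N := |N| + M) (by positivity)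
    refine (hf.mul_const C).mono' (by
      refine AEStronglyMeasurable.mul (by fun_prop) (AEStronglyMeasurable.norm ?_)
      exact hm.mul (continuous_airyAi_line 0 ω).aestronglyMeasurable) ?_
    filter_upwards [ae_restrict_mem measurableSet_Ioi] with x hx
    have hx : 0 < x := hx
    rw [Real.norm_of_nonneg (by positivity), norm_mul]
    calc Real.exp (N * x) * (‖f x‖ * ‖airyAi (0 + ω * x)‖)
        ≤ Real.exp (|N| * x) * (‖f x‖ * (C * Real.exp (-((|N| + M) * x)))) := by
          gcongr
          · exact le_abs_self N
          · exact (hb x hx.le).1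
      _ = ‖f x‖ * (Real.exp (|N| * x) * Real.exp (-((|N| + M) * x))) * C := by ring
      _ = _ := by
          rw [← Real.exp_add]
          congr 3
          ring

end Airy

end Transform

/-! ### Exponents of the Airy function along lines -/

/-- The normalized exponent in the estimate of `|Ai(z + ω x)| / |Ai(z)|` for `arg z = θ`,
`arg ω = φ`, where `α` is the free parameter of the upper bound. -/
noncomputable def airyPhase (θ φ α y : ℝ) : ℝ :=
  α ^ 3 / 3 - α * (Real.cos θ + y * Real.cos φ) + (Real.sin θ + y * Real.sin φ) ^ 2 / (4 * α) +
    2 / 3 * Real.cos (3 * θ / 2)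

theorem cos_three_mul_div_two (θ : ℝ) :
    Real.cos (3 * θ / 2) = 4 * Real.cos (θ / 2) ^ 3 - 3 * Real.cos (θ / 2) := by
  rw [← Real.cos_three_mul]
  congr 1
  ring

/-- This parameter makes the phase 0 at y = 0, with slope -cos(θ/2 + φ): it settles small y. -/
theorem airyPhase_cos_half {θ : ℝ} (φ y : ℝ) (hθ : 0 < Real.cos (θ / 2)) :
    airyPhase θ φ (Real.cos (θ / 2)) y =
      -(y * Real.cos (θ / 2 + φ)) + y ^ 2 * Real.sin φ ^ 2 / (4 * Real.cos (θ / 2)) := by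
  have h1 : Real.cos θ = 2 * Real.cos (θ / 2) ^ 2 - 1 := by
    rw [← Real.cos_two_mul]
    congr 1
    ring
  have h2 : Real.sin θ = 2 * Real.sin (θ / 2) * Real.cos (θ / 2) := by
    rw [← Real.sin_two_mul]
    congr 1
    ring
  have h3 := Real.sin_sq_add_cos_sq (θ / 2)
  rw [airyPhase, cos_three_mul_div_two, h1, h2, Real.cos_add]
  field_simp
  linear_combination 12 * Real.cos (θ / 2) ^ 2 * h3

/-- The optimal choice of the parameter is the real part of the square root. -/
theorem airyPhase_re_of_sq_eq {θ φ y : ℝ} {q : ℂ} (hre : (q ^ 2).re = Real.cos θ + y * Real.cos φ)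
    (him : (q ^ 2).im = Real.sin θ + y * Real.sin φ) :
    airyPhase θ φ q.re y = -(2 / 3 * (q ^ 3).re) + 2 / 3 * Real.cos (3 * θ / 2) := by
  rw [airyPhase, ← hre, ← him]
  simp only [pow_succ, pow_zero, one_mul, Complex.mul_re, Complex.mul_im]
  field_simp
  ring

/-- For large y the phase is governed by -(2/3)cos(3φ/2)y^{3/2}, negative because φ < π/3; the
threshold makes δ√y ≥ 6, enough to absorb the lower terms. -/
theorem airyPhase_exists_of_large {φ : ℝ} (hφ0 : 0 ≤ φ) (hφ : φ < Real.pi / 3) (θ : ℝ) :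
    ∃ Y : ℝ, 0 < Y ∧ ∀ y, Y ≤ y → ∃ α, 1 / 2 ≤ α ∧ airyPhase θ φ α y ≤ -y := by
  set κ := Real.cos (φ / 2) with hκ
  have hκ2 : √3 / 2 < κ := by
    rw [← Real.cos_pi_div_six, hκ]
    exact Real.cos_lt_cos_of_nonneg_of_le_pi_div_two (by positivity) (by linarith) (by linarith)
  have h33 : √(3 : ℝ) ^ 2 = 3 := Real.sq_sqrt (by norm_num)
  have h32 : 0 < √(3 : ℝ) := by positivity
  have hκ1 : κ ≤ 1 := Real.cos_le_one _
  have hκ3 : 3 < 4 * κ ^ 2 := by nlinarith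
  have hκh : 3 / 4 ≤ κ := by nlinarith
  have hcos : Real.cos φ = 2 * κ ^ 2 - 1 := by
    rw [hκ, ← Real.cos_two_mul]
    congr 1
    ring
  have hsin : Real.sin φ ^ 2 = 4 * κ ^ 2 * (1 - κ ^ 2) := by
    rw [Real.sin_sq, hcos]
    ring
  set δ := 2 / 3 * κ * (4 * κ ^ 2 - 3) with hδ
  have hδ0 : 0 < δ := mul_pos (by linarith) (by linarith)
  refine ⟨max 1 ((6 / δ) ^ 2), by positivity, fun y hy => ?_⟩
  have hy1 : 1 ≤ y := (le_max_left _ _).trans hy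
  set T := √y with hT
  have hT2 : T ^ 2 = y := Real.sq_sqrt (by linarith)
  have hT1 : 1 ≤ T := Real.one_le_sqrt.2 hy1
  have hTδ : 6 / δ ≤ T := Real.le_sqrt_of_sq_le ((le_max_right _ _).trans hy)
  rw [div_le_iff₀ hδ0] at hTδ
  refine ⟨κ * T, by nlinarith, ?_⟩
  have h1 := airy_exponent_le (R := 1) (u := Real.cos θ + y * Real.cos φ)
    (v := Real.sin θ + y * Real.sin φ) hκh hκ1 hsin hT1 zero_le_one
    (by rw [hT2, hcos]; linarith [Real.neg_one_le_cos θ]) (by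
      rw [hT2]
      have h2 : Real.sin θ * Real.sin φ ≤ 1 := by
        have := abs_le.1 (abs_mul (Real.sin θ) (Real.sin φ) ▸
          mul_le_one₀ (Real.abs_sin_le_one θ) (abs_nonneg _) (Real.abs_sin_le_one φ))
        exact this.2
      have h3 := Real.sin_sq_le_one θ
      nlinarith)
  rw [airyPhase]
  rw [← hδ] at h1
  have h4 := Real.cos_le_one (3 * θ / 2)
  have h5 : 6 * T ^ 2 ≤ T * δ * T ^ 2 := by gcongr
  nlinarith

/-- A pointwise negative exponent is uniformly negative. -/
theorem airyPhase_uniform {θ φ : ℝ} (hφ0 : 0 ≤ φ) (hφ : φ < Real.pi / 3)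
    (hθ : 0 < Real.cos (θ / 2)) (hθφ : 0 < Real.cos (θ / 2 + φ))
    (hneg : ∀ y, 0 < y → ∃ α, 0 < α ∧ airyPhase θ φ α y < 0) :
    ∃ c m : ℝ, 0 < c ∧ 0 < m ∧ ∀ y, 0 ≤ y → ∃ α, m ≤ α ∧ airyPhase θ φ α y ≤ -(c * y) := by
  obtain ⟨Y, hY, hlarge⟩ := airyPhase_exists_of_large hφ0 hφ θ
  have hcompact : ∃ c m : ℝ, 0 < c ∧ 0 < m ∧ ∀ y ∈ Icc 0 Y, 0 ≤ y →
      ∃ α, m ≤ α ∧ airyPhase θ φ α y ≤ -(c * y) := by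
    -- Local bounds suffice: finite unions take minima of the constants. Near 0 the linear term
    -- decides; near y₀ > 0 a single α works by continuity.
    refine (isCompact_Icc (a := 0) (b := Y)).induction_on
      (p := fun S => ∃ c m : ℝ, 0 < c ∧ 0 < m ∧ ∀ y ∈ S, 0 ≤ y →
        ∃ α, m ≤ α ∧ airyPhase θ φ α y ≤ -(c * y)) ⟨1, 1, by simp⟩ ?_ ?_ ?_
    · rintro S T hST ⟨c, m, hc, hm, h⟩
      exact ⟨c, m, hc, hm, fun y hy => h y (hST hy)⟩
    · rintro S T ⟨c, m, hc, hm, h⟩ ⟨c', m', hc', hm', h'⟩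
      refine ⟨min c c', min m m', lt_min hc hc', lt_min hm hm', fun y hy hy0 => ?_⟩
      rcases hy with hy | hy
      · obtain ⟨α, hα, he⟩ := h y hy hy0
        refine ⟨α, (min_le_left _ _).trans hα, he.trans ?_⟩
        have : min c c' * y ≤ c * y := by gcongr; exact min_le_left _ _
        linarith
      · obtain ⟨α, hα, he⟩ := h' y hy hy0
        refine ⟨α, (min_le_right _ _).trans hα, he.trans ?_⟩
        have : min c c' * y ≤ c' * y := by gcongr; exact min_le_right _ _
        linarith
    · intro y₀ hy₀
      rcases hy₀.1.eq_or_lt with h0 | h0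
      · subst h0
        set b := Real.sin φ ^ 2 / (4 * Real.cos (θ / 2)) with hb
        have hb0 : 0 ≤ b := by positivity
        refine ⟨Iio (Real.cos (θ / 2 + φ) / (2 * (b + 1))),
          mem_nhdsWithin_of_mem_nhds (Iio_mem_nhds (by positivity)),
          Real.cos (θ / 2 + φ) / 2, Real.cos (θ / 2), by positivity, hθ, fun y hy hy0 => ?_⟩
        refine ⟨Real.cos (θ / 2), le_rfl, ?_⟩
        rw [airyPhase_cos_half φ y hθ]
        have hy' : y * (2 * (b + 1)) < Real.cos (θ / 2 + φ) := (lt_div_iff₀ (by positivity)).1 hy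
        have e : y ^ 2 * Real.sin φ ^ 2 / (4 * Real.cos (θ / 2)) = y * (y * b) := by
          rw [hb]
          ring
        rw [e]
        have h1 : y * b ≤ Real.cos (θ / 2 + φ) / 2 := by nlinarith
        nlinarith [mul_le_mul_of_nonneg_left h1 hy0]
      · obtain ⟨α, hα, he⟩ := hneg y₀ h0
        have hcont : Continuous fun y => airyPhase θ φ α y := by
          unfold airyPhase
          fun_prop
        refine ⟨{y | airyPhase θ φ α y < airyPhase θ φ α y₀ / 2} ∩ Iio (2 * y₀),
          mem_nhdsWithin_of_mem_nhds (Filter.inter_mem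
            (hcont.continuousAt.eventually_lt continuousAt_const (by linarith))
            (Iio_mem_nhds (by linarith))),
          -airyPhase θ φ α y₀ / (4 * y₀), α, div_pos (by linarith) (by linarith), hα,
          fun y hy hy0 => ⟨α, le_rfl, ?_⟩⟩
        have h1 : airyPhase θ φ α y < airyPhase θ φ α y₀ / 2 := hy.1
        have h2 : y < 2 * y₀ := hy.2
        have h3 : -airyPhase θ φ α y₀ / (4 * y₀) * y ≤ -airyPhase θ φ α y₀ / (4 * y₀) * (2 * y₀) :=
          mul_le_mul_of_nonneg_left h2.le (div_nonneg (by linarith) (by linarith))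
        have h4 : -airyPhase θ φ α y₀ / (4 * y₀) * (2 * y₀) = -airyPhase θ φ α y₀ / 2 := by
          field_simp
          ring
        linarith
  obtain ⟨c, m, hc, hm, h⟩ := hcompact
  refine ⟨min c 1, min m (1 / 2), lt_min hc one_pos, lt_min hm (by norm_num), fun y hy => ?_⟩
  rcases le_total y Y with hyY | hyY
  · obtain ⟨α, hα, he⟩ := h y ⟨hy, hyY⟩ hy
    refine ⟨α, (min_le_left _ _).trans hα, he.trans ?_⟩
    have : min c 1 * y ≤ c * y := by gcongr; exact min_le_left _ _
    linarith
  · obtain ⟨α, hα, he⟩ := hlarge y hyY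
    refine ⟨α, (min_le_right _ _).trans hα, he.trans ?_⟩
    have : min c 1 * y ≤ 1 * y := by gcongr; exact min_le_right _ _
    linarith

/-! ### Rays below the critical direction -/

theorem sq_mul_le_cube_mean {x z : ℝ} (hx : 0 ≤ x) (hz : 0 ≤ z) :
    x ^ 2 * z ≤ ((2 * x + z) / 3) ^ 3 := by
  nlinarith [mul_nonneg (sq_nonneg (x - z)) (by positivity : 0 ≤ 8 * x + z)]

/-- Logarithmic concavity of `sin`. -/
theorem sin_sq_mul_sin_le {a b : ℝ} (ha : a ∈ Icc 0 Real.pi) (hb : b ∈ Icc 0 Real.pi) :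
    Real.sin a ^ 2 * Real.sin b ≤ Real.sin ((2 * a + b) / 3) ^ 3 := by
  have hsa := Real.sin_nonneg_of_mem_Icc ha
  have hsb := Real.sin_nonneg_of_mem_Icc hb
  refine (sq_mul_le_cube_mean hsa hsb).trans (pow_le_pow_left₀ (by positivity) ?_ 3)
  have h := strictConcaveOn_sin_Icc.concaveOn.2 ha hb (by norm_num : (0 : ℝ) ≤ 2 / 3)
    (by norm_num : (0 : ℝ) ≤ 1 / 3) (by norm_num)
  simp only [smul_eq_mul] at h
  calc (2 * Real.sin a + Real.sin b) / 3 = 2 / 3 * Real.sin a + 1 / 3 * Real.sin b := by ring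
    _ ≤ _ := h
    _ = _ := by congr 1; ring

/-- Let w = exp(iθ) + y exp(iφ). While Im w ≤ 0, α = cos(θ/2) suffices, because the quadratic term
is at most half of a linear one. Once Im w > 0, take α = Re √w; as cos(3θ/2) = -1/2, the claim
becomes Re w^{3/2} > -1/2. -/
theorem airyPhase_neg_of_lower {φ : ℝ} (hφ0 : 0 ≤ φ) (hφ : φ < 5 * Real.pi / 18) {y : ℝ}
    (hy : 0 < y) : ∃ α, 0 < α ∧ airyPhase (-(8 * Real.pi / 9)) φ α y < 0 := by
  have hpi := Real.pi_pos
  set θ := -(8 * Real.pi / 9) with hθ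
  have hα0 : Real.cos (θ / 2) = Real.sin (Real.pi / 18) := by
    rw [← Real.cos_pi_div_two_sub, ← Real.cos_neg]
    congr 1
    rw [hθ]
    ring
  have hs18 : 0 < Real.sin (Real.pi / 18) :=
    Real.sin_pos_of_pos_of_lt_pi (by positivity) (by linarith)
  by_cases him : Real.sin θ + y * Real.sin φ ≤ 0
  · refine ⟨Real.cos (θ / 2), by rw [hα0]; exact hs18, ?_⟩
    rw [airyPhase_cos_half φ y (by rw [hα0]; exact hs18), hα0]
    have h1 : Real.cos (θ / 2 + φ) = Real.sin (Real.pi / 18) * Real.cos φ +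
        Real.cos (Real.pi / 18) * Real.sin φ := by
      rw [← Real.sin_add, ← Real.cos_pi_div_two_sub, ← Real.cos_neg]
      congr 1
      rw [hθ]
      ring
    have h2 : Real.sin θ = -(2 * Real.sin (Real.pi / 18) * Real.cos (Real.pi / 18)) := by
      rw [← Real.sin_two_mul, hθ, Real.sin_neg, ← Real.sin_pi_sub]
      congr 2
      ring
    have hc18 : 0 < Real.cos (Real.pi / 18) := Real.cos_pos_of_mem_Ioo ⟨by linarith, by linarith⟩
    have hcφ : 0 < Real.cos φ := Real.cos_pos_of_mem_Ioo ⟨by linarith, by linarith⟩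
    have hsφ : 0 ≤ Real.sin φ := Real.sin_nonneg_of_nonneg_of_le_pi hφ0 (by linarith)
    rw [h2] at him
    rw [h1]
    set s := Real.sin (Real.pi / 18)
    set c := Real.cos (Real.pi / 18)
    have h3 : y ^ 2 * Real.sin φ ^ 2 / (4 * s) ≤ y * Real.sin φ * c / 2 := by
      rw [div_le_iff₀ (by positivity)]
      have h4 : (y * Real.sin φ) * (y * Real.sin φ) ≤ (y * Real.sin φ) * (2 * s * c) :=
        mul_le_mul_of_nonneg_left (by linarith) (by positivity)
      nlinarith
    have h5 : 0 < y * (s * Real.cos φ) := by positivity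
    have h6 : 0 ≤ y * Real.sin φ * c := by positivity
    nlinarith
  · push Not at him
    set w : ℂ := ⟨Real.cos θ + y * Real.cos φ, Real.sin θ + y * Real.sin φ⟩ with hw
    have hwim : 0 < w.im := him
    set ρ := ‖w‖ with hρ
    set ψ := w.arg with hψ
    have hw0 : w ≠ 0 := fun h => by rw [h] at hwim; simp at hwim
    have hρ0 : 0 < ρ := norm_pos_iff.2 hw0
    have hψ0 : 0 < ψ := by
      rcases (Complex.arg_nonneg_iff.2 hwim.le).eq_or_lt with h | h
      · have := Complex.arg_eq_zero_iff.1 h.symm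
        linarith [this.2]
      · exact h
    have hψπ : ψ < Real.pi := (Complex.arg_lt_pi_iff).2 (Or.inr hwim.ne')
    have hre : ρ * Real.cos ψ = Real.cos θ + y * Real.cos φ := Complex.norm_mul_cos_arg w
    have himw : ρ * Real.sin ψ = Real.sin θ + y * Real.sin φ := Complex.norm_mul_sin_arg w
    set q : ℂ := √ρ * Complex.exp ((ψ / 2 : ℝ) * Complex.I) with hq
    have hqn : ∀ n : ℕ, q ^ n = ((√ρ ^ n : ℝ) : ℂ) * Complex.exp ((n * (ψ / 2) : ℝ) * Complex.I) := by
      intro n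
      rw [hq, mul_pow, ← Complex.exp_nat_mul]
      push_cast
      congr 2
      ring
    have hsq : √ρ ^ 2 = ρ := Real.sq_sqrt hρ0.le
    have hsρ : 0 < √ρ := Real.sqrt_pos.2 hρ0
    have hqre : q.re = √ρ * Real.cos (ψ / 2) := by
      rw [hq, Complex.re_ofReal_mul, Complex.exp_ofReal_mul_I_re]
    have hqpos : 0 < q.re := by
      rw [hqre]
      exact mul_pos hsρ (Real.cos_pos_of_mem_Ioo ⟨by linarith, by linarith⟩)
    refine ⟨q.re, hqpos, ?_⟩
    have h2ψ : ((2 : ℕ) : ℝ) * (ψ / 2) = ψ := by push_cast; ring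
    rw [airyPhase_re_of_sq_eq
      (by rw [hqn, h2ψ, Complex.re_ofReal_mul, Complex.exp_ofReal_mul_I_re, hsq, hre])
      (by rw [hqn, h2ψ, Complex.im_ofReal_mul, Complex.exp_ofReal_mul_I_im, hsq, himw]),
      hqn, Complex.re_ofReal_mul, Complex.exp_ofReal_mul_I_re]
    have hcθ : Real.cos (3 * θ / 2) = -(1 / 2) := by
      rw [← Real.cos_pi_div_three, ← Real.cos_pi_sub, ← Real.cos_neg, ← Real.cos_sub_two_pi,
        ← Real.cos_neg]
      congr 1
      rw [hθ]
      ring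
    rw [hcθ]
    have h3ψ : ((3 : ℕ) : ℝ) * (ψ / 2) = 3 * ψ / 2 := by push_cast; ring
    rw [h3ψ]
    have hmain : -(1 / 2) < √ρ ^ 3 * Real.cos (3 * ψ / 2) := by
      by_cases hc : 0 ≤ Real.cos (3 * ψ / 2)
      · have : 0 ≤ √ρ ^ 3 * Real.cos (3 * ψ / 2) := by positivity
        linarith
      · push Not at hc
        have hψ3 : Real.pi / 3 < ψ := by
          by_contra! hle
          exact absurd (Real.cos_nonneg_of_mem_Icc (x := 3 * ψ / 2)
            ⟨by linarith, by linarith⟩) (not_le.2 hc)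
        have hsinψφ : 0 < Real.sin (ψ - φ) :=
          Real.sin_pos_of_pos_of_lt_pi (by linarith) (by linarith)
        -- Both sides are the distance from the origin to the line traced by w as y varies; it is
        -- below 1/2 because φ - π/9 < π/6.
        have hd : ρ * Real.sin (ψ - φ) = Real.sin (φ - Real.pi / 9) := by
          have e1 : ρ * Real.sin (ψ - φ) = Real.sin (θ - φ) := by
            rw [Real.sin_sub, Real.sin_sub]
            linear_combination Real.cos φ * himw - Real.sin φ * hre
          have e2 : φ - Real.pi / 9 = Real.pi - (θ - φ) - 2 * Real.pi := by
            rw [hθ]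
            ring
          rw [e1, e2, Real.sin_sub_two_pi, Real.sin_pi_sub]
        have hd0 : 0 < Real.sin (φ - Real.pi / 9) := by rw [← hd]; positivity
        have hφ9 : Real.pi / 9 < φ := by
          by_contra! hle
          have := Real.sin_nonpos_of_nonpos_of_neg_pi_le (x := φ - Real.pi / 9) (by linarith)
            (by linarith)
          linarith
        have hd1 : Real.sin (φ - Real.pi / 9) < 1 / 2 := by
          rw [← Real.sin_pi_div_six]
          exact Real.sin_lt_sin_of_lt_of_le_pi_div_two (by linarith) (by linarith) (by linarith)
        have hs3 : 1 / 2 < Real.sin (3 * φ) := by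
          rw [← Real.cos_pi_div_three, ← Real.cos_pi_div_two_sub, ← Real.cos_abs (Real.pi / 2 - _)]
          refine Real.cos_lt_cos_of_nonneg_of_le_pi_div_two (abs_nonneg _) (by linarith) ?_
          rw [abs_lt]
          constructor <;> linarith
        set χ := (Real.pi - ψ) / 2 with hχ
        have hcs : Real.cos (3 * ψ / 2) = -Real.sin (3 * χ) := by
          rw [← Real.cos_pi_div_two_sub, ← Real.cos_pi_sub, ← Real.cos_neg,
            ← Real.cos_add_two_pi, hχ]
          congr 1
          ring
        have hsψ : Real.sin (ψ - φ) = Real.sin ((2 * (3 * χ) + 3 * φ) / 3) := by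
          rw [← Real.sin_pi_sub, hχ]
          congr 1
          ring
        -- Log-concavity bounds sin²(3χ)sin(3φ) by sin³(ψ - φ). With sin(3φ) > 1/2 and distance
        -- below 1/2 this gives ρ³sin²(3χ) < 1/4, the square of the bound sought.
        have hlog := sin_sq_mul_sin_le (a := 3 * χ) (b := 3 * φ)
          ⟨by rw [hχ]; linarith, by rw [hχ]; linarith⟩ ⟨by linarith, by linarith⟩
        rw [← hsψ] at hlog
        have hcube : (ρ * Real.sin (ψ - φ)) ^ 3 < (1 / 2) ^ 3 := by
          rw [hd]
          exact pow_lt_pow_left₀ hd1 hd0.le (by norm_num)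
        have hkey : ρ ^ 3 * Real.sin (3 * χ) ^ 2 < 1 / 4 := by
          have e1 : ρ ^ 3 * Real.sin (3 * χ) ^ 2 * (1 / 2) ≤
              ρ ^ 3 * Real.sin (3 * χ) ^ 2 * Real.sin (3 * φ) := by gcongr
          have e2 : ρ ^ 3 * (Real.sin (3 * χ) ^ 2 * Real.sin (3 * φ)) ≤
              ρ ^ 3 * Real.sin (ψ - φ) ^ 3 := by gcongr
          rw [mul_pow] at hcube
          nlinarith
        rw [hcs]
        have h6 : (√ρ ^ 3 * Real.sin (3 * χ)) ^ 2 < (1 / 2) ^ 2 := by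
          rw [mul_pow, ← pow_mul, mul_comm 3 2, pow_mul, hsq]
          linarith
        have := abs_lt_of_sq_lt_sq h6 (by norm_num)
        linarith [(abs_lt.1 this).2]
    linarith

/-! ### The remaining rays -/

/-- The linear form equals ‖w‖ sin(β - arg w), so its sign locates w relative to the ray of angle β.
-/
theorem arg_lt_of_sin_mul_re_sub_pos {w : ℂ} {β : ℝ} (hβ0 : 0 ≤ β) (hβ : β ≤ Real.pi)
    (h : 0 < Real.sin β * w.re - Real.cos β * w.im) : w ∈ Complex.slitPlane ∧ w.arg < β := by
  have hs := Real.sin_nonneg_of_nonneg_of_le_pi hβ0 hβ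
  refine ⟨?_, ?_⟩
  · by_cases him : w.im = 0
    · rw [him, mul_zero, sub_zero] at h
      exact Or.inl (pos_of_mul_pos_right h hs)
    · exact Or.inr him
  · by_contra! hle
    have h1 : Real.sin β * w.re - Real.cos β * w.im = ‖w‖ * Real.sin (β - w.arg) := by
      rw [← Complex.norm_mul_cos_arg w, ← Complex.norm_mul_sin_arg w, Real.sin_sub]
      ring
    have h2 := Real.sin_nonpos_of_nonpos_of_neg_pi_le (x := β - w.arg) (by linarith)
      (by linarith [Complex.arg_le_pi w])
    rw [h1] at h
    linarith [mul_nonpos_of_nonneg_of_nonpos (norm_nonneg w) h2]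

theorem arg_exp_add_lt {θ φ t : ℝ} (hφ0 : 0 ≤ φ) (hφ : φ < 5 * Real.pi / 18)
    (hθ0 : -(Real.pi / 2) < θ) (hθ1 : θ < Real.pi) (hθ2 : θ < Real.pi - 2 * φ) (ht : 0 ≤ t) :
    Complex.exp (θ * Complex.I) + t * Complex.exp (φ * Complex.I) ∈ Complex.slitPlane ∧
      (Complex.exp (θ * Complex.I) + t * Complex.exp (φ * Complex.I)).arg < Real.pi - 2 * φ := by
  have hpi := Real.pi_pos
  set w := Complex.exp (θ * Complex.I) + t * Complex.exp (φ * Complex.I) with hw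
  have hre : w.re = Real.cos θ + t * Real.cos φ := by
    rw [hw, Complex.add_re, Complex.re_ofReal_mul, Complex.exp_ofReal_mul_I_re,
      Complex.exp_ofReal_mul_I_re]
  have him : w.im = Real.sin θ + t * Real.sin φ := by
    rw [hw, Complex.add_im, Complex.im_ofReal_mul, Complex.exp_ofReal_mul_I_im,
      Complex.exp_ofReal_mul_I_im]
  have hcφ : 0 < Real.cos φ := Real.cos_pos_of_mem_Ioo ⟨by linarith, by linarith⟩
  by_cases hcase : θ < Real.pi / 2 ∧ φ ≤ Real.pi / 4
  · have hcθ : 0 < Real.cos θ := Real.cos_pos_of_mem_Ioo ⟨hθ0, hcase.1⟩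
    have hw0 : 0 < w.re := by
      rw [hre]
      positivity
    refine ⟨Or.inl hw0, lt_of_lt_of_le ?_ (by linarith [hcase.2] : Real.pi / 2 ≤ _)⟩
    exact (abs_lt.1 (Complex.abs_arg_lt_pi_div_two_iff.2 (Or.inl hw0))).2
  · refine arg_lt_of_sin_mul_re_sub_pos (by linarith) (by linarith) ?_
    have e : Real.sin (Real.pi - 2 * φ) * w.re - Real.cos (Real.pi - 2 * φ) * w.im =
        Real.sin (Real.pi - 2 * φ - θ) + t * Real.sin (Real.pi - 2 * φ - φ) := by
      rw [hre, him, Real.sin_sub _ θ, Real.sin_sub _ φ]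
      ring
    have h1 : 0 < Real.sin (Real.pi - 2 * φ - θ) := by
      refine Real.sin_pos_of_pos_of_lt_pi (by linarith) ?_
      by_contra! hle
      exact hcase ⟨by linarith, by linarith⟩
    have h2 := Real.sin_nonneg_of_nonneg_of_le_pi (x := Real.pi - 2 * φ - φ) (by linarith)
      (by linarith)
    rw [e]
    positivity

/-- Along w(t) = exp(iθ) + t exp(iφ), the derivative of w^{3/2} is (3/2)√w·exp(iφ), of argument arg
w/2 + φ. This stays in (-π/2, π/2) because arg w < π - 2φ, so Re w^{3/2} strictly increases. -/
theorem airyPhase_neg_of_upper {θ φ : ℝ} (hφ0 : 0 ≤ φ) (hφ : φ < 5 * Real.pi / 18)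
    (hθ0 : -(Real.pi / 2) < θ) (hθ1 : θ < Real.pi) (hθ2 : θ < Real.pi - 2 * φ) {y : ℝ}
    (hy : 0 < y) : ∃ α, 0 < α ∧ airyPhase θ φ α y < 0 := by
  have hpi := Real.pi_pos
  set e := Complex.exp (φ * Complex.I) with he
  set w : ℝ → ℂ := fun t => Complex.exp (θ * Complex.I) + t * e with hw
  set q : ℝ → ℂ := fun t => Complex.exp (Complex.log (w t) / 2) with hq
  have hslit : ∀ t, 0 ≤ t → w t ∈ Complex.slitPlane := fun t ht =>
    (arg_exp_add_lt hφ0 hφ hθ0 hθ1 hθ2 ht).1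
  have harg : ∀ t, 0 ≤ t → (w t).arg < Real.pi - 2 * φ := fun t ht =>
    (arg_exp_add_lt hφ0 hφ hθ0 hθ1 hθ2 ht).2
  have hwd : ∀ t : ℝ, HasDerivAt w e t := fun t =>
    (((hasDerivAt_id t).ofReal_comp.mul_const e).const_add _).congr_deriv (by simp)
  have hq2 : ∀ t, 0 ≤ t → q t ^ 2 = w t := by
    intro t ht
    rw [hq, ← Complex.exp_nat_mul]
    push_cast
    rw [mul_div_cancel₀ _ two_ne_zero, Complex.exp_log (Complex.slitPlane_ne_zero (hslit t ht))]
  have hqd : ∀ t, 0 ≤ t → HasDerivAt (fun t => q t ^ 3) (3 / 2 * (q t * e)) t := by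
    intro t ht
    have h0 := Complex.slitPlane_ne_zero (hslit t ht)
    have h1 : HasDerivAt q (q t * (e / w t / 2)) t :=
      (((hwd t).clog_real (hslit t ht)).div_const 2).cexp
    refine (h1.pow 3).congr_deriv ?_
    simp only [Nat.add_one_sub_one, Nat.cast_ofNat]
    rw [hq2 t ht]
    field_simp
  have hpos : ∀ t, 0 ≤ t → 0 < (q t * e).re := by
    intro t ht
    have h1 : q t * e = Complex.exp (Complex.log (w t) / 2 + φ * Complex.I) :=
      (Complex.exp_add _ _).symm
    rw [h1, Complex.exp_re]
    refine mul_pos (Real.exp_pos _) (Real.cos_pos_of_mem_Ioo ?_)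
    have h2 : (Complex.log (w t) / 2 + φ * Complex.I).im = (w t).arg / 2 + φ := by
      simp [Complex.log_im]
    rw [h2]
    exact ⟨by linarith [Complex.neg_pi_lt_arg (w t)], by linarith [harg t ht]⟩
  have hmono : StrictMonoOn (fun t => (q t ^ 3).re) (Icc 0 y) := by
    have hd : ∀ t, 0 ≤ t → HasDerivAt (fun t => (q t ^ 3).re) (3 / 2 * (q t * e).re) t := by
      intro t ht
      refine ((Complex.reCLM.hasFDerivAt.comp_hasDerivAt t (hqd t ht))).congr_deriv ?_
      simp only [Complex.reCLM_apply]
      rw [show (3 / 2 : ℂ) = ((3 / 2 : ℝ) : ℂ) by push_cast; ring, Complex.re_ofReal_mul]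
    refine strictMonoOn_of_deriv_pos (convex_Icc 0 y)
      (fun t ht => (hd t ht.1).continuousAt.continuousWithinAt) fun t ht => ?_
    rw [interior_Icc] at ht
    rw [(hd t ht.1.le).deriv]
    linarith [hpos t ht.1.le]
  have h0 : (q 0 ^ 3).re = Real.cos (3 * θ / 2) := by
    have h1 : w 0 = Complex.exp (θ * Complex.I) := by simp [hw]
    rw [hq]
    simp only
    rw [h1, Complex.log_exp (by simp; linarith) (by simp; linarith), ← Complex.exp_nat_mul,
      ← Complex.exp_ofReal_mul_I_re]
    congr 2
    push_cast
    ring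
  have hqre : 0 < (q y).re := by
    rw [hq, Complex.exp_re]
    refine mul_pos (Real.exp_pos _) (Real.cos_pos_of_mem_Ioo ?_)
    have h2 : (Complex.log (w y) / 2).im = (w y).arg / 2 := by
      simp [Complex.log_im]
    rw [h2]
    exact ⟨by linarith [Complex.neg_pi_lt_arg (w y)], by linarith [harg y hy.le]⟩
  refine ⟨(q y).re, hqre, ?_⟩
  have h1 : (q 0 ^ 3).re < (q y ^ 3).re := hmono ⟨le_rfl, hy.le⟩ ⟨hy.le, le_rfl⟩ hy
  rw [airyPhase_re_of_sq_eq]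
  · rw [h0] at h1
    linarith
  · rw [hq2 y hy.le, hw, he, Complex.add_re, Complex.re_ofReal_mul, Complex.exp_ofReal_mul_I_re,
      Complex.exp_ofReal_mul_I_re]
  · rw [hq2 y hy.le, hw, he, Complex.add_im, Complex.im_ofReal_mul, Complex.exp_ofReal_mul_I_im,
      Complex.exp_ofReal_mul_I_im]

/-! ### Quotients of entire functions -/

/-- At a simple zero of g the quotient of the difference slopes is holomorphic and extends f/g by
f'/g'. -/
theorem exists_entire_quotient {f g : ℂ → ℂ} (hf : Differentiable ℂ f) (hg : Differentiable ℂ g)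
    (hg' : ∀ z, g z = 0 → deriv g z ≠ 0) (hfg : ∀ z, g z = 0 → f z = 0) :
    ∃ G : ℂ → ℂ, Differentiable ℂ G ∧ ∀ z, f z = G z * g z := by
  classical
  refine ⟨fun z => if g z = 0 then deriv f z / deriv g z else f z / g z, fun z₀ => ?_, fun z => ?_⟩
  · by_cases h0 : g z₀ = 0
    · have hdf : DifferentiableAt ℂ (dslope f z₀) z₀ :=
        ((Complex.differentiableOn_dslope Filter.univ_mem).2 hf.differentiableOn).differentiableAt
          Filter.univ_mem
      have hdg : DifferentiableAt ℂ (dslope g z₀) z₀ :=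
        ((Complex.differentiableOn_dslope Filter.univ_mem).2 hg.differentiableOn).differentiableAt
          Filter.univ_mem
      have hne : dslope g z₀ z₀ ≠ 0 := by
        rw [dslope_same]
        exact hg' z₀ h0
      refine (hdf.div hdg hne).congr_of_eventuallyEq ?_
      filter_upwards [hdg.continuousAt.eventually_ne hne] with z hz
      rcases eq_or_ne z z₀ with rfl | hzz
      · rw [if_pos h0, Pi.div_apply, dslope_same, dslope_same]
      · have hsub : z - z₀ ≠ 0 := sub_ne_zero.2 hzz
        rw [Pi.div_apply]
        rw [dslope_of_ne _ hzz, slope_def_field, h0, sub_zero] at hz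
        rw [dslope_of_ne _ hzz, dslope_of_ne _ hzz, slope_def_field, slope_def_field, hfg z₀ h0, h0,
          sub_zero, sub_zero, if_neg fun h => hz (by rw [h, zero_div]), div_div_div_cancel_right₀ hsub]
    · refine ((hf z₀).div (hg z₀) h0).congr_of_eventuallyEq ?_
      filter_upwards [(hg z₀).continuousAt.eventually_ne h0] with z hz
      rw [if_neg hz, Pi.div_apply]
  · simp only
    split_ifs with h
    · rw [h, mul_zero, hfg z h]
    · rw [div_mul_cancel₀ _ h]

/-! ### Decay of `Ai(z + ω x) / Ai(z)` along rays -/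

/-- Scaling by z = s² exp(iθ), a = sα, y = ‖ω‖x/s² turns the upper exponent minus the lower one into
s³ times the phase, at most -c‖ω‖sx; the factors 1/√s cancel. -/
theorem norm_airyAi_ray_ratio_le {θ φ : ℝ} (hφ0 : 0 ≤ φ) (hφ : φ < Real.pi / 3)
    (hθ : 0 < Real.cos (θ / 2)) (hθφ : 0 < Real.cos (θ / 2 + φ))
    (hneg : ∀ y, 0 < y → ∃ α, 0 < α ∧ airyPhase θ φ α y < 0) {ω : ℂ} (hω : ω ≠ 0)
    (harg : ω.arg = φ) :
    ∃ C c R : ℝ, 0 < C ∧ 0 < c ∧ 1 ≤ R ∧ ∀ s : ℝ, R ≤ s → ∀ x : ℝ, 0 ≤ x →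
      ‖airyAi (((s ^ 2 : ℝ) : ℂ) * Complex.exp (θ * Complex.I) + ω * x)‖ ≤
        C * Real.exp (-(c * s * x)) *
          ‖airyAi (((s ^ 2 : ℝ) : ℂ) * Complex.exp (θ * Complex.I))‖ := by
  obtain ⟨c, m, hc, hm, hph⟩ := airyPhase_uniform hφ0 hφ hθ hθφ hneg
  obtain ⟨R, hR, hlow⟩ := norm_airyAi_sq_ge hθ
  have hωn : 0 < ‖ω‖ := norm_pos_iff.2 hω
  refine ⟨4 * Real.pi / √m, c * ‖ω‖, R, by positivity, by positivity, hR, fun s hs x hx => ?_⟩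
  have hs0 : 0 < s := by linarith
  obtain ⟨α, hα, hle⟩ := hph (‖ω‖ * x / s ^ 2) (by positivity)
  have hα0 : 0 < α := hm.trans_le hα
  set z : ℂ := ((s ^ 2 : ℝ) : ℂ) * Complex.exp (θ * Complex.I) with hz
  have hlz : 1 / (4 * Real.pi) / √s * Real.exp (-(2 / 3 * (s ^ 3 * Real.cos (3 * θ / 2)))) ≤
      ‖airyAi z‖ := by
    set q : ℂ := s * Complex.exp ((θ / 2 : ℝ) * Complex.I) with hq
    have hqn : ‖q‖ = s := by
      rw [hq, norm_mul, Complex.norm_exp_ofReal_mul_I, mul_one, Complex.norm_real,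
        Real.norm_of_nonneg hs0.le]
    have hqre : q.re = s * Real.cos (θ / 2) := by
      rw [hq, Complex.re_ofReal_mul, Complex.exp_ofReal_mul_I_re]
    have hq2 : q ^ 2 = z := by
      rw [hq, hz, mul_pow, ← Complex.exp_nat_mul]
      push_cast
      congr 2
      ring
    have hq3 : (q ^ 3).re = s ^ 3 * Real.cos (3 * θ / 2) := by
      have : q ^ 3 = ((s ^ 3 : ℝ) : ℂ) * Complex.exp ((3 * θ / 2 : ℝ) * Complex.I) := by
        rw [hq, mul_pow, ← Complex.exp_nat_mul]
        push_cast
        congr 2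
        ring
      rw [this, Complex.re_ofReal_mul, Complex.exp_ofReal_mul_I_re]
    have := hlow q (by rw [hqn]; exact hs) (by rw [hqn, hqre, mul_comm])
    rwa [hq2, hq3, hqn] at this
  have hre : (z + ω * x).re = s ^ 2 * Real.cos θ + ‖ω‖ * x * Real.cos φ := by
    rw [hz, Complex.add_re, Complex.re_ofReal_mul, Complex.exp_ofReal_mul_I_re, Complex.re_mul_ofReal,
      ← Complex.norm_mul_cos_arg ω, harg]
    ring
  have him : (z + ω * x).im = s ^ 2 * Real.sin θ + ‖ω‖ * x * Real.sin φ := by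
    rw [hz, Complex.add_im, Complex.im_ofReal_mul, Complex.exp_ofReal_mul_I_im, Complex.im_mul_ofReal,
      ← Complex.norm_mul_sin_arg ω, harg]
    ring
  have hup := norm_airyAi_le (z + ω * x) (mul_pos hs0 hα0)
  rw [hre, him] at hup
  have hexp : (s * α) ^ 3 / 3 - s * α * (s ^ 2 * Real.cos θ + ‖ω‖ * x * Real.cos φ) +
      (s ^ 2 * Real.sin θ + ‖ω‖ * x * Real.sin φ) ^ 2 / (4 * (s * α)) =
      s ^ 3 * airyPhase θ φ α (‖ω‖ * x / s ^ 2) - 2 / 3 * (s ^ 3 * Real.cos (3 * θ / 2)) := by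
    rw [airyPhase]
    field_simp
    ring
  have hle2 : s ^ 3 * airyPhase θ φ α (‖ω‖ * x / s ^ 2) ≤ -(c * ‖ω‖ * s * x) := by
    calc s ^ 3 * airyPhase θ φ α (‖ω‖ * x / s ^ 2) ≤ s ^ 3 * -(c * (‖ω‖ * x / s ^ 2)) :=
          mul_le_mul_of_nonneg_left hle (by positivity)
      _ = _ := by field_simp
  rw [hexp] at hup
  calc ‖airyAi (z + ω * x)‖ ≤ 1 / √(s * m) * Real.exp (-(c * ‖ω‖ * s * x) -
        2 / 3 * (s ^ 3 * Real.cos (3 * θ / 2))) := by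
        refine hup.trans (mul_le_mul ?_ (Real.exp_le_exp.2 (by linarith)) (Real.exp_pos _).le
          (by positivity))
        exact one_div_le_one_div_of_le (by positivity) (Real.sqrt_le_sqrt (by gcongr))
    _ = 4 * Real.pi / √m * Real.exp (-(c * ‖ω‖ * s * x)) * (1 / (4 * Real.pi) / √s *
        Real.exp (-(2 / 3 * (s ^ 3 * Real.cos (3 * θ / 2))))) := by
        rw [Real.sqrt_mul hs0.le, sub_eq_add_neg, Real.exp_add]
        field_simp
    _ ≤ _ := mul_le_mul_of_nonneg_left hlz (by positivity)

theorem tendsto_airyTransform_div_ray {θ φ : ℝ} (hφ0 : 0 ≤ φ) (hφ : φ < Real.pi / 3)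
    (hθ : 0 < Real.cos (θ / 2)) (hθφ : 0 < Real.cos (θ / 2 + φ))
    (hneg : ∀ y, 0 < y → ∃ α, 0 < α ∧ airyPhase θ φ α y < 0) {ω : ℂ} (hω : ω ≠ 0)
    (harg : ω.arg = φ) {f : ℝ → ℂ} (hm : AEStronglyMeasurable f (volume.restrict (Ioi 0)))
    (hf : ∀ N, 0 < N → IntegrableOn (fun x => ‖f x‖ * Real.exp (-(N * x))) (Ioi 0)) :
    Filter.Tendsto (fun r : ℝ =>
      (∫ x in Ioi (0 : ℝ), f x * airyAi (r * Complex.exp (θ * Complex.I) + ω * x)) /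
        airyAi (r * Complex.exp (θ * Complex.I))) Filter.atTop (nhds 0) := by
  obtain ⟨C, c, R, hC, hc, hR, hle⟩ := norm_airyAi_ray_ratio_le hφ0 hφ hθ hθφ hneg hω harg
  have hlim : Filter.Tendsto (fun r : ℝ => ∫ x in Ioi (0 : ℝ),
      ‖f x‖ * (C * Real.exp (-(c * √r * x)))) Filter.atTop (nhds 0) := by
    suffices h : Filter.Tendsto (fun r : ℝ => ∫ x in Ioi (0 : ℝ),
        ‖f x‖ * (C * Real.exp (-(c * √r * x)))) Filter.atTop
        (nhds (∫ _ in Ioi (0 : ℝ), (0 : ℝ))) by simpa using h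
    refine tendsto_integral_filter_of_dominated_convergence
      (fun x => C * (‖f x‖ * Real.exp (-(c * x)))) ?_ ?_ ((hf c hc).const_mul C) ?_
    · exact Filter.Eventually.of_forall fun r => hm.norm.mul
        (by fun_prop : Continuous fun x : ℝ => C * Real.exp (-(c * √r * x))).aestronglyMeasurable
    · filter_upwards [Filter.eventually_ge_atTop 1] with r hr
      filter_upwards [ae_restrict_mem measurableSet_Ioi] with x hx
      have hx : 0 < x := hx
      rw [Real.norm_of_nonneg (by positivity)]
      have h1 : 1 ≤ √r := Real.one_le_sqrt.2 hr
      have h2 : Real.exp (-(c * √r * x)) ≤ Real.exp (-(c * x)) := by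
        rw [Real.exp_le_exp]
        nlinarith [mul_pos hc hx]
      calc ‖f x‖ * (C * Real.exp (-(c * √r * x))) ≤ ‖f x‖ * (C * Real.exp (-(c * x))) := by gcongr
        _ = _ := by ring
    · filter_upwards [ae_restrict_mem measurableSet_Ioi] with x hx
      have hx : 0 < x := hx
      have h1 : Filter.Tendsto (fun r : ℝ => c * √r * x) Filter.atTop Filter.atTop :=
        (Real.tendsto_sqrt_atTop.const_mul_atTop hc).atTop_mul_const hx
      have := ((Real.tendsto_exp_neg_atTop_nhds_zero.comp h1).const_mul C).const_mul ‖f x‖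
      simpa using this
  refine squeeze_zero_norm' ?_ hlim
  filter_upwards [Filter.eventually_ge_atTop (R ^ 2)] with r hr
  have hr0 : 0 ≤ r := (sq_nonneg R).trans hr
  have hs : R ≤ √r := Real.le_sqrt_of_sq_le hr
  have hle' := hle (√r) hs
  rw [Real.sq_sqrt hr0] at hle'
  set z : ℂ := r * Complex.exp (θ * Complex.I) with hz
  rw [norm_div]
  refine div_le_of_le_mul₀ (norm_nonneg _) (integral_nonneg fun x => by positivity) ?_
  have hint : IntegrableOn (fun x => ‖f x‖ * (C * Real.exp (-(c * √r * x)))) (Ioi 0) := by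
    have := (hf (c * √r) (mul_pos hc (by linarith))).const_mul C
    refine this.congr (Filter.Eventually.of_forall fun x => ?_)
    simp only
    ring
  rw [← integral_mul_const]
  refine norm_integral_le_of_norm_le (hint.mul_const _) ?_
  filter_upwards [ae_restrict_mem measurableSet_Ioi] with x hx
  have hx : 0 < x := hx
  rw [norm_mul, mul_assoc]
  exact mul_le_mul_of_nonneg_left (hle' x hx.le) (norm_nonneg _)

theorem norm_airyTransform_le {ω : ℂ} (hω : ω ≠ 0) (harg : |ω.arg| < Real.pi / 3) {f : ℝ → ℂ}
    (hf : IntegrableOn (fun x => ‖f x‖ * Real.exp (-(1 * x))) (Ioi 0)) :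
    ∃ C B : ℝ, 0 < C ∧ 0 < B ∧ ∀ z : ℂ, ‖∫ x in Ioi (0 : ℝ), f x * airyAi (z + ω * x)‖ ≤
      C * Real.exp (B * ((1 + ‖z‖) * √(1 + ‖z‖))) := by
  obtain ⟨C, B, hC, hB, hle⟩ := norm_airyAi_line_le hω harg 1 zero_le_one
  set J := ∫ x in Ioi (0 : ℝ), ‖f x‖ * Real.exp (-(1 * x)) with hJ
  have hJ0 : 0 ≤ J := integral_nonneg fun x => by positivity
  refine ⟨C * (J + 1), B, by positivity, hB, fun z => ?_⟩
  have h1 : ‖∫ x in Ioi (0 : ℝ), f x * airyAi (z + ω * x)‖ ≤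
      ∫ x in Ioi (0 : ℝ), C * Real.exp (B * ((1 + ‖z‖) * √(1 + ‖z‖))) *
        (‖f x‖ * Real.exp (-(1 * x))) := by
    refine norm_integral_le_of_norm_le (hf.const_mul _) ?_
    filter_upwards [ae_restrict_mem measurableSet_Ioi] with x hx
    have hx : 0 < x := hx
    rw [norm_mul]
    calc ‖f x‖ * ‖airyAi (z + ω * x)‖ ≤ ‖f x‖ * _ :=
          mul_le_mul_of_nonneg_left (hle z x hx.le) (norm_nonneg _)
      _ = _ := by ring
  rw [integral_const_mul, ← hJ] at h1
  refine h1.trans ?_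
  have : 0 ≤ C * Real.exp (B * ((1 + ‖z‖) * √(1 + ‖z‖))) := by positivity
  nlinarith

/-! ### Growth of quotients by the Airy function -/

theorem exists_sq_eq_re_nonneg (w : ℂ) : ∃ q : ℂ, q ^ 2 = w ∧ 0 ≤ q.re := by
  obtain ⟨q, hq⟩ := IsAlgClosed.exists_pow_nat_eq w zero_lt_two
  rcases le_total 0 q.re with h | h
  · exact ⟨q, hq, h⟩
  · exact ⟨-q, by rw [neg_sq, hq], by simpa using h⟩

/-- For q = √w with Re q ≥ 0, (Re q)² = (|w| + Re w)/2 ≥ |w|/8, so Re q ≥ |q|/3 and the saddle bound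
applies. The constant 18 exceeds 4π + 1 + 2/3. -/
theorem exists_exp_neg_le_norm_airyAi : ∃ R : ℝ, 1 ≤ R ∧ ∀ w : ℂ, R ≤ ‖w‖ →
    -(3 / 4 * ‖w‖) ≤ w.re → Real.exp (-(18 * ((1 + ‖w‖) * √(1 + ‖w‖)))) ≤ ‖airyAi w‖ := by
  obtain ⟨R, hR, hlow⟩ := norm_airyAi_sq_ge (k := 1 / 3) (by norm_num)
  refine ⟨R ^ 2, one_le_pow₀ hR, fun w hw hre => ?_⟩
  obtain ⟨q, rfl, hq0⟩ := exists_sq_eq_re_nonneg w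
  rw [norm_pow] at hw hre ⊢
  have hqR : R ≤ ‖q‖ := le_of_sq_le_sq hw (norm_nonneg q)
  have hq1 : 1 ≤ ‖q‖ := hR.trans hqR
  have hn : ‖q‖ ^ 2 = q.re ^ 2 + q.im ^ 2 := by
    rw [Complex.sq_norm, Complex.normSq_apply]
    ring
  have hk : 1 / 3 * ‖q‖ ≤ q.re := by
    have h1 : (q ^ 2).re = q.re ^ 2 - q.im ^ 2 := by
      rw [pow_two, Complex.mul_re]
      ring
    refine le_of_sq_le_sq ?_ hq0
    nlinarith
  refine le_trans ?_ (hlow q hqR hk)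
  set T := √(1 + ‖q‖ ^ 2) with hT
  have hT2 : T ^ 2 = 1 + ‖q‖ ^ 2 := Real.sq_sqrt (by positivity)
  have hTq : ‖q‖ ≤ T := Real.le_sqrt_of_sq_le (by linarith)
  have hT1 : 1 ≤ T := hq1.trans hTq
  have hS : (1 + ‖q‖ ^ 2) * T = T ^ 3 := by rw [← hT2]; ring
  rw [hS]
  have hq3 : ‖q‖ ^ 3 ≤ T ^ 3 := pow_le_pow_left₀ (norm_nonneg q) hTq 3
  have hq3' : ‖q‖ ≤ T ^ 3 := hTq.trans (le_self_pow₀ hT1 (by norm_num))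
  have hT3 : 1 ≤ T ^ 3 := one_le_pow₀ hT1
  have hre3 : (q ^ 3).re ≤ ‖q‖ ^ 3 := by
    rw [← norm_pow]
    exact Complex.re_le_norm _
  have h4 : Real.exp (-(4 * Real.pi)) ≤ 1 / (4 * Real.pi) := by
    rw [Real.exp_neg, ← one_div]
    exact one_div_le_one_div_of_le (by positivity) (by linarith [Real.add_one_le_exp (4 * Real.pi)])
  have h5 : Real.exp (-‖q‖) ≤ 1 / √‖q‖ := by
    rw [Real.exp_neg, ← one_div]
    refine one_div_le_one_div_of_le (Real.sqrt_pos.2 (by linarith)) ?_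
    have : √‖q‖ ≤ ‖q‖ := Real.sqrt_le_iff.2 ⟨by linarith, by nlinarith⟩
    linarith [Real.add_one_le_exp ‖q‖]
  calc Real.exp (-(18 * T ^ 3)) ≤ Real.exp (-(4 * Real.pi) + -‖q‖ + -(2 / 3 * (q ^ 3).re)) := by
        rw [Real.exp_le_exp]
        linarith [Real.pi_lt_four]
    _ = Real.exp (-(4 * Real.pi)) * Real.exp (-‖q‖) * Real.exp (-(2 / 3 * (q ^ 3).re)) := by
        rw [Real.exp_add, Real.exp_add]
    _ ≤ 1 / (4 * Real.pi) * (1 / √‖q‖) * Real.exp (-(2 / 3 * (q ^ 3).re)) := by gcongr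
    _ = _ := by ring

/-- On the left side of the square, |Ai| is at least its value at the critical point -x, where
x|Ai|² ≥ k. Elsewhere on the boundary Re w ≥ -(3/4)|w|, since otherwise |Re w| ≤ |Im w| would give a
contradiction. -/
theorem exists_exp_neg_le_norm_airyAi_square : ∃ B R : ℝ, 0 < B ∧ 1 ≤ R ∧ ∀ x : ℝ, R ≤ x →
    airyNegDeriv x = 0 → ∀ w : ℂ, |w.re| ≤ x → |w.im| ≤ x → (|w.re| = x ∨ |w.im| = x) →
      Real.exp (-(B * ((1 + ‖w‖) * √(1 + ‖w‖)))) ≤ ‖airyAi w‖ := by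
  obtain ⟨R, hR, hlow⟩ := exists_exp_neg_le_norm_airyAi
  obtain ⟨k, hk, hcrit⟩ := exists_le_norm_airyAi_of_critical
  refine ⟨max 18 (1 + 1 / k), R, by positivity, hR, fun x hx hx0 w hre him hw => ?_⟩
  have hxw : x ≤ ‖w‖ := by
    rcases hw with h | h
    · exact h ▸ Complex.abs_re_le_norm w
    · exact h ▸ Complex.abs_im_le_norm w
  have hx1 : 1 ≤ x := hR.trans hx
  set S := (1 + ‖w‖) * √(1 + ‖w‖) with hS
  have hSw : 1 + ‖w‖ ≤ S :=
    le_mul_of_one_le_right (by positivity) (Real.one_le_sqrt.2 (by linarith [norm_nonneg w]))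
  by_cases hl : w.re = -x
  · have hw' : w = -(x : ℂ) + Complex.I * w.im := by
      apply Complex.ext <;> simp [hl]
    have h1 : ‖airyAi (-(x : ℂ))‖ ≤ ‖airyAi w‖ := by
      have := norm_airyAi_le_vertical (by linarith : 0 ≤ x) w.im
      rwa [← hw'] at this
    have h2 := hcrit x hx1 hx0
    have h3 : Real.exp (-((1 + 1 / k) * S)) ≤ ‖airyAi (-(x : ℂ))‖ := by
      refine le_of_sq_le_sq ?_ (norm_nonneg _)
      rw [← Real.exp_nat_mul]
      have h4 : x * Real.exp ((2 : ℕ) * -((1 + 1 / k) * S)) ≤ k := by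
        have h5 : x ≤ Real.exp S := by linarith [Real.add_one_le_exp S]
        have h6 : Real.exp (-(1 / k)) ≤ k := by
          have := Real.add_one_le_exp (1 / k)
          rw [Real.exp_neg]
          exact inv_le_of_inv_le₀ hk (by rw [← one_div]; linarith)
        calc x * Real.exp ((2 : ℕ) * -((1 + 1 / k) * S)) ≤
              Real.exp S * Real.exp ((2 : ℕ) * -((1 + 1 / k) * S)) := by gcongr
          _ = Real.exp (-(S + 2 * (1 / k * S))) := by
              rw [← Real.exp_add]
              congr 1
              push_cast
              ring
          _ ≤ Real.exp (-(1 / k)) := by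
              rw [Real.exp_le_exp]
              have : 1 / k * 1 ≤ 1 / k * S :=
                mul_le_mul_of_nonneg_left (by linarith) (by positivity)
              have : 0 < 1 / k := by positivity
              linarith
          _ ≤ k := h6
      exact le_of_mul_le_mul_left (h4.trans h2) (by linarith)
    refine le_trans ?_ (h3.trans h1)
    rw [Real.exp_le_exp, neg_le_neg_iff]
    exact mul_le_mul_of_nonneg_right (le_max_right _ _) (by linarith)
  · have h1 : -(3 / 4 * ‖w‖) ≤ w.re := by
      by_contra! hlt
      have h2 : |w.re| ≤ |w.im| := by
        rcases hw with h | h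
        · rcases abs_eq (by linarith : 0 ≤ x) |>.1 h with h' | h'
          · linarith [norm_nonneg w]
          · exact absurd h' hl
        · rw [h]
          exact hre
      have h3 : ‖w‖ ^ 2 = w.re ^ 2 + w.im ^ 2 := by
        rw [Complex.sq_norm, Complex.normSq_apply]
        ring
      have h4 := sq_le_sq.2 h2
      nlinarith [norm_nonneg w]
    refine le_trans ?_ (hlow w (hx.trans hxw) h1)
    rw [Real.exp_le_exp, neg_le_neg_iff]
    exact mul_le_mul_of_nonneg_right (le_max_left _ _) (by linarith)

/-- Maximum principle on a square around z whose half-side, a critical point of Ai(-x), lies within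
8 of R + 1 + ‖z‖; hence 1 + ‖w‖ ≤ M(1 + ‖z‖) on its boundary. -/
theorem norm_le_of_norm_mul_airyAi_le {G : ℂ → ℂ} (hG : Differentiable ℂ G) {C B : ℝ} (hC : 0 < C)
    (hB : 0 < B)
    (hle : ∀ z, ‖G z * airyAi z‖ ≤ C * Real.exp (B * ((1 + ‖z‖) * √(1 + ‖z‖)))) :
    ∃ B' : ℝ, 0 < B' ∧ ∀ z, ‖G z‖ ≤ C * Real.exp (B' * ((1 + ‖z‖) * √(1 + ‖z‖))) := by
  obtain ⟨B₂, R, hB₂, hR, hlow⟩ := exists_exp_neg_le_norm_airyAi_square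
  set M := 2 * R + 20 with hM
  have hM0 : 0 < M := by linarith
  refine ⟨(B + B₂) * (M * √M), by positivity, fun z => ?_⟩
  obtain ⟨x, hx, hx0⟩ := exists_airyNegDeriv_eq_zero (a := R + 1 + ‖z‖)
    (by linarith [norm_nonneg z])
  have hzn := norm_nonneg z
  have hbd : Bornology.IsBounded (Ioo (-x) x ×ℂ Ioo (-x) x) :=
    (Metric.isBounded_Ioo _ _).reProdIm (Metric.isBounded_Ioo _ _)
  refine Complex.norm_le_of_forall_mem_frontier_norm_le hbd hG.diffContOnCl (fun w hw => ?_)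
    (subset_closure (?_ : z ∈ Ioo (-x) x ×ℂ Ioo (-x) x))
  · have hxx : -x ≠ x := by linarith [hx.1]
    rw [(isOpen_Ioo.reProdIm isOpen_Ioo).frontier_eq, Complex.closure_reProdIm,
      closure_Ioo hxx] at hw
    obtain ⟨⟨hw1, hw2⟩, hw3⟩ := hw
    have hre : |w.re| ≤ x := abs_le.2 hw1
    have him : |w.im| ≤ x := abs_le.2 hw2
    have hor : |w.re| = x ∨ |w.im| = x := by
      by_contra! hne
      exact hw3 ⟨abs_lt.1 (lt_of_le_of_ne hre hne.1), abs_lt.1 (lt_of_le_of_ne him hne.2)⟩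
    have hlow' := hlow x (by linarith [hx.1]) hx0 w hre him hor
    have hwn : 1 + ‖w‖ ≤ M * (1 + ‖z‖) := by
      have := Complex.norm_le_abs_re_add_abs_im w
      nlinarith [hx.2]
    have hS : (1 + ‖w‖) * √(1 + ‖w‖) ≤ M * √M * ((1 + ‖z‖) * √(1 + ‖z‖)) := by
      calc (1 + ‖w‖) * √(1 + ‖w‖) ≤ (M * (1 + ‖z‖)) * √(M * (1 + ‖z‖)) :=
            mul_le_mul hwn (Real.sqrt_le_sqrt hwn) (by positivity) (by positivity)
        _ = _ := by rw [Real.sqrt_mul hM0.le]; ring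
    set S := (1 + ‖w‖) * √(1 + ‖w‖)
    have h1 : ‖G w‖ * Real.exp (-(B₂ * S)) ≤ C * Real.exp (B * S) :=
      (mul_le_mul_of_nonneg_left hlow' (norm_nonneg _)).trans ((norm_mul _ _).symm.le.trans (hle w))
    have h2 : ‖G w‖ ≤ C * Real.exp ((B + B₂) * S) := by
      rw [Real.exp_neg, ← div_eq_mul_inv, div_le_iff₀ (Real.exp_pos _)] at h1
      rw [add_mul, Real.exp_add, ← mul_assoc]
      exact h1
    refine h2.trans (mul_le_mul_of_nonneg_left (Real.exp_le_exp.2 ?_) hC.le)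
    rw [mul_assoc (B + B₂)]
    exact mul_le_mul_of_nonneg_left hS (by positivity)
  · exact ⟨abs_lt.1 (lt_of_le_of_lt (Complex.abs_re_le_norm z) (by linarith [hx.1])),
      abs_lt.1 (lt_of_le_of_lt (Complex.abs_im_le_norm z) (by linarith [hx.1]))⟩

/-! ### The Phragmén–Lindelöf argument -/

/-- In u = log z the sector is a strip and the growth is exp(3B exp((3/2)|Re u|)). Phragmén–Lindelöf
admits it when 3/2 < π/(b - a), which is the gap condition 2π/3. -/
theorem norm_exp_le_of_sector {G : ℂ → ℂ} (hG : Differentiable ℂ G) {C B : ℝ} (hC : 0 < C)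
    (hB : 0 < B) (hle : ∀ z, ‖G z‖ ≤ C * Real.exp (B * ((1 + ‖z‖) * √(1 + ‖z‖)))) {a b K : ℝ}
    (hab : a < b) (hba : b - a < 2 * Real.pi / 3)
    (ha : ∀ u : ℂ, u.im = a → ‖G (Complex.exp u)‖ ≤ K)
    (hb : ∀ u : ℂ, u.im = b → ‖G (Complex.exp u)‖ ≤ K) {u : ℂ} (hua : a ≤ u.im)
    (hub : u.im ≤ b) : ‖G (Complex.exp u)‖ ≤ K := by
  refine PhragmenLindelof.horizontal_strip (f := fun u => G (Complex.exp u)) (a := a) (b := b)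
    (hG.comp Complex.differentiable_exp).diffContOnCl ⟨3 / 2, ?_, 3 * B, ?_⟩ ha hb hua hub
  · rw [lt_div_iff₀ (by linarith)]
    linarith
  · refine Asymptotics.IsBigO.of_bound C (Filter.Eventually.of_forall fun u => ?_)
    refine (hle _).trans ?_
    rw [Real.norm_of_nonneg (Real.exp_pos _).le, Complex.norm_exp]
    refine mul_le_mul_of_nonneg_left (Real.exp_le_exp.2 ?_) hC.le
    set e := Real.exp |u.re| with he
    have he1 : 1 ≤ e := Real.one_le_exp (abs_nonneg _)
    have h1 : 1 + Real.exp u.re ≤ 2 * e := by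
      have : Real.exp u.re ≤ e := Real.exp_le_exp.2 (le_abs_self _)
      linarith
    have h2 : Real.exp (3 / 2 * |u.re|) = e * √e := by
      rw [he, ← Real.exp_half, ← Real.exp_add]
      congr 1
      ring
    rw [h2]
    have h3 : √(2 * e) ≤ 3 / 2 * √e := by
      rw [Real.sqrt_mul (by norm_num)]
      refine mul_le_mul_of_nonneg_right ?_ (Real.sqrt_nonneg _)
      rw [Real.sqrt_le_left (by norm_num)]
      norm_num
    calc B * ((1 + Real.exp u.re) * √(1 + Real.exp u.re)) ≤ B * ((2 * e) * (3 / 2 * √e)) := by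
          refine mul_le_mul_of_nonneg_left ?_ hB.le
          exact mul_le_mul h1 ((Real.sqrt_le_sqrt h1).trans h3) (by positivity) (by positivity)
      _ = _ := by ring

theorem exists_bound_of_tendsto_ray {G : ℂ → ℂ} (hG : Differentiable ℂ G) {θ : ℝ}
    (h : Filter.Tendsto (fun r : ℝ => G (r * Complex.exp (θ * Complex.I))) Filter.atTop (nhds 0)) :
    ∃ K : ℝ, ∀ u : ℂ, u.im = θ → ‖G (Complex.exp u)‖ ≤ K := by
  have hc : Continuous fun r : ℝ => G (r * Complex.exp (θ * Complex.I)) :=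
    hG.continuous.comp (by fun_prop)
  obtain ⟨R, hR⟩ := Filter.eventually_atTop.1 (h.norm.eventually_le_const
    (by simp : ‖(0 : ℂ)‖ < 1))
  obtain ⟨K, hK⟩ := (isCompact_Icc (a := 0) (b := R)).exists_bound_of_continuousOn hc.continuousOn
  refine ⟨max K 1, fun u hu => ?_⟩
  have he : Complex.exp u = (Real.exp u.re : ℝ) * Complex.exp (θ * Complex.I) := by
    rw [← hu, Complex.ofReal_exp, ← Complex.exp_add, Complex.re_add_im]
  rw [he]
  rcases le_total (Real.exp u.re) R with h1 | h1
  · exact (hK _ ⟨(Real.exp_pos _).le, h1⟩).trans (le_max_left _ _)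
  · exact (hR _ h1).trans (le_max_right _ _)

/-- An entire function of growth at most `exp (B |z| ^ (3/2))` that tends to zero along rays whose
consecutive angles are less than `2π/3` vanishes identically. -/
theorem eq_zero_of_tendsto_rays {G : ℂ → ℂ} (hG : Differentiable ℂ G) {C B : ℝ} (hC : 0 < C)
    (hB : 0 < B) (hle : ∀ z, ‖G z‖ ≤ C * Real.exp (B * ((1 + ‖z‖) * √(1 + ‖z‖)))) {θ : ℝ}
    (hθ1 : 4 * Real.pi / 9 < θ) (hθ2 : θ < 2 * Real.pi / 3)
    (h : ∀ η ∈ ({-(8 * Real.pi / 9), -(4 * Real.pi / 9), 0, θ} : Set ℝ), Filter.Tendsto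
      (fun r : ℝ => G (r * Complex.exp (η * Complex.I))) Filter.atTop (nhds 0)) (z : ℂ) :
    G z = 0 := by
  have hpi := Real.pi_pos
  obtain ⟨K₁, hK₁⟩ := exists_bound_of_tendsto_ray hG (h (-(8 * Real.pi / 9)) (by simp))
  obtain ⟨K₂, hK₂⟩ := exists_bound_of_tendsto_ray hG (h (-(4 * Real.pi / 9)) (by simp))
  obtain ⟨K₃, hK₃⟩ := exists_bound_of_tendsto_ray hG (h 0 (by simp))
  obtain ⟨K₄, hK₄⟩ := exists_bound_of_tendsto_ray hG (h θ (by simp))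
  set K := max (max K₁ K₂) (max K₃ K₄) with hK
  have hper : ∀ u : ℂ, Complex.exp (u + 2 * Real.pi * Complex.I) = Complex.exp u :=
    Complex.exp_periodic
  have hK₁' : ∀ u : ℂ, u.im = -(8 * Real.pi / 9) → ‖G (Complex.exp u)‖ ≤ K := fun u hu =>
    (hK₁ u hu).trans ((le_max_left _ _).trans (le_max_left _ _))
  have hK₂' : ∀ u : ℂ, u.im = -(4 * Real.pi / 9) → ‖G (Complex.exp u)‖ ≤ K := fun u hu =>
    (hK₂ u hu).trans ((le_max_right _ _).trans (le_max_left _ _))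
  have hK₃' : ∀ u : ℂ, u.im = 0 → ‖G (Complex.exp u)‖ ≤ K := fun u hu =>
    (hK₃ u hu).trans ((le_max_left _ _).trans (le_max_right _ _))
  have hK₄' : ∀ u : ℂ, u.im = θ → ‖G (Complex.exp u)‖ ≤ K := fun u hu =>
    (hK₄ u hu).trans ((le_max_right _ _).trans (le_max_right _ _))
  -- The angle 10π/9 is the ray -8π/9 again; it closes the circle of sectors.
  have hK₅' : ∀ u : ℂ, u.im = 10 * Real.pi / 9 → ‖G (Complex.exp u)‖ ≤ K := fun u hu => by
    have := hper (u - 2 * Real.pi * Complex.I)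
    rw [sub_add_cancel] at this
    rw [this]
    refine hK₁' _ ?_
    simp [hu]
    ring
  have hsector : ∀ u : ℂ, -(8 * Real.pi / 9) ≤ u.im → u.im ≤ 10 * Real.pi / 9 →
      ‖G (Complex.exp u)‖ ≤ K := by
    intro u h1 h2
    rcases le_total u.im (-(4 * Real.pi / 9)) with h3 | h3
    · exact norm_exp_le_of_sector hG hC hB hle (by linarith) (by linarith) hK₁' hK₂' h1 h3
    rcases le_total u.im 0 with h4 | h4
    · exact norm_exp_le_of_sector hG hC hB hle (by linarith) (by linarith) hK₂' hK₃' h3 h4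
    rcases le_total u.im θ with h5 | h5
    · exact norm_exp_le_of_sector hG hC hB hle (by linarith) (by linarith) hK₃' hK₄' h4 h5
    · exact norm_exp_le_of_sector hG hC hB hle (by linarith) (by linarith) hK₄' hK₅' h5 h2
  have hbound : ∀ w : ℂ, w ≠ 0 → ‖G w‖ ≤ K := by
    intro w hw
    have him : (Complex.log w).im = w.arg := Complex.log_im w
    rw [← Complex.exp_log hw]
    rcases le_total (-(8 * Real.pi / 9)) w.arg with h1 | h1
    · exact hsector _ (by rw [him]; exact h1) (by rw [him]; linarith [Complex.arg_le_pi w])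
    · rw [← hper]
      have : (Complex.log w + 2 * Real.pi * Complex.I).im = w.arg + 2 * Real.pi := by simp [him]
      refine hsector _ ?_ ?_ <;> rw [this] <;> linarith [Complex.neg_pi_lt_arg w]
  have hrange : Bornology.IsBounded (range G) := by
    refine (Metric.isBounded_closedBall (x := (0 : ℂ)) (r := max K ‖G 0‖)).subset ?_
    rintro _ ⟨w, rfl⟩
    rw [mem_closedBall_zero_iff]
    rcases eq_or_ne w 0 with rfl | hw
    · exact le_max_right _ _
    · exact (hbound w hw).trans (le_max_left _ _)
  have hconst := h 0 (by simp)
  simp only [hG.apply_eq_apply_of_bounded hrange _ z] at hconst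
  exact tendsto_nhds_unique tendsto_const_nhds hconst

/-! ### Completeness of the eigenfunctions -/

theorem airyTransform_eq_zero_of_zeros {ω : ℂ} (hω : ω ≠ 0) (h0 : 0 ≤ ω.arg)
    (h1 : ω.arg < 5 * Real.pi / 18) {f : ℝ → ℂ}
    (hm : AEStronglyMeasurable f (volume.restrict (Ioi 0)))
    (hf : ∀ N, 0 < N → IntegrableOn (fun x => ‖f x‖ * Real.exp (-(N * x))) (Ioi 0))
    (h : ∀ z, airyAi z = 0 → ∫ x in Ioi (0 : ℝ), f x * airyAi (z + ω * x) = 0) (z : ℂ) :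
    ∫ x in Ioi (0 : ℝ), f x * airyAi (z + ω * x) = 0 := by
  have hpi := Real.pi_pos
  have hφ3 : ω.arg < Real.pi / 3 := by linarith
  have harg : |ω.arg| < Real.pi / 3 := by rwa [abs_of_nonneg h0]
  set F : ℂ → ℂ := fun z => ∫ x in Ioi (0 : ℝ), f x * airyAi (z + ω * x) with hF
  have hFd : Differentiable ℂ F := fun z =>
    (hasDerivAt_airyTransform hω harg zero_le_one hm (hf 1 one_pos) z).differentiableAt
  obtain ⟨G, hG, hFG⟩ := exists_entire_quotient hFd airyAi_differentiable
    (fun z hz => deriv_airyAi_ne_zero hz) h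
  obtain ⟨C, B, hC, hB, hle⟩ := norm_airyTransform_le hω harg (hf 1 one_pos)
  obtain ⟨B', hB', hle'⟩ := norm_le_of_norm_mul_airyAi_le hG hC hB fun z => by
    rw [← hFG]
    exact hle z
  -- Below π - 2 arg ω the phase is negative, below 2π/3 the gap from 0 is admissible, and above
  -- 4π/9 so is the gap to 10π/9. Compatibility of the first and last is exactly arg ω < 5π/18.
  obtain ⟨θ, hθ1, hθ2⟩ := exists_between
    (lt_min (by linarith : 4 * Real.pi / 9 < Real.pi - 2 * ω.arg)
      (by linarith : 4 * Real.pi / 9 < 2 * Real.pi / 3))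
  have hθ3 := hθ2.trans_le (min_le_left _ _)
  have hθ4 := hθ2.trans_le (min_le_right _ _)
  have hray : ∀ η : ℝ, |η| < Real.pi → |η / 2 + ω.arg| < Real.pi / 2 →
      (∀ y, 0 < y → ∃ α, 0 < α ∧ airyPhase η ω.arg α y < 0) → Filter.Tendsto
      (fun r : ℝ => G (r * Complex.exp (η * Complex.I))) Filter.atTop (nhds 0) := by
    intro η hη hηφ hneg
    rw [abs_lt] at hη hηφ
    have hcos : 0 < Real.cos (η / 2) :=
      Real.cos_pos_of_mem_Ioo ⟨by linarith [hη.1], by linarith [hη.2]⟩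
    refine (tendsto_airyTransform_div_ray h0 hφ3 hcos (Real.cos_pos_of_mem_Ioo hηφ) hneg hω rfl hm
      hf).congr' ?_
    filter_upwards [Filter.eventually_gt_atTop 0] with r hr
    have hne : airyAi (r * Complex.exp (η * Complex.I)) ≠ 0 := by
      intro hz
      obtain ⟨him, hre⟩ := im_eq_zero_and_re_neg_of_airyAi_eq_zero hz
      have harg' : (r * Complex.exp (η * Complex.I)).arg = η := by
        rw [Complex.exp_mul_I]
        exact Complex.arg_mul_cos_add_sin_mul_I hr ⟨hη.1, hη.2.le⟩
      rw [Complex.arg_eq_pi_iff.2 ⟨hre, him⟩] at harg'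
      linarith
    exact (eq_div_of_mul_eq hne (hFG _).symm).symm
  have hGz : G z = 0 := by
    refine eq_zero_of_tendsto_rays hG hC hB' hle' hθ1 hθ4 ?_ z
    rintro η (rfl | rfl | rfl | rfl)
    · refine hray _ ?_ ?_ fun y hy => airyPhase_neg_of_lower h0 h1 hy <;>
      rw [abs_lt] <;> constructor <;> linarith
    · refine hray _ ?_ ?_ fun y hy => airyPhase_neg_of_upper h0 h1 ?_ ?_ ?_ hy
      · rw [abs_lt]; constructor <;> linarith
      · rw [abs_lt]; constructor <;> linarith
      all_goals linarith
    · refine hray _ ?_ ?_ fun y hy => airyPhase_neg_of_upper h0 h1 ?_ ?_ ?_ hy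
      · rw [abs_lt]; constructor <;> linarith
      · rw [abs_lt]; constructor <;> linarith
      all_goals linarith
    · refine hray _ ?_ ?_ fun y hy => airyPhase_neg_of_upper h0 h1 ?_ ?_ ?_ hy
      · rw [abs_lt]; constructor <;> linarith
      · rw [abs_lt]; constructor <;> linarith
      all_goals linarith
  have := hFG z
  rw [hGz, zero_mul] at this
  exact this

/-- Ai is real on the real axis, so conjugating f and ω reduces negative arguments to nonnegative
ones. -/
theorem ae_eq_zero_of_airyTransform_zeros {ω : ℂ} (hω : ω ≠ 0) (harg : |ω.arg| < 5 * Real.pi / 18)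
    {f : ℝ → ℂ} (hm : AEStronglyMeasurable f (volume.restrict (Ioi 0)))
    (hf : ∀ N, 0 < N → IntegrableOn (fun x => ‖f x‖ * Real.exp (-(N * x))) (Ioi 0))
    (h : ∀ z, airyAi z = 0 → ∫ x in Ioi (0 : ℝ), f x * airyAi (z + ω * x) = 0) :
    ∀ᵐ x ∂volume.restrict (Ioi (0 : ℝ)), f x = 0 := by
  have hpi := Real.pi_pos
  wlog h0 : 0 ≤ ω.arg generalizing ω f
  · have hconj : (starRingEnd ℂ ω).arg = -ω.arg := by
      rw [Complex.arg_conj, if_neg]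
      intro h
      linarith
    have hm' : AEStronglyMeasurable (fun x => starRingEnd ℂ (f x)) (volume.restrict (Ioi 0)) :=
      Complex.continuous_conj.comp_aestronglyMeasurable hm
    have key := this (ω := starRingEnd ℂ ω) (f := fun x => starRingEnd ℂ (f x))
      ((map_ne_zero _).2 hω) (by rwa [hconj, abs_neg]) hm'
      (fun N hN => by simpa only [RCLike.norm_conj] using hf N hN) (fun z hz => ?_)
      (by rw [hconj]; linarith)
    · filter_upwards [key] with x hx
      exact (map_eq_zero _).1 hx
    · have hz' : airyAi (starRingEnd ℂ z) = 0 := by rw [airyAi_conj, hz, map_zero]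
      have h2 := congrArg (starRingEnd ℂ) (h _ hz')
      rw [← integral_conj, map_zero] at h2
      rw [← h2]
      refine integral_congr_ae (Filter.Eventually.of_forall fun x => ?_)
      simp only [map_mul]
      rw [← airyAi_conj]
      simp
  · rw [abs_of_nonneg h0] at harg
    exact ae_eq_zero_of_airyTransform_eq_zero hω (by rw [abs_of_nonneg h0]; linarith) zero_le_one hm
      (hf 1 one_pos) (airyTransform_eq_zero_of_zeros hω h0 harg hm hf h)

theorem isCompleteSystem_airyAi_line {ω : ℂ} (hω : ω ≠ 0) (harg : |ω.arg| < 5 * Real.pi / 18)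
    {t : ℕ → ℝ} (ht : {z : ℂ | airyAi z = 0} = range fun n => -(t n : ℂ)) {y : ℕ → L2HalfLine}
    (hy : ∀ n, y n =ᵐ[volume.restrict (Ioi (0 : ℝ))]
      fun x => airyAi (-(t n : ℂ) + ω * (x : ℂ))) : IsCompleteSystem y := by
  rw [IsCompleteSystem, Submodule.topologicalClosure_eq_top_iff, Submodule.eq_bot_iff]
  intro g hg
  have hgm : MemLp g 2 (volume.restrict (Ioi (0 : ℝ))) := Lp.memLp g
  have hzero := ae_eq_zero_of_airyTransform_zeros hω harg (f := fun x => starRingEnd ℂ (g x))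
    (Complex.continuous_conj.comp_aestronglyMeasurable hgm.1) (fun N hN => ?_) (fun z hz => ?_)
  · refine Lp.ext ?_
    filter_upwards [hzero, Lp.coeFn_zero ℂ 2 (volume.restrict (Ioi (0 : ℝ)))] with x hx hx0
    rw [hx0, Pi.zero_apply]
    exact (map_eq_zero _).1 hx
  · have hexp : MemLp (fun x : ℝ => (Real.exp (-(N * x)) : ℝ)) 2
        (volume.restrict (Ioi (0 : ℝ))) := by
      rw [memLp_two_iff_integrable_sq
        (by fun_prop : Continuous fun x : ℝ => Real.exp (-(N * x))).aestronglyMeasurable]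
      refine (exp_neg_integrableOn_Ioi 0 (by positivity : 0 < 2 * N)).congr
        (Filter.Eventually.of_forall fun x => ?_)
      simp only
      rw [← Real.exp_nat_mul]
      congr 1
      push_cast
      ring
    simp only [RCLike.norm_conj]
    exact hgm.norm.integrable_mul hexp
  · obtain ⟨n, rfl⟩ : z ∈ range fun n => -(t n : ℂ) := ht ▸ hz
    have h1 : inner ℂ g (y n) = 0 :=
      (Submodule.mem_orthogonal' _ _).1 hg _ (Submodule.subset_span (mem_range_self n))
    rw [L2.inner_def] at h1
    rw [← h1]
    refine integral_congr_ae ?_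
    filter_upwards [hy n] with x hx
    rw [hx, RCLike.inner_apply, mul_comm]

theorem mainTheorem1 (c : ℂ) (hc : c ≠ 0) (harg : |c.arg| < 5 * Real.pi / 6) :
    ∃ t : ℕ → ℝ, StrictMono t ∧ (∀ n, 0 < t n) ∧
      {z : ℂ | airyAi z = 0} = Set.range (fun n => -(t n : ℂ)) ∧
      (∀ μ : ℂ, (∃ y, IsEigenvectorOf (airyOperator c) μ y) ↔
        ∃ n, μ = (t n : ℂ) * c ^ (2 / 3 : ℂ)) ∧
      (∀ n, IsSimpleEigenvalue (airyOperator c) ((t n : ℂ) * c ^ (2 / 3 : ℂ))) ∧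
      ∃ y : ℕ → L2HalfLine,
        (∀ n, y n =ᵐ[volume.restrict (Ioi (0 : ℝ))]
          fun x => airyAi (-(t n : ℂ) + c ^ (1 / 3 : ℂ) * (x : ℂ))) ∧
        (∀ n, IsEigenvectorOf (airyOperator c) ((t n : ℂ) * c ^ (2 / 3 : ℂ)) (y n)) ∧
        IsCompleteSystem y ∧ IsMinimalSystem y := by
  have hpi := Real.pi_pos
  obtain ⟨t, ht, htpos, htz⟩ := exists_airyAi_zeros
  set ω : ℂ := c ^ (1 / 3 : ℂ) with hωdef
  have hω : ω ≠ 0 := by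
    rw [hωdef, Complex.cpow_def_of_ne_zero hc]
    exact Complex.exp_ne_zero _
  have hω3 : ω ^ 3 = c := by
    rw [hωdef, ← Complex.cpow_nat_mul]
    norm_num
  have hω2 : c ^ (2 / 3 : ℂ) = ω ^ 2 := by
    rw [hωdef, ← Complex.cpow_nat_mul]
    norm_num
  have hωarg : ω.arg = c.arg / 3 := by
    rw [hωdef, Complex.cpow_def_of_ne_zero hc, Complex.arg_exp]
    have him : (Complex.log c * (1 / 3)).im = c.arg / 3 := by
      rw [show (1 / 3 : ℂ) = ((1 / 3 : ℝ) : ℂ) by push_cast; rfl, Complex.im_mul_ofReal,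
        Complex.log_im]
      ring
    -- The principal cube root has argument arg c/3 with no wrap-around, so 5π/6 becomes 5π/18.
    rw [him, toIocMod_eq_self]
    exact ⟨by linarith [Complex.neg_pi_lt_arg c], by linarith [Complex.arg_le_pi c]⟩
  have harg5 : |ω.arg| < 5 * Real.pi / 18 := by
    rw [hωarg, abs_div, abs_of_pos (zero_lt_three' ℝ)]
    linarith
  have harg3 : |ω.arg| < Real.pi / 3 := by linarith
  have hz : ∀ n, airyAi (-(t n : ℂ)) = 0 := fun n => by
    have : -(t n : ℂ) ∈ {z : ℂ | airyAi z = 0} := htz ▸ mem_range_self n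
    exact this
  have hμ : ∀ n, (t n : ℂ) * c ^ (2 / 3 : ℂ) = -(ω ^ 2 * -(t n : ℂ)) := fun n => by
    rw [hω2]
    ring
  set y : ℕ → L2HalfLine := fun n => (memLp_airyAi_line hω harg3 (-(t n : ℂ))).toLp _ with hydef
  have hy : ∀ n, y n =ᵐ[volume.restrict (Ioi (0 : ℝ))]
      fun x => airyAi (-(t n : ℂ) + ω * (x : ℂ)) := fun n => MemLp.coeFn_toLp _
  have hev : ∀ n, IsEigenvectorOf (airyOperator c) ((t n : ℂ) * c ^ (2 / 3 : ℂ)) (y n) :=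
    fun n => by
      have := isEigenvectorOf_airyAi_line hω harg3 (hz n) (hy n)
      rwa [hω3, ← hμ n] at this
  refine ⟨t, ht, htpos, htz, fun μ => ⟨?_, ?_⟩, fun n => ?_, y, hy, hev,
    isCompleteSystem_airyAi_line hω harg5 htz hy, isMinimalSystem_airyAi_line hω harg3 ht hz hy⟩
  · rintro ⟨e, he⟩
    obtain ⟨he0, hmem⟩ := (isEigenvectorOf_airyOperator_iff c μ e).1 he
    rw [← hω3] at hmem
    have hzero := airyAi_eq_zero_of_eigenvector hω harg3 he0 hmem
    obtain ⟨n, hn⟩ : -(μ / ω ^ 2) ∈ range fun n => -(t n : ℂ) := htz ▸ hzero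
    refine ⟨n, ?_⟩
    rw [hω2, neg_injective hn, div_mul_cancel₀ _ (pow_ne_zero 2 hω)]
  · rintro ⟨n, rfl⟩
    exact ⟨y n, hev n⟩
  · have := isSimpleEigenvalue_airyOperator hω harg3 (hz n)
    rwa [hω3, ← hμ n] at this
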